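/- Let $n\ge 2$ be an integer and $1<b<n$ a real number. Let $\mathcal S$ be the space of complex-valued Schwartz functions on $\mathbb R^n$, write $x=r\omega$ with $r\ge 0$ and $\omega\in S^{n-1}$, and let $L^q_\omega=L^q(S^{n-1})$ with respect to surface measure. Let $\mathrm D^{a}=(-\Delta)^{a/2}$ be the Fourier multiplier with symbol $|\xi|^{a}$ (for the Fourier transform with kernel $e^{-ix\cdot\xi}$), and let $\Lambda_\omega^{s}=(1-\Delta_\omega)^{s/2}$, where $\Delta_\omega=\sum_{1\le i<j\le n}(x_i\partial_j-x_j\partial_i)^2$ is the Laplace–Beltrami operator on $S^{n-1}$; that is, $\Lambda_\omega^s$ acts in the variable $\omega$ and multiplies the component of $f(r\,\cdot)$ in the spherical harmonics of degree $k$ by $(1+k(k+n-2))^{s/2}$. There is a constant $C$ depending only on $n$ and $b$ such that, for every $f\in\mathcal S$, $$\sup_{r>0}\ r^{\frac{n-b}{2}}\,\|f(r\omega)\|_{L^2_\omega}\le C\,\bigl\|\mathrm D^{\frac b2}\Lambda_\omega^{\frac{1-b}{2}}f\bigr\|_{L^2(\mathbb R^n)}$$ and $$\bigl\|\mathrm D^{-\frac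 b2}\Lambda_\omega^{\frac{b-1}{2}}f\bigr\|_{L^2(\mathbb R^n)}\le C\int_0^\infty r^{\frac{b-n}{2}}\,\|f(r\omega)\|_{L^2_\omega}\,r^{n-1}\,dr .$$ Moreover, for every real $s>\frac{n-b}{2}$ there is a constant $C$ depending only on $n$, $b$ and $s$ such that, for every $f\in\mathcal S$, $$\sup_{r>0}\ r^{\frac{n-b}{2}}\,\|f(r\omega)\|_{L^\infty_\omega}\le C\,\bigl\|\mathrm D^{\frac b2}\Lambda_\omega^{s}f\bigr\|_{L^2(\mathbb R^n)} .$$ -/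

import Mathlib

open MeasureTheory Set
open scoped FourierTransform SchwartzMap ENNReal NNReal

noncomputable section

namespace AngularSobolev

/-- Euclidean space `ℝⁿ`. -/
abbrev Eucl (n : ℕ) : Type := EuclideanSpace ℝ (Fin n)

/-- The unit sphere `S^{n-1} ⊆ ℝⁿ`. -/
abbrev Sph (n : ℕ) : Type := Metric.sphere (0 : Eucl n) 1

/-- The surface measure `dω` on `S^{n-1}`. -/
abbrev surf (n : ℕ) : Measure (Sph n) := (volume : Measure (Eucl n)).toSphere

/-! ### Spherical harmonics -/

/-- The Laplacian `∑ ∂ᵢ²` on polynomials. -/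
def polyLaplacian (n : ℕ) : MvPolynomial (Fin n) ℂ →ₗ[ℂ] MvPolynomial (Fin n) ℂ :=
  ∑ i, (MvPolynomial.pderiv i).toLinearMap ∘ₗ (MvPolynomial.pderiv i).toLinearMap

/-- The homogeneous harmonic polynomials of degree `k` in `n` variables. -/
def harmonicPolys (n k : ℕ) : Submodule ℂ (MvPolynomial (Fin n) ℂ) :=
  MvPolynomial.homogeneousSubmodule (Fin n) ℂ k ⊓ LinearMap.ker (polyLaplacian n)

/-- Restriction of a polynomial to the sphere. -/
def restrictPoly (n : ℕ) : MvPolynomial (Fin n) ℂ →ₗ[ℂ] C(Sph n, ℂ) where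
  toFun p :=
    { toFun := fun ω => MvPolynomial.eval (fun i => (((ω : Eucl n) i : ℝ) : ℂ)) p
      continuous_toFun := (MvPolynomial.continuous_eval p).comp (by fun_prop) }
  map_add' p q := by ext; simp
  map_smul' c p := by ext; simp

/-- The space `𝓗_k` of spherical harmonics of degree `k` on `S^{n-1}`. -/
def sphericalHarmonics (n k : ℕ) : Submodule ℂ C(Sph n, ℂ) :=
  (harmonicPolys n k).map (restrictPoly n)

/-- The inclusion of the continuous functions in `L²(S^{n-1})`. -/
def toL2 (n : ℕ) : C(Sph n, ℂ) →ₗ[ℂ] Lp ℂ 2 (surf n) :=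
  (ContinuousMap.toLp (E := ℂ) 2 (surf n) ℂ).toLinearMap

theorem toL2_injective (n : ℕ) : Function.Injective (toL2 n) :=
  ContinuousMap.toLp_injective (surf n)

/-- `𝓗_k` as a subspace of `L²(S^{n-1})`. -/
def sphericalHarmonicsL2 (n k : ℕ) : Submodule ℂ (Lp ℂ 2 (surf n)) :=
  (sphericalHarmonics n k).map (toL2 n)

instance finiteDimensional_harmonicPolys (n k : ℕ) :
    FiniteDimensional ℂ (harmonicPolys n k) := by
  have h : harmonicPolys n k ≤ MvPolynomial.restrictTotalDegree (Fin n) ℂ k := by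
    intro p hp
    rw [MvPolynomial.mem_restrictTotalDegree]
    exact MvPolynomial.IsHomogeneous.totalDegree_le hp.1
  exact Submodule.finiteDimensional_of_le h

instance finiteDimensional_sphericalHarmonicsL2 (n k : ℕ) :
    FiniteDimensional ℂ (sphericalHarmonicsL2 n k) := by
  unfold sphericalHarmonicsL2 sphericalHarmonics
  infer_instance

/-- The `L²(S^{n-1})`-orthogonal projection of `g` onto `𝓗_k`, as a continuous function. -/
def harmonicPart (n k : ℕ) (g : C(Sph n, ℂ)) : C(Sph n, ℂ) :=
  ((Submodule.equivMapOfInjective (toL2 n) (toL2_injective n) (sphericalHarmonics n k)).symm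
    ((sphericalHarmonicsL2 n k).orthogonalProjectionOnto (toL2 n g)) :
      sphericalHarmonics n k)

/-- The rotation field `Ω_{ij} = xᵢ ∂ⱼ - xⱼ ∂ᵢ`, acting on polynomials. -/
def rotField {n : ℕ} (i j : Fin n) (p : MvPolynomial (Fin n) ℂ) : MvPolynomial (Fin n) ℂ :=
  MvPolynomial.X i * MvPolynomial.pderiv j p - MvPolynomial.X j * MvPolynomial.pderiv i p

/-- The Laplace-Beltrami operator `Δ_ω = ∑_{i<j} Ω_{ij}²`, acting on polynomials. -/
def angularLaplacian {n : ℕ} (p : MvPolynomial (Fin n) ℂ) : MvPolynomial (Fin n) ℂ :=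
  ∑ i : Fin n, ∑ j ∈ Finset.Ioi i, rotField i j (rotField i j p)

/-- The eigenvalue `k (k + n - 2)` of `-Δ_ω` on the spherical harmonics of degree `k`. -/
def sphEigenvalue (n k : ℕ) : ℝ := (k : ℝ) * ((k : ℝ) + (n : ℝ) - 2)

theorem sum_lt_add_swap {n : ℕ} {M : Type*} [AddCommGroup M] (G : Fin n → Fin n → M) :
    ∑ i : Fin n, ∑ j ∈ Finset.Ioi i, (G i j + G j i) = ∑ i, ∑ j, G i j - ∑ i, G i i := by
  have h1 : ∀ i : Fin n, ∑ j, G i j =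
      ∑ j ∈ Finset.Ioi i, G i j + G i i + ∑ j ∈ Finset.Iio i, G i j := by
    intro i
    rw [← Finset.sum_filter_add_sum_filter_not Finset.univ (fun j => i ≤ j)]
    congr 1
    · have : Finset.univ.filter (fun j => i ≤ j) = insert i (Finset.Ioi i) := by
        ext j; simp [le_iff_eq_or_lt]
      rw [this, Finset.sum_insert (by simp), add_comm]
    · congr 1
      ext j; simp
  have h2 : ∑ i : Fin n, ∑ j ∈ Finset.Iio i, G i j = ∑ i : Fin n, ∑ j ∈ Finset.Ioi i, G j i :=
    Finset.sum_comm' (by intro x y; simp)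
  simp only [h1, Finset.sum_add_distrib, h2]
  abel

theorem pderiv_comm {n : ℕ} (i j : Fin n) (p : MvPolynomial (Fin n) ℂ) :
    MvPolynomial.pderiv i (MvPolynomial.pderiv j p) =
      MvPolynomial.pderiv j (MvPolynomial.pderiv i p) := by
  have h : ⁅(MvPolynomial.pderiv i : Derivation ℂ (MvPolynomial (Fin n) ℂ) (MvPolynomial (Fin n) ℂ)),
      (MvPolynomial.pderiv j :
        Derivation ℂ (MvPolynomial (Fin n) ℂ) (MvPolynomial (Fin n) ℂ))⁆ = 0 := by
    refine MvPolynomial.derivation_ext (R := ℂ) fun l => ?_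
    simp [Derivation.commutator_apply, MvPolynomial.pderiv_X, Pi.single_apply, apply_ite]
  have := congrArg (fun D : Derivation ℂ (MvPolynomial (Fin n) ℂ) (MvPolynomial (Fin n) ℂ) => D p) h
  simpa [Derivation.commutator_apply, sub_eq_zero] using this

/-- Spherical harmonics of degree `k` are eigenfunctions of `-Δ_ω`, with eigenvalue
`k (k + n - 2)`. -/
theorem angularLaplacian_eq {n k : ℕ} {p : MvPolynomial (Fin n) ℂ} (hp : p ∈ harmonicPolys n k) :
    angularLaplacian p = ((-sphEigenvalue n k : ℝ) : ℂ) • p := by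
  obtain ⟨hk, hΔ⟩ := hp
  have hk : p.IsHomogeneous k := hk
  have hΔ : ∑ j, MvPolynomial.pderiv j (MvPolynomial.pderiv j p) = 0 := by
    simpa [polyLaplacian] using hΔ
  have hE : ∑ i, MvPolynomial.X i * MvPolynomial.pderiv i p = (k : MvPolynomial (Fin n) ℂ) * p := by
    rw [hk.sum_X_mul_pderiv, nsmul_eq_mul]
  have hE2 : ∀ i, ∑ j, MvPolynomial.X j * MvPolynomial.pderiv j (MvPolynomial.pderiv i p) =
      ((k : MvPolynomial (Fin n) ℂ) - 1) * MvPolynomial.pderiv i p := by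
    intro i
    have h := congrArg (MvPolynomial.pderiv i) hE
    simp only [map_sum, Derivation.leibniz, smul_eq_mul, MvPolynomial.pderiv_X,
      Finset.sum_add_distrib, Derivation.map_natCast, mul_zero, add_zero] at h
    have h3 : ∑ j, MvPolynomial.pderiv j p * (Pi.single i 1 : Fin n → MvPolynomial (Fin n) ℂ) j =
        MvPolynomial.pderiv i p := by
      simp [Pi.single_apply]
    have h4 : ∀ j, MvPolynomial.pderiv i (MvPolynomial.pderiv j p) =
        MvPolynomial.pderiv j (MvPolynomial.pderiv i p) := fun j => pderiv_comm i j p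
    simp only [h4] at h
    rw [h3] at h
    linear_combination h
  let G : Fin n → Fin n → MvPolynomial (Fin n) ℂ := fun i j =>
    MvPolynomial.X i ^ 2 * MvPolynomial.pderiv j (MvPolynomial.pderiv j p)
      - MvPolynomial.X i * (MvPolynomial.X j * MvPolynomial.pderiv j (MvPolynomial.pderiv i p))
      - MvPolynomial.X i * MvPolynomial.pderiv i p
  have hF : ∀ i : Fin n, ∀ j ∈ Finset.Ioi i, rotField i j (rotField i j p) = G i j + G j i := by
    intro i j hj
    have hij : i ≠ j := (Finset.mem_Ioi.1 hj).ne
    simp only [rotField, G, map_sub, MvPolynomial.pderiv_mul, MvPolynomial.pderiv_X_self,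
      MvPolynomial.pderiv_X_of_ne hij, MvPolynomial.pderiv_X_of_ne hij.symm]
    rw [pderiv_comm i j p]
    ring
  have hG1 : ∀ i, G i i = -(MvPolynomial.X i * MvPolynomial.pderiv i p) := by
    intro i
    simp only [G]
    ring
  have hG2 : ∀ i, ∑ j, G i j = -(((k : MvPolynomial (Fin n) ℂ) - 1 + (n : MvPolynomial (Fin n) ℂ)) *
      (MvPolynomial.X i * MvPolynomial.pderiv i p)) := by
    intro i
    simp only [G, Finset.sum_sub_distrib, ← Finset.mul_sum, hΔ, hE2, Finset.sum_const,
      Finset.card_univ, Fintype.card_fin, nsmul_eq_mul]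
    ring
  have hc : (((-sphEigenvalue n k : ℝ) : ℂ)) • p =
      (-((k : MvPolynomial (Fin n) ℂ) * (k + (n : MvPolynomial (Fin n) ℂ) - 2))) * p := by
    have h2 : (MvPolynomial.C (2 : ℂ) : MvPolynomial (Fin n) ℂ) = 2 := map_ofNat _ 2
    rw [MvPolynomial.smul_eq_C_mul]
    simp [sphEigenvalue, h2]
  rw [hc, angularLaplacian, Finset.sum_congr rfl fun i _ => Finset.sum_congr rfl (hF i),
    sum_lt_add_swap]
  simp only [hG1, hG2, Finset.sum_neg_distrib, ← Finset.mul_sum, hE]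
  ring

/-! ### The angular operator and the fractional Laplacian -/

/-- The restriction `ω ↦ f (r ω)` of a Schwartz function to the sphere of radius `r`. -/
def restrictSphere {n : ℕ} (f : 𝓢(Eucl n, ℂ)) (r : ℝ) : C(Sph n, ℂ) where
  toFun ω := f (r • (ω : Eucl n))
  continuous_toFun := f.continuous.comp (by fun_prop)

/-- The operator `Λ_ω^s = (1 - Δ_ω)^{s/2}`, acting on Schwartz functions in the angular variable
by the expansion in spherical harmonics. The value at the origin, where `f` restricts to a constant,
is `f 0`. -/
def angularPow {n : ℕ} (s : ℝ) (f : 𝓢(Eucl n, ℂ)) (x : Eucl n) : ℂ :=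
  if hx : x = 0 then f 0
  else ∑' k : ℕ, (((1 + sphEigenvalue n k) ^ (s / 2) : ℝ) : ℂ) *
    harmonicPart n k (restrictSphere f ‖x‖) ⟨‖x‖⁻¹ • x, by simp [norm_smul, hx]⟩

/-- The operator `D^a = (-Δ)^{a/2}`: the Fourier multiplier with symbol `|2πξ|^a`, for the Fourier
transform `ĝ(ξ) = ∫ g(x) exp(-2πi x·ξ) dx`. -/
def fracD {n : ℕ} (a : ℝ) (g : Eucl n → ℂ) : Eucl n → ℂ :=
  𝓕⁻ (fun ξ : Eucl n => (((2 * Real.pi * ‖ξ‖) ^ a : ℝ) : ℂ) * 𝓕 g ξ)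

/-- The norm of `ω ↦ g (r ω)` in `L^q(S^{n-1})`. -/
def sphereNorm {n : ℕ} (q : ℝ≥0∞) (g : Eucl n → ℂ) (r : ℝ) : ℝ≥0∞ :=
  eLpNorm (fun ω : Sph n => g (r • (ω : Eucl n))) q (surf n)

/-- The norm of `g` in `L¹_{|x|^{n-1} d|x|} L²_ω`. -/
def mixedNorm {n : ℕ} (g : Eucl n → ℂ) : ℝ≥0∞ :=
  ∫⁻ r in Ioi (0 : ℝ), sphereNorm 2 g r * ENNReal.ofReal (r ^ (n - 1))

end AngularSobolev

end

/-!
The functions are expanded in spherical harmonics. The Fourier transform preserves the degree `k`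
of a component, and `D^a` and `Λ_ω^s` are diagonal on the expansion, so the norms of `D^a Λ_ω^s f`
are sums of the weighted energies `∫ |ξ|^{2a} |ĝ_k(ξ)|² dξ` of the components, and it suffices to
treat a single degree with a constant of the correct growth in `k`.

For one degree everything follows from the weighted restriction estimate
`∫ |ξ|^{-b} |(Y dω)^(ξ)|² dξ ≤ C (k + 1)^{1 - b} ‖Y‖²` for spherical harmonics `Y` of degree `k`. At
frequencies `|ξ| ≲ k` the transform of `Y dω` is exponentially small in `k`, because `Y` is
orthogonal to the Taylor polynomial of degree `< k` of the plane wave, and the weight is integrable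
at `0` because `b < n`. At higher frequencies the Agmon–Hörmander bound
`∫_{|ξ| ≤ R} |(Y dω)^|² ≤ C R ‖Y‖²` is summed over dyadic shells, which uses `1 < b`. The first
inequality then follows from Cauchy–Schwarz in `ξ` and the second one from Minkowski's inequality
in `r`. For the last one, the addition theorem gives `‖Y‖_∞² ≤ C (k + 1)^{n - 2} ‖Y‖₂²`, and the
sum over `k` converges since `s > (n - b) / 2`.
-/

noncomputable section

namespace AngularSobolev

section PolarCoordinates

variable {E F : Type*} [NormedAddCommGroup E] [NormedSpace ℝ E] [FiniteDimensional ℝ E]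
  [MeasurableSpace E] [BorelSpace E] {μ : Measure E} [μ.IsAddHaarMeasure]
  [NormedAddCommGroup F] [NormedSpace ℝ F]

theorem norm_smul_coe_sphere {E : Type*} [SeminormedAddCommGroup E] [NormedSpace ℝ E] {r : ℝ}
    (hr : 0 ≤ r) (ω : Metric.sphere (0 : E) 1) : ‖r • (ω : E)‖ = r := by
  rw [norm_smul, norm_eq_of_mem_sphere, mul_one, Real.norm_of_nonneg hr]

theorem measurableEmbedding_smul_sphere : MeasurableEmbedding
    fun q : Metric.sphere (0 : E) 1 × Ioi (0 : ℝ) => (q.2 : ℝ) • (q.1 : E) :=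
  (MeasurableEmbedding.subtype_coe (measurableSet_singleton (0 : E)).compl).comp
    (homeomorphUnitSphereProd E).symm.measurableEmbedding

theorem measurePreserving_smul_sphere [Nontrivial E] : MeasurePreserving
    (fun q : Metric.sphere (0 : E) 1 × Ioi (0 : ℝ) => (q.2 : ℝ) • (q.1 : E))
    (μ.toSphere.prod (.volumeIoiPow (Module.finrank ℝ E - 1))) μ := by
  have hcoe : MeasurePreserving ((↑) : ({0}ᶜ : Set E) → E) (μ.comap (↑)) μ := by
    have h := measurePreserving_subtype_coe (μa := μ) (measurableSet_singleton (0 : E)).compl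
    rwa [restrict_compl_singleton] at h
  exact hcoe.comp (μ.measurePreserving_homeomorphUnitSphereProd.symm
    (homeomorphUnitSphereProd E).toMeasurableEquiv)

theorem lintegral_eq_lintegral_Ioi_toSphere [Nontrivial E] {f : E → ℝ≥0∞} (hf : Measurable f) :
    ∫⁻ x, f x ∂μ = ∫⁻ r in Ioi (0 : ℝ), ENNReal.ofReal (r ^ (Module.finrank ℝ E - 1)) *
      ∫⁻ ω, f (r • (ω : E)) ∂μ.toSphere := by
  have hF : Measurable fun q : Metric.sphere (0 : E) 1 × Ioi (0 : ℝ) => f ((q.2 : ℝ) • (q.1 : E)) :=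
    hf.comp measurableEmbedding_smul_sphere.measurable
  rw [← measurePreserving_smul_sphere.lintegral_comp hf,
    lintegral_prod_symm _ hF.aemeasurable, Measure.volumeIoiPow,
    lintegral_withDensity_eq_lintegral_mul _ (by fun_prop) hF.lintegral_prod_left']
  exact lintegral_subtype_comap measurableSet_Ioi
    fun r : ℝ => ENNReal.ofReal (r ^ (Module.finrank ℝ E - 1)) * ∫⁻ ω, f (r • (ω : E)) ∂μ.toSphere

theorem integral_eq_integral_Ioi_toSphere [Nontrivial E] {f : E → F} (hf : Integrable f μ) :
    ∫ x, f x ∂μ = ∫ r in Ioi (0 : ℝ), r ^ (Module.finrank ℝ E - 1) •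
      ∫ ω, f (r • (ω : E)) ∂μ.toSphere := by
  have hF : Integrable (fun q : Metric.sphere (0 : E) 1 × Ioi (0 : ℝ) => f ((q.2 : ℝ) • (q.1 : E)))
      (μ.toSphere.prod (.volumeIoiPow (Module.finrank ℝ E - 1))) :=
    (measurePreserving_smul_sphere.integrable_comp_emb measurableEmbedding_smul_sphere).2 hf
  rw [← measurePreserving_smul_sphere.integral_comp measurableEmbedding_smul_sphere,
    integral_prod_symm _ hF]
  simp only [Measure.volumeIoiPow, ENNReal.ofReal]
  rw [integral_withDensity_eq_integral_smul (by fun_prop),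
    integral_subtype_comap measurableSet_Ioi fun r : ℝ =>
      Real.toNNReal (r ^ (Module.finrank ℝ E - 1)) • ∫ ω, f (r • (ω : E)) ∂μ.toSphere]
  refine setIntegral_congr_fun measurableSet_Ioi fun r hr => ?_
  rw [NNReal.smul_def, Real.coe_toNNReal _ (pow_nonneg (le_of_lt hr) _)]

end PolarCoordinates

section SphereMap

variable {E : Type*} [NormedAddCommGroup E] [NormedSpace ℝ E]

/-- The homeomorphism of the unit sphere induced by a linear isometry. -/
def sphereMap (e : E ≃ₗᵢ[ℝ] E) : Metric.sphere (0 : E) 1 ≃ₜ Metric.sphere (0 : E) 1 :=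
  e.toHomeomorph.subtype fun x => by simp

theorem coe_sphereMap (e : E ≃ₗᵢ[ℝ] E) (ω : Metric.sphere (0 : E) 1) :
    (sphereMap e ω : E) = e ω := rfl

open scoped Pointwise in
theorem measurePreserving_sphereMap [MeasurableSpace E] [BorelSpace E] {μ : Measure E}
    (e : E ≃ₗᵢ[ℝ] E) (he : MeasurePreserving e μ μ) :
    MeasurePreserving (sphereMap e) μ.toSphere μ.toSphere := by
  refine ⟨(sphereMap e).measurable, Measure.ext fun s hs => ?_⟩
  rw [Measure.map_apply (sphereMap e).measurable hs, μ.toSphere_apply' hs,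
    μ.toSphere_apply' ((sphereMap e).measurable hs),
    ← he.measure_preimage_equiv (f := e.toHomeomorph.toMeasurableEquiv)
      (Ioo (0 : ℝ) 1 • (Subtype.val '' s))]
  congr 2
  ext x
  simp only [mem_smul, mem_image, mem_preimage]
  constructor
  · rintro ⟨r, hr, -, ⟨ω, hω, rfl⟩, rfl⟩
    exact ⟨r, hr, _, ⟨sphereMap e ω, hω, rfl⟩, (map_smul e r (ω : E)).symm⟩
  · rintro ⟨r, hr, -, ⟨ω, hω, rfl⟩, hx⟩
    refine ⟨r, hr, _, ⟨(sphereMap e).symm ω, by simpa using hω, rfl⟩, e.injective ?_⟩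
    rw [map_smul, ← coe_sphereMap, Homeomorph.apply_symm_apply]
    exact hx

end SphereMap

section PolynomialEvaluation

variable {n : ℕ}

/-- Evaluation of complex polynomials at a real point. -/
def polyEval (x : Eucl n) : MvPolynomial (Fin n) ℂ →ₐ[ℂ] ℂ :=
  MvPolynomial.aeval fun i => ((x i : ℝ) : ℂ)

@[simp] theorem polyEval_X (x : Eucl n) (i : Fin n) :
    polyEval x (MvPolynomial.X i) = ((x i : ℝ) : ℂ) :=
  MvPolynomial.aeval_X _ i

@[simp] theorem polyEval_C (x : Eucl n) (c : ℂ) : polyEval x (MvPolynomial.C c) = c :=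
  MvPolynomial.aeval_C _ c

@[simp] theorem restrictPoly_apply (p : MvPolynomial (Fin n) ℂ) (ω : Sph n) :
    restrictPoly n p ω = polyEval ω p := rfl

@[fun_prop] theorem continuous_polyEval {X : Type*} [TopologicalSpace X] {γ : X → Eucl n}
    (hγ : Continuous γ) (p : MvPolynomial (Fin n) ℂ) : Continuous fun x => polyEval (γ x) p :=
  (MvPolynomial.continuous_eval p).comp (by fun_prop)

theorem hasDerivAt_polyEval {γ : ℝ → Eucl n} {γ' : Fin n → ℝ} {t : ℝ}
    (hγ : ∀ l, HasDerivAt (fun s => γ s l) (γ' l) t) (p : MvPolynomial (Fin n) ℂ) :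
    HasDerivAt (fun s => polyEval (γ s) p)
      (∑ l, (γ' l : ℂ) * polyEval (γ t) (MvPolynomial.pderiv l p)) t := by
  induction p using MvPolynomial.induction_on with
  | C a => simpa using hasDerivAt_const t a
  | add p q hp hq =>
    simp only [map_add, mul_add, Finset.sum_add_distrib]
    exact hp.add hq
  | mul_X p i hp =>
    simp only [map_mul, polyEval_X, MvPolynomial.pderiv_mul, map_add, mul_add,
      Finset.sum_add_distrib, MvPolynomial.pderiv_X]
    convert! hp.mul (hγ i).ofReal_comp using 2
    · simp only [Finset.sum_mul, mul_assoc]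
    · rw [Finset.sum_eq_single i]
      · simp [mul_comm]
      · intro l _ hl
        simp [hl.symm]
      · simp

end PolynomialEvaluation

section PlaneRotation

variable {n : ℕ} {i j : Fin n}

/-- The rotation by the angle `θ` in the `(xᵢ, xⱼ)`-plane: the flow of the field `Ω_{ij}`. -/
def planeRotation (hij : i ≠ j) (θ : ℝ) : Eucl n ≃ₗᵢ[ℝ] Eucl n :=
  LinearIsometry.toLinearIsometryEquiv
    { toFun := fun x => WithLp.toLp 2 fun l =>
        if l = i then Real.cos θ * x i - Real.sin θ * x j
        else if l = j then Real.sin θ * x i + Real.cos θ * x j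
        else x l
      map_add' := fun x y => by
        ext l
        simp only [PiLp.add_apply]
        split_ifs <;> ring
      map_smul' := fun c x => by
        ext l
        simp only [PiLp.smul_apply, smul_eq_mul, RingHom.id_apply]
        split_ifs <;> ring
      norm_map' := fun x => by
        rw [← sq_eq_sq₀ (norm_nonneg _) (norm_nonneg _), ← sub_eq_zero]
        simp only [EuclideanSpace.real_norm_sq_eq, ← Finset.sum_sub_distrib]
        rw [Fintype.sum_eq_add i j hij fun l hl => by simp [hl.1, hl.2]]
        simp only [LinearMap.coe_mk, AddHom.coe_mk, if_true, hij.symm, if_false]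
        linear_combination (x i ^ 2 + x j ^ 2) * Real.sin_sq_add_cos_sq θ }
    rfl

theorem planeRotation_apply (hij : i ≠ j) (θ : ℝ) (x : Eucl n) (l : Fin n) :
    planeRotation hij θ x l =
      if l = i then Real.cos θ * x i - Real.sin θ * x j
      else if l = j then Real.sin θ * x i + Real.cos θ * x j
      else x l := rfl

theorem hasDerivAt_polyEval_planeRotation (hij : i ≠ j) (p : MvPolynomial (Fin n) ℂ) (x : Eucl n)
    (θ : ℝ) : HasDerivAt (fun t => polyEval (planeRotation hij t x) p)
      (polyEval (planeRotation hij θ x) (rotField i j p)) θ := by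
  let y := planeRotation hij θ x
  have hγ (l : Fin n) : HasDerivAt (fun t => planeRotation hij t x l)
      (if l = i then - y j else if l = j then y i else 0) θ := by
    have hc := Real.hasDerivAt_cos θ
    have hs := Real.hasDerivAt_sin θ
    simp only [y, planeRotation_apply, hij.symm, if_true, if_false]
    split_ifs
    · convert! (hc.mul_const (x i)).sub (hs.mul_const (x j)) using 1
      ring
    · convert! (hs.mul_const (x i)).add (hc.mul_const (x j)) using 1
      ring
    · exact hasDerivAt_const θ (x l)
  convert! hasDerivAt_polyEval hγ p using 1
  rw [Fintype.sum_eq_add i j hij fun l hl => by simp [hl.1, hl.2]]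
  simp only [rotField, map_sub, map_mul, polyEval_X, hij.symm, if_true, if_false]
  push_cast
  ring

end PlaneRotation

section RotationFields

variable {n : ℕ}

theorem rotField_mul (i j : Fin n) (p q : MvPolynomial (Fin n) ℂ) :
    rotField i j (p * q) = rotField i j p * q + p * rotField i j q := by
  simp only [rotField, MvPolynomial.pderiv_mul]
  ring

theorem rotField_sum {ι : Type*} (s : Finset ι) (i j : Fin n) (p : ι → MvPolynomial (Fin n) ℂ) :
    rotField i j (∑ a ∈ s, p a) = ∑ a ∈ s, rotField i j (p a) := by
  simp only [rotField, map_sum, Finset.mul_sum, Finset.sum_sub_distrib]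

theorem integrable_sphere {E : Type*} [NormedAddCommGroup E] {f : Sph n → E} (hf : Continuous f) :
    Integrable f (surf n) :=
  hf.integrable_of_hasCompactSupport (HasCompactSupport.of_compactSpace f)

theorem integral_planeRotation {E : Type*} [NormedAddCommGroup E] [NormedSpace ℝ E] {i j : Fin n}
    (hij : i ≠ j) (θ : ℝ) (f : Eucl n → E) :
    ∫ ω : Sph n, f (planeRotation hij θ ω) ∂surf n = ∫ ω : Sph n, f ω ∂surf n :=
  (measurePreserving_sphereMap _ (planeRotation hij θ).measurePreserving).integral_comp
    (sphereMap _).measurableEmbedding fun ω : Sph n => f ω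

/-- The mean of `Ω_{ij} p` over the sphere is its mean along the orbits of the rotations in the
`(xᵢ, xⱼ)`-plane, along which `Ω_{ij} p` is the derivative of a periodic function. -/
theorem integral_rotField (p : MvPolynomial (Fin n) ℂ) (i j : Fin n) :
    ∫ ω : Sph n, polyEval ω (rotField i j p) ∂surf n = 0 := by
  rcases eq_or_ne i j with rfl | hij
  · simp [rotField]
  set F : ℝ → Sph n → ℂ := fun θ ω => polyEval (planeRotation hij θ ω) (rotField i j p)
  have hcont : Continuous (Function.uncurry F) := by
    refine continuous_polyEval ((PiLp.continuous_toLp 2 _).comp (continuous_pi fun l => ?_)) _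
    dsimp only
    split_ifs <;> fun_prop
  have hint : Integrable (Function.uncurry F)
      ((volume.restrict (Ioc 0 (2 * Real.pi))).prod (surf n)) :=
    .of_bound hcont.aestronglyMeasurable ‖restrictPoly n (rotField i j p)‖
      (ae_of_all _ fun q => (restrictPoly n (rotField i j p)).norm_coe_le_norm
        (sphereMap (planeRotation hij q.1) q.2))
  have horbit (ω : Sph n) : ∫ θ in Ioc 0 (2 * Real.pi), F θ ω = 0 := by
    rw [← intervalIntegral.integral_of_le (by positivity),
      intervalIntegral.integral_eq_sub_of_hasDerivAt
        (fun θ _ => hasDerivAt_polyEval_planeRotation hij p ω θ)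
        ((hcont.comp (by fun_prop : Continuous fun θ : ℝ => (θ, ω))).intervalIntegrable _ _),
      sub_eq_zero]
    congr 2
    ext l
    simp [planeRotation_apply]
  have hswap := integral_integral_swap hint
  simp only [F, horbit, integral_zero, integral_planeRotation hij _ fun x =>
    polyEval x (rotField i j p), integral_const] at hswap
  refine (smul_eq_zero.1 hswap).resolve_left ?_
  simp [Real.pi_ne_zero, Real.pi_pos.le]

theorem integral_rotField_mul (p q : MvPolynomial (Fin n) ℂ) (i j : Fin n) :
    ∫ ω : Sph n, polyEval ω (rotField i j p) * polyEval ω q ∂surf n =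
      -∫ ω : Sph n, polyEval ω p * polyEval ω (rotField i j q) ∂surf n := by
  have h := integral_rotField (p * q) i j
  simp only [rotField_mul, map_add, map_mul] at h
  rw [integral_add (integrable_sphere (by fun_prop)) (integrable_sphere (by fun_prop))] at h
  exact eq_neg_of_add_eq_zero_left h

theorem integral_angularLaplacian_mul (p q : MvPolynomial (Fin n) ℂ) :
    ∫ ω : Sph n, polyEval ω (angularLaplacian p) * polyEval ω q ∂surf n =
      -∑ i : Fin n, ∑ j ∈ Finset.Ioi i, ∫ ω : Sph n,
        polyEval ω (rotField i j p) * polyEval ω (rotField i j q) ∂surf n := by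
  simp only [angularLaplacian, map_sum, Finset.sum_mul]
  rw [integral_finsetSum _ fun i _ => integrable_sphere (by fun_prop), ← Finset.sum_neg_distrib]
  refine Finset.sum_congr rfl fun i _ => ?_
  rw [integral_finsetSum _ fun j _ => integrable_sphere (by fun_prop), ← Finset.sum_neg_distrib]
  exact Finset.sum_congr rfl fun j _ => integral_rotField_mul _ _ i j

theorem integral_angularLaplacian_mul_comm (p q : MvPolynomial (Fin n) ℂ) :
    ∫ ω : Sph n, polyEval ω (angularLaplacian p) * polyEval ω q ∂surf n =
      ∫ ω : Sph n, polyEval ω p * polyEval ω (angularLaplacian q) ∂surf n := by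
  rw [integral_angularLaplacian_mul]
  simp_rw [mul_comm (polyEval _ p), integral_angularLaplacian_mul, mul_comm]

end RotationFields

section HarmonicPolynomials

open MvPolynomial

variable {n : ℕ}

/-- Complex conjugation of the coefficients of a polynomial, that is, of its values at real
points. -/
def polyConj : MvPolynomial (Fin n) ℂ →+* MvPolynomial (Fin n) ℂ :=
  MvPolynomial.map (starRingEnd ℂ)

@[simp] theorem polyEval_polyConj (p : MvPolynomial (Fin n) ℂ) (x : Eucl n) :
    polyEval x (polyConj p) = starRingEnd ℂ (polyEval x p) := by
  induction p using MvPolynomial.induction_on with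
  | C a => simp [polyConj]
  | add p q hp hq => simp [hp, hq]
  | mul_X p i hp =>
    simp only [map_mul, hp, polyEval_X, Complex.conj_ofReal]
    simp [polyConj]

theorem pderiv_polyConj (i : Fin n) (p : MvPolynomial (Fin n) ℂ) :
    pderiv i (polyConj p) = polyConj (pderiv i p) :=
  pderiv_map

theorem rotField_polyConj (i j : Fin n) (p : MvPolynomial (Fin n) ℂ) :
    rotField i j (polyConj p) = polyConj (rotField i j p) := by
  simp only [rotField, pderiv_polyConj]
  simp [polyConj]

theorem mem_harmonicPolys {k : ℕ} {p : MvPolynomial (Fin n) ℂ} :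
    p ∈ harmonicPolys n k ↔ p.IsHomogeneous k ∧ polyLaplacian n p = 0 := Iff.rfl

theorem polyLaplacian_apply (p : MvPolynomial (Fin n) ℂ) :
    polyLaplacian n p = ∑ i, pderiv i (pderiv i p) := by
  simp [polyLaplacian]

theorem polyLaplacian_pderiv (i : Fin n) (p : MvPolynomial (Fin n) ℂ) :
    polyLaplacian n (pderiv i p) = pderiv i (polyLaplacian n p) := by
  simp only [polyLaplacian_apply, map_sum, pderiv_comm _ i]

theorem polyLaplacian_mul (p q : MvPolynomial (Fin n) ℂ) :
    polyLaplacian n (p * q) =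
      polyLaplacian n p * q + 2 * ∑ i, pderiv i p * pderiv i q + p * polyLaplacian n q := by
  simp only [polyLaplacian_apply, Finset.sum_mul, Finset.mul_sum, ← Finset.sum_add_distrib]
  refine Finset.sum_congr rfl fun i _ => ?_
  simp only [pderiv_mul, map_add]
  ring

theorem polyLaplacian_X_mul (i : Fin n) (p : MvPolynomial (Fin n) ℂ) :
    polyLaplacian n (X i * p) = 2 * pderiv i p + X i * polyLaplacian n p := by
  rw [polyLaplacian_mul, polyLaplacian_apply (X i)]
  simp [pderiv_X, Pi.single_apply, apply_ite]

theorem polyConj_mem {k : ℕ} {p : MvPolynomial (Fin n) ℂ} (hp : p ∈ harmonicPolys n k) :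
    polyConj p ∈ harmonicPolys n k := by
  obtain ⟨hk, hΔ⟩ := mem_harmonicPolys.1 hp
  refine mem_harmonicPolys.2 ⟨hk.map _, ?_⟩
  simp only [polyLaplacian_apply, pderiv_polyConj, ← map_sum] at hΔ ⊢
  rw [hΔ, map_zero]

theorem pderiv_mem {k : ℕ} {p : MvPolynomial (Fin n) ℂ} (hp : p ∈ harmonicPolys n k) (i : Fin n) :
    pderiv i p ∈ harmonicPolys n (k - 1) := by
  obtain ⟨hk, hΔ⟩ := mem_harmonicPolys.1 hp
  exact mem_harmonicPolys.2 ⟨hk.pderiv, by rw [polyLaplacian_pderiv, hΔ, map_zero]⟩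

theorem isHomogeneous_rotField {k : ℕ} {p : MvPolynomial (Fin n) ℂ} (hp : p.IsHomogeneous k)
    (i j : Fin n) : (rotField i j p).IsHomogeneous k := by
  rcases Nat.eq_zero_or_pos k with rfl | hk
  · rw [totalDegree_eq_zero_iff_eq_C.1 (Nat.le_zero.1 hp.totalDegree_le)]
    simp [rotField, isHomogeneous_zero]
  · have h (a b : Fin n) : (X a * pderiv b p).IsHomogeneous k := by
      simpa [Nat.add_sub_cancel' hk] using (isHomogeneous_X ℂ a).mul hp.pderiv
    exact (h i j).sub (h j i)

theorem rotField_mem {k : ℕ} {p : MvPolynomial (Fin n) ℂ} (hp : p ∈ harmonicPolys n k)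
    (i j : Fin n) : rotField i j p ∈ harmonicPolys n k := by
  obtain ⟨hk, hΔ⟩ := mem_harmonicPolys.1 hp
  refine mem_harmonicPolys.2 ⟨isHomogeneous_rotField hk i j, ?_⟩
  simp only [rotField, map_sub, polyLaplacian_X_mul, polyLaplacian_pderiv, hΔ, pderiv_comm i j,
    map_zero, mul_zero, sub_self]

/-- The polynomial `|x|²`. -/
def normSqPoly (n : ℕ) : MvPolynomial (Fin n) ℂ := ∑ j, X j ^ 2

theorem isHomogeneous_normSqPoly : (normSqPoly n).IsHomogeneous 2 :=
  IsHomogeneous.sum _ _ _ fun j _ => by simpa using (isHomogeneous_X ℂ j).pow 2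

theorem polyEval_normSqPoly (ω : Sph n) : polyEval ω (normSqPoly n) = 1 := by
  have h : ∑ j, (ω : Eucl n) j ^ 2 = 1 := by
    rw [← EuclideanSpace.real_norm_sq_eq, norm_eq_of_mem_sphere, one_pow]
  simp only [normSqPoly, map_sum, map_pow, polyEval_X]
  exact_mod_cast h

theorem pderiv_normSqPoly (i : Fin n) : pderiv i (normSqPoly n) = 2 * X i := by
  simp [normSqPoly, pderiv_X, Pi.single_apply]

theorem polyLaplacian_normSqPoly_mul {k : ℕ} {p : MvPolynomial (Fin n) ℂ}
    (hp : p.IsHomogeneous k) : polyLaplacian n (normSqPoly n * p) =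
      ((2 * n + 4 * k : ℕ) : MvPolynomial (Fin n) ℂ) * p +
        normSqPoly n * polyLaplacian n p := by
  have htwo (i : Fin n) : pderiv i (2 : MvPolynomial (Fin n) ℂ) = 0 :=
    (pderiv i).map_natCast 2
  have hΔ : polyLaplacian n (normSqPoly n) = 2 * n := by
    simp [polyLaplacian_apply, pderiv_normSqPoly, htwo, mul_comm]
  have hEuler : ∑ i, X i * pderiv i p = k * p := by rw [hp.sum_X_mul_pderiv, nsmul_eq_mul]
  simp only [polyLaplacian_mul, hΔ, pderiv_normSqPoly, mul_assoc, ← Finset.mul_sum, hEuler]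
  push_cast
  ring

end HarmonicPolynomials

section SphericalHarmonics

open MvPolynomial

variable {n : ℕ}

theorem star_mem_sphericalHarmonics {k : ℕ} {Y : C(Sph n, ℂ)} (hY : Y ∈ sphericalHarmonics n k) :
    star Y ∈ sphericalHarmonics n k := by
  obtain ⟨p, hp, rfl⟩ := hY
  exact ⟨polyConj p, polyConj_mem hp, by ext ω; simp⟩

theorem restrictPoly_mul (p q : MvPolynomial (Fin n) ℂ) :
    restrictPoly n (p * q) = restrictPoly n p * restrictPoly n q := by ext ω; simp

/-- On the sphere, `Xᵢ p = (Xᵢ p - c |X|² ∂ᵢp) + c ∂ᵢp`; for `c = (n + 2k - 2)⁻¹` the first summand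
is harmonic. -/
theorem restrictPoly_X_mul_mem [n.AtLeastTwo] {k : ℕ} {p : MvPolynomial (Fin n) ℂ}
    (hp : p ∈ harmonicPolys n k) (i : Fin n) :
    restrictPoly n (X i * p) ∈ sphericalHarmonics n (k + 1) ⊔ sphericalHarmonics n (k - 1) := by
  obtain ⟨hk, hΔ⟩ := mem_harmonicPolys.1 hp
  have hXp : (X i * p).IsHomogeneous (k + 1) := add_comm 1 k ▸ (isHomogeneous_X ℂ i).mul hk
  obtain rfl | ⟨l, rfl⟩ : k = 0 ∨ ∃ l, k = l + 1 := by cases k <;> simp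
  · refine Submodule.mem_sup_left ⟨_, mem_harmonicPolys.2 ⟨hXp, ?_⟩, rfl⟩
    rw [polyLaplacian_X_mul, hΔ, totalDegree_eq_zero_iff_eq_C.1 (Nat.le_zero.1 hk.totalDegree_le)]
    simp
  obtain ⟨hl, hΔ'⟩ := mem_harmonicPolys.1 (pderiv_mem hp i)
  rw [Nat.add_sub_cancel] at hl
  set c : ℂ := (n + 2 * l : ℕ)⁻¹
  have hc : c * (2 * n + 4 * l : ℕ) = 2 := by
    have : (n + 2 * l : ℕ) ≠ (0 : ℂ) := by
      have := NeZero.ne n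
      exact_mod_cast (by omega : n + 2 * l ≠ 0)
    rw [show 2 * n + 4 * l = (n + 2 * l) * 2 by ring, Nat.cast_mul, inv_mul_cancel_left₀ this,
      Nat.cast_two]
  refine Submodule.mem_sup.2 ⟨_, ⟨X i * p - c • (normSqPoly n * pderiv i p), ?_, rfl⟩, _,
    ⟨_, Submodule.smul_mem _ c (pderiv_mem hp i), rfl⟩, ?_⟩
  · refine mem_harmonicPolys.2 ⟨hXp.sub ?_, ?_⟩
    · rw [smul_eq_C_mul]
      have h := (isHomogeneous_C (Fin n) c).mul (isHomogeneous_normSqPoly.mul hl)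
      rwa [show 0 + (2 + l) = l + 1 + 1 by ring] at h
    · rw [map_sub, map_smul, polyLaplacian_X_mul, polyLaplacian_normSqPoly_mul hl, hΔ, hΔ',
        mul_zero, mul_zero, add_zero, add_zero, ← nsmul_eq_mul, ← Nat.cast_smul_eq_nsmul ℂ,
        smul_smul, hc, ofNat_smul_eq_nsmul, nsmul_eq_mul, Nat.cast_two, sub_self]
  · ext ω
    simp [polyEval_normSqPoly]

/-- The sum of the spaces of spherical harmonics of degree at most `m`. -/
def harmonicsUpTo (n m : ℕ) : Submodule ℂ C(Sph n, ℂ) :=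
  ⨆ (l : ℕ) (_ : l ≤ m), sphericalHarmonics n l

theorem sphericalHarmonics_le_upTo {l m : ℕ} (h : l ≤ m) :
    sphericalHarmonics n l ≤ harmonicsUpTo n m :=
  le_iSup₂_of_le l h le_rfl

theorem harmonicsUpTo_mono : Monotone (harmonicsUpTo n) := fun _ _ h =>
  iSup₂_le fun _ ha => sphericalHarmonics_le_upTo (ha.trans h)

theorem X_mul_mem_upTo [n.AtLeastTwo] {m : ℕ} (i : Fin n) {g : C(Sph n, ℂ)}
    (hg : g ∈ harmonicsUpTo n m) : restrictPoly n (X i) * g ∈ harmonicsUpTo n (m + 1) := by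
  suffices h : harmonicsUpTo n m ≤ (harmonicsUpTo n (m + 1)).comap
      (LinearMap.mulLeft ℂ (restrictPoly n (X i))) from h hg
  refine iSup₂_le fun l hl => ?_
  rintro _ ⟨p, hp, rfl⟩
  rw [Submodule.mem_comap, LinearMap.mulLeft_apply, ← restrictPoly_mul]
  exact sup_le (sphericalHarmonics_le_upTo (n := n) (by omega))
    (sphericalHarmonics_le_upTo (by omega)) (restrictPoly_X_mul_mem hp i)

theorem restrictPoly_monomial_mem [n.AtLeastTwo] {m : ℕ} {d : Fin n →₀ ℕ} (hd : d.degree = m) :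
    restrictPoly n (monomial d 1) ∈ harmonicsUpTo n m := by
  induction m generalizing d with
  | zero =>
    rw [(Finsupp.degree_eq_zero_iff d).1 hd]
    exact sphericalHarmonics_le_upTo le_rfl
      ⟨1, mem_harmonicPolys.2 ⟨isHomogeneous_one _ _, by simp [polyLaplacian_apply]⟩, rfl⟩
  | succ m ih =>
    obtain ⟨i, hi⟩ := Finsupp.ne_iff.1 (show d ≠ 0 by rintro rfl; simp at hd)
    obtain ⟨e, rfl⟩ := exists_add_of_le
      (Finsupp.single_le_iff.2 (Nat.one_le_iff_ne_zero.2 hi))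
    rw [monomial_single_add, pow_one, restrictPoly_mul]
    refine X_mul_mem_upTo i (ih ?_)
    rw [map_add, Finsupp.degree_single] at hd
    omega

theorem restrictPoly_mem_upTo [n.AtLeastTwo] {m : ℕ} {p : MvPolynomial (Fin n) ℂ}
    (hp : p.totalDegree ≤ m) : restrictPoly n p ∈ harmonicsUpTo n m := by
  rw [p.as_sum, map_sum]
  refine Submodule.sum_mem _ fun d hd => ?_
  rw [← mul_one (p.coeff d), ← smul_eq_mul, ← smul_monomial, map_smul]
  refine Submodule.smul_mem _ _ (harmonicsUpTo_mono (le_trans ?_ hp)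
    (restrictPoly_monomial_mem rfl))
  simpa [Finsupp.degree_eq_sum, Finsupp.sum_fintype] using le_totalDegree hd

theorem sphEigenvalue_strictMono [n.AtLeastTwo] : StrictMono (sphEigenvalue n) := by
  have h : (2 : ℝ) ≤ n := by exact_mod_cast Nat.AtLeastTwo.prop
  refine strictMono_nat_of_lt_succ fun k => ?_
  simp only [sphEigenvalue]
  push_cast
  nlinarith [k.cast_nonneg (α := ℝ)]

theorem integral_sphericalHarmonics_mul_eq_zero [n.AtLeastTwo] {k l : ℕ} (hkl : k ≠ l)
    {Y Z : C(Sph n, ℂ)} (hY : Y ∈ sphericalHarmonics n k) (hZ : Z ∈ sphericalHarmonics n l) :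
    ∫ ω, Y ω * Z ω ∂surf n = 0 := by
  obtain ⟨p, hp, rfl⟩ := hY
  obtain ⟨q, hq, rfl⟩ := hZ
  have h := integral_angularLaplacian_mul_comm p q
  simp only [angularLaplacian_eq hp, angularLaplacian_eq hq, map_smul, smul_eq_mul, mul_assoc,
    mul_left_comm (polyEval _ p)] at h
  rw [integral_const_mul, integral_const_mul, ← sub_eq_zero, ← sub_mul, mul_eq_zero,
    sub_eq_zero] at h
  refine h.resolve_left fun h => hkl ?_
  exact sphEigenvalue_strictMono.injective (neg_injective (Complex.ofReal_injective h))

/-- The bilinear pairing `g ↦ ∫ g Y` with a fixed function on the sphere. -/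
def pairing (Y : C(Sph n, ℂ)) : C(Sph n, ℂ) →ₗ[ℂ] ℂ where
  toFun g := ∫ ω, g ω * Y ω ∂surf n
  map_add' g h := by
    simp only [ContinuousMap.add_apply, add_mul]
    exact integral_add (integrable_sphere (by fun_prop)) (integrable_sphere (by fun_prop))
  map_smul' c g := by
    simp only [ContinuousMap.smul_apply, smul_eq_mul, mul_assoc, RingHom.id_apply]
    exact integral_const_mul _ _

theorem integral_polyEval_mul_eq_zero [n.AtLeastTwo] {k : ℕ} {p : MvPolynomial (Fin n) ℂ}
    (hp : p.totalDegree < k) {Y : C(Sph n, ℂ)} (hY : Y ∈ sphericalHarmonics n k) :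
    ∫ ω : Sph n, polyEval ω p * Y ω ∂surf n = 0 := by
  have h : harmonicsUpTo n p.totalDegree ≤ LinearMap.ker (pairing Y) :=
    iSup₂_le fun l hl _ hg => integral_sphericalHarmonics_mul_eq_zero (by omega) hg hY
  exact h (restrictPoly_mem_upTo le_rfl)

end SphericalHarmonics

section HarmonicExpansion

variable {n : ℕ}

theorem inner_toL2 (g h : C(Sph n, ℂ)) :
    inner ℂ (toL2 n g) (toL2 n h) = ∫ ω, h ω * starRingEnd ℂ (g ω) ∂surf n :=
  ContinuousMap.inner_toLp (surf n) g h

theorem norm_sq_toL2 (g : C(Sph n, ℂ)) : ‖toL2 n g‖ ^ 2 = ∫ ω, ‖g ω‖ ^ 2 ∂surf n := by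
  rw [← inner_self_eq_norm_sq (𝕜 := ℂ), inner_toL2]
  simp only [Complex.mul_conj, Complex.normSq_eq_norm_sq]
  rw [integral_complex_ofReal]
  rfl

theorem toL2_mem {k : ℕ} {Y : C(Sph n, ℂ)} (hY : Y ∈ sphericalHarmonics n k) :
    toL2 n Y ∈ sphericalHarmonicsL2 n k := Submodule.mem_map_of_mem hY

theorem harmonicPart_mem (k : ℕ) (g : C(Sph n, ℂ)) :
    harmonicPart n k g ∈ sphericalHarmonics n k := Subtype.coe_prop _

theorem toL2_harmonicPart (k : ℕ) (g : C(Sph n, ℂ)) :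
    toL2 n (harmonicPart n k g) =
      ((sphericalHarmonicsL2 n k).orthogonalProjectionOnto (toL2 n g) : Lp ℂ 2 (surf n)) :=
  congrArg Subtype.val ((Submodule.equivMapOfInjective (toL2 n) (toL2_injective n)
    (sphericalHarmonics n k)).apply_symm_apply
    ((sphericalHarmonicsL2 n k).orthogonalProjectionOnto (toL2 n g)))

theorem harmonicPart_add (k : ℕ) (g h : C(Sph n, ℂ)) :
    harmonicPart n k (g + h) = harmonicPart n k g + harmonicPart n k h :=
  toL2_injective n (by simp [toL2_harmonicPart])

theorem harmonicPart_smul (k : ℕ) (c : ℂ) (g : C(Sph n, ℂ)) :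
    harmonicPart n k (c • g) = c • harmonicPart n k g :=
  toL2_injective n (by simp [toL2_harmonicPart])

theorem integral_harmonicPart_mul {k : ℕ} {Y : C(Sph n, ℂ)} (hY : Y ∈ sphericalHarmonics n k)
    (g : C(Sph n, ℂ)) :
    ∫ ω, harmonicPart n k g ω * Y ω ∂surf n = ∫ ω, g ω * Y ω ∂surf n := by
  have h := Submodule.inner_orthogonalProjectionOnto_eq_of_mem_left
    (K := sphericalHarmonicsL2 n k) ⟨_, toL2_mem (star_mem_sphericalHarmonics hY)⟩ (toL2 n g)
  rw [Submodule.coe_inner, ← toL2_harmonicPart, inner_toL2, inner_toL2] at h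
  simpa using h

theorem harmonicPart_of_mem {k : ℕ} {Y : C(Sph n, ℂ)} (hY : Y ∈ sphericalHarmonics n k) :
    harmonicPart n k Y = Y := by
  apply toL2_injective n
  rw [toL2_harmonicPart]
  exact Submodule.starProjection_eq_self_iff.2 (toL2_mem hY)

theorem harmonicPart_eq_zero_of_integral_mul_eq_zero {k : ℕ} {g : C(Sph n, ℂ)}
    (h : ∀ Y ∈ sphericalHarmonics n k, ∫ ω, g ω * Y ω ∂surf n = 0) : harmonicPart n k g = 0 := by
  apply toL2_injective n
  rw [toL2_harmonicPart, map_zero, Submodule.orthogonalProjectionOnto_apply_of_mem_orthogonal,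
    Submodule.coe_zero]
  rw [Submodule.mem_orthogonal]
  rintro _ ⟨Y, hY, rfl⟩
  rw [inner_toL2]
  exact h _ (star_mem_sphericalHarmonics hY)

theorem harmonicPart_of_mem_of_ne [n.AtLeastTwo] {k l : ℕ} (hlk : l ≠ k) {Y : C(Sph n, ℂ)}
    (hY : Y ∈ sphericalHarmonics n l) : harmonicPart n k Y = 0 :=
  harmonicPart_eq_zero_of_integral_mul_eq_zero fun _ hZ =>
    integral_sphericalHarmonics_mul_eq_zero hlk hY hZ

theorem inner_eq_zero_of_mem_sphericalHarmonicsL2 [n.AtLeastTwo] {k l : ℕ} (hkl : k ≠ l)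
    {x y : Lp ℂ 2 (surf n)} (hx : x ∈ sphericalHarmonicsL2 n k)
    (hy : y ∈ sphericalHarmonicsL2 n l) : inner ℂ x y = 0 := by
  obtain ⟨Y, hY, rfl⟩ := hx
  obtain ⟨Z, hZ, rfl⟩ := hy
  rw [inner_toL2]
  exact integral_sphericalHarmonics_mul_eq_zero hkl.symm hZ (star_mem_sphericalHarmonics hY)

/-- The star subalgebra of `C(S^{n-1})` formed by the restrictions of polynomials, for use in the
Stone-Weierstrass theorem. -/
def polyStarSubalgebra (n : ℕ) : StarSubalgebra ℂ C(Sph n, ℂ) where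
  carrier := Set.range (restrictPoly n)
  mul_mem' := by
    rintro _ _ ⟨p, rfl⟩ ⟨q, rfl⟩
    exact ⟨p * q, restrictPoly_mul p q⟩
  add_mem' := by
    rintro _ _ ⟨p, rfl⟩ ⟨q, rfl⟩
    exact ⟨p + q, map_add _ _ _⟩
  algebraMap_mem' c := ⟨MvPolynomial.C c, by ext; simp [Algebra.algebraMap_eq_smul_one]⟩
  star_mem' := by
    rintro _ ⟨p, rfl⟩
    exact ⟨polyConj p, by ext; simp⟩

theorem separatesPoints_polyStarSubalgebra : (polyStarSubalgebra n).SeparatesPoints := by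
  intro ω θ h
  obtain ⟨i, hi⟩ : ∃ i, (ω : Eucl n) i ≠ (θ : Eucl n) i := by
    by_contra! hcoord
    exact h (Subtype.ext (PiLp.ext hcoord))
  exact ⟨restrictPoly n (MvPolynomial.X i), ⟨_, ⟨_, rfl⟩, rfl⟩, by simpa using hi⟩

theorem topologicalClosure_iSup_sphericalHarmonicsL2 [n.AtLeastTwo] :
    (⨆ k, sphericalHarmonicsL2 n k).topologicalClosure = ⊤ := by
  have hpoly : (LinearMap.range (restrictPoly n)).topologicalClosure = ⊤ := by
    have h := ContinuousMap.starSubalgebra_topologicalClosure_eq_top_of_separatesPoints _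
      (separatesPoints_polyStarSubalgebra (n := n))
    exact Submodule.eq_top_iff'.2 fun g =>
      (h ▸ trivial : g ∈ (polyStarSubalgebra n).topologicalClosure)
  rw [eq_top_iff, ← (ContinuousMap.toLp_denseRange ℂ (surf n) ℂ
    (p := 2) (by simp)).topologicalClosure_map_submodule hpoly]
  refine Submodule.topologicalClosure_mono ?_
  rintro _ ⟨_, ⟨p, rfl⟩, rfl⟩
  have hle : harmonicsUpTo n p.totalDegree ≤ (⨆ k, sphericalHarmonicsL2 n k).comap (toL2 n) :=
    iSup₂_le fun l _ g hg => Submodule.mem_iSup_of_mem l (toL2_mem hg)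
  exact hle (restrictPoly_mem_upTo le_rfl)

theorem isHilbertSum_sphericalHarmonicsL2 [n.AtLeastTwo] :
    IsHilbertSum ℂ (fun k => sphericalHarmonicsL2 n k)
      fun k => (sphericalHarmonicsL2 n k).subtypeₗᵢ :=
  IsHilbertSum.mkInternal _
    (fun _ _ hkl x y => inner_eq_zero_of_mem_sphericalHarmonicsL2 hkl x.2 y.2)
    topologicalClosure_iSup_sphericalHarmonicsL2.ge

theorem hasSum_orthogonalProjection_sphericalHarmonicsL2 [n.AtLeastTwo] (x : Lp ℂ 2 (surf n)) :
    HasSum (fun k => ((sphericalHarmonicsL2 n k).orthogonalProjectionOnto x : Lp ℂ 2 (surf n)))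
      x := by
  obtain ⟨w, rfl⟩ :=
    (isHilbertSum_sphericalHarmonicsL2 (n := n)).linearIsometryEquiv.symm.surjective x
  have h := isHilbertSum_sphericalHarmonicsL2.hasSum_linearIsometryEquiv_symm w
  convert! h using 2 with k
  congr 1
  refine (h.mapL (sphericalHarmonicsL2 n k).orthogonalProjectionOnto).unique ?_
  convert hasSum_single k fun l hl => ?_
  · exact (Submodule.orthogonalProjectionOnto_mem_subspace_eq_self _).symm
  · exact Submodule.orthogonalProjectionOnto_apply_of_mem_orthogonal
      ((Submodule.mem_orthogonal _ _).2 fun u hu =>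
        inner_eq_zero_of_mem_sphericalHarmonicsL2 hl.symm hu (w l).2)

theorem hasSum_norm_sq_harmonicPart [n.AtLeastTwo] (g : C(Sph n, ℂ)) :
    HasSum (fun k => ∫ ω, ‖harmonicPart n k g ω‖ ^ 2 ∂surf n) (∫ ω, ‖g ω‖ ^ 2 ∂surf n) := by
  have h := ((hasSum_orthogonalProjection_sphericalHarmonicsL2 (toL2 n g)).mapL
    (innerSL ℂ (toL2 n g))).mapL Complex.reCLM
  simp only [innerSL_apply_apply] at h
  rw [← norm_sq_toL2, ← inner_self_eq_norm_sq (𝕜 := ℂ)]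
  refine h.congr_fun fun k => ?_
  rw [← norm_sq_toL2, toL2_harmonicPart,
    ← Submodule.inner_orthogonalProjectionOnto_eq_of_mem_right]
  exact (inner_self_eq_norm_sq (𝕜 := ℂ) _).symm

theorem eq_zero_of_integral_mul_eq_zero [n.AtLeastTwo] {g : C(Sph n, ℂ)}
    (h : ∀ k, ∀ Y ∈ sphericalHarmonics n k, ∫ ω, g ω * Y ω ∂surf n = 0) : g = 0 := by
  have hsum := hasSum_norm_sq_harmonicPart g
  simp only [harmonicPart_eq_zero_of_integral_mul_eq_zero (h _)] at hsum
  have hnorm : ‖toL2 n g‖ ^ 2 = 0 := by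
    rw [norm_sq_toL2]
    exact hsum.unique (by simp)
  exact toL2_injective n (by simpa using hnorm)

theorem eq_of_integral_mul_eq [n.AtLeastTwo] {g g' : C(Sph n, ℂ)}
    (h : ∀ k, ∀ Y ∈ sphericalHarmonics n k,
      ∫ ω, g ω * Y ω ∂surf n = ∫ ω, g' ω * Y ω ∂surf n) : g = g' :=
  sub_eq_zero.1 (eq_zero_of_integral_mul_eq_zero fun k Y hY =>
    ((pairing Y).map_sub g g').trans (sub_eq_zero.2 (h k Y hY)))

theorem mem_sphericalHarmonics_of_integral_mul_eq_zero [n.AtLeastTwo] {k : ℕ} {g : C(Sph n, ℂ)}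
    (h : ∀ l, l ≠ k → ∀ Y ∈ sphericalHarmonics n l, ∫ ω, g ω * Y ω ∂surf n = 0) :
    g ∈ sphericalHarmonics n k := by
  suffices hg : g = harmonicPart n k g from hg ▸ harmonicPart_mem k g
  refine eq_of_integral_mul_eq fun l Y hY => ?_
  rcases eq_or_ne l k with rfl | hl
  · exact (integral_harmonicPart_mul hY g).symm
  · rw [h l hl Y hY, integral_sphericalHarmonics_mul_eq_zero hl.symm (harmonicPart_mem k g) hY]

end HarmonicExpansion

section Dimension

open MvPolynomial

variable {n : ℕ}

theorem coeff_pderiv_pderiv (j : Fin n) (a : Fin n →₀ ℕ) (p : MvPolynomial (Fin n) ℂ) :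
    (pderiv j (pderiv j p)).coeff a = p.coeff (a + Finsupp.single j 2) * (a j + 2) * (a j + 1) := by
  rw [coeff_pderiv, coeff_pderiv, add_assoc, ← Finsupp.single_add,
    Finsupp.add_apply, Finsupp.single_eq_same, one_add_one_eq_two]
  push_cast
  ring

/-- Cauchy data for Laplace's equation: the coefficient equations of `Δp = 0` determine the
coefficients with exponent `m + 2` in `xᵢ` from those with exponent `m`. -/
theorem eq_zero_of_polyLaplacian_eq_zero {p : MvPolynomial (Fin n) ℂ} (hp : polyLaplacian n p = 0)
    (i : Fin n) (h : ∀ a : Fin n →₀ ℕ, a i < 2 → p.coeff a = 0) : p = 0 := by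
  suffices hcoeff : ∀ m, ∀ a : Fin n →₀ ℕ, a i = m → p.coeff a = 0 from
    ext _ _ fun a => hcoeff _ a rfl
  intro m
  induction m using Nat.strong_induction_on with
  | _ m ih =>
    intro a ha
    by_cases hm : m < 2
    · exact h a (ha ▸ hm)
    obtain ⟨a, rfl⟩ := exists_add_of_le (Finsupp.single_le_iff.2 (by omega : 2 ≤ a i))
    rw [Finsupp.add_apply, Finsupp.single_eq_same] at ha
    have hΔ := congrArg (coeff a) hp
    rw [polyLaplacian_apply, coeff_sum, coeff_zero, Finset.sum_eq_single i, coeff_pderiv_pderiv,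
      add_comm a] at hΔ
    · have h2 : (a i : ℂ) + 2 ≠ 0 := by exact_mod_cast Nat.succ_ne_zero (a i + 1)
      have h1 : (a i : ℂ) + 1 ≠ 0 := Nat.cast_add_one_ne_zero _
      simpa [h1, h2] using hΔ
    · intro j _ hj
      rw [coeff_pderiv_pderiv, ih (a i) (by omega), zero_mul, zero_mul]
      simp [hj]
    · simp

theorem exists_injective_degree_eq (i j : Fin n) (k : ℕ) :
    ∃ F : {a : Fin n →₀ ℕ // a.degree = k ∧ a i < 2} →
      Fin 2 × ({l : Fin n // l ≠ i ∧ l ≠ j} → Fin (k + 1)), Function.Injective F := by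
  refine ⟨fun a => (⟨a.1 i, a.2.2⟩, fun l =>
    ⟨a.1 l, Nat.lt_succ_of_le ((Finsupp.le_degree l.1 a.1).trans_eq a.2.1)⟩), ?_⟩
  rintro ⟨a, ha⟩ ⟨b, hb⟩ hab
  simp only [Prod.mk.injEq, Fin.mk.injEq, _root_.funext_iff, Subtype.forall] at hab
  have hne (l : Fin n) (hl : l ≠ j) : a l = b l :=
    (eq_or_ne l i).elim (· ▸ hab.1) fun hli => hab.2 l ⟨hli, hl⟩
  have hj : a j = b j := by
    have h := ha.1.trans hb.1.symm
    rw [Finsupp.degree_eq_sum, Finsupp.degree_eq_sum,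
      ← Finset.add_sum_erase _ _ (Finset.mem_univ j),
      ← Finset.add_sum_erase _ b (Finset.mem_univ j),
      Finset.sum_congr rfl fun l hl => hne l (Finset.ne_of_mem_erase hl)] at h
    exact Nat.add_right_cancel h
  exact Subtype.ext (Finsupp.ext fun l => (eq_or_ne l j).elim (· ▸ hj) (hne l))

theorem finrank_harmonicPolys_le [n.AtLeastTwo] (k : ℕ) :
    Module.finrank ℂ (harmonicPolys n k) ≤ 2 * (k + 1) ^ (n - 2) := by
  have : Nontrivial (Fin n) := Fin.nontrivial_iff_two_le.2 Nat.AtLeastTwo.prop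
  obtain ⟨i, j, hij⟩ := exists_pair_ne (Fin n)
  obtain ⟨F, hF⟩ := exists_injective_degree_eq i j k
  have : Fintype {a : Fin n →₀ ℕ // a.degree = k ∧ a i < 2} :=
    Fintype.ofInjective F hF
  let Φ : harmonicPolys n k →ₗ[ℂ] ({a : Fin n →₀ ℕ // a.degree = k ∧ a i < 2} → ℂ) :=
    { toFun := fun p a => p.1.coeff a
      map_add' := fun p q => by ext; simp
      map_smul' := fun c p => by ext; simp }
  have hΦ : Function.Injective Φ := by
    rw [injective_iff_map_eq_zero]
    rintro ⟨p, hp⟩ hΦp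
    obtain ⟨hk, hΔ⟩ := mem_harmonicPolys.1 hp
    refine Subtype.ext (eq_zero_of_polyLaplacian_eq_zero hΔ i fun a ha => ?_)
    by_cases hak : a.degree = k
    · exact congrFun hΦp ⟨a, hak, ha⟩
    · exact hk.coeff_eq_zero hak
  have hcard : Fintype.card {l : Fin n // l ≠ i ∧ l ≠ j} = n - 2 := by
    have h := Finset.card_compl ({i, j} : Finset (Fin n))
    rw [Finset.card_pair hij, Fintype.card_fin] at h
    rw [Fintype.card_subtype, ← h]
    congr 1
    ext l
    simp
  calc Module.finrank ℂ (harmonicPolys n k)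
      ≤ Fintype.card {a : Fin n →₀ ℕ // a.degree = k ∧ a i < 2} := by
        simpa using LinearMap.finrank_le_finrank_of_injective hΦ
    _ ≤ _ := Fintype.card_le_of_injective F hF
    _ = 2 * (k + 1) ^ (n - 2) := by simp [hcard]

theorem finrank_sphericalHarmonicsL2_le [n.AtLeastTwo] (k : ℕ) :
    Module.finrank ℂ (sphericalHarmonicsL2 n k) ≤ 2 * (k + 1) ^ (n - 2) := by
  refine le_trans ?_ (finrank_harmonicPolys_le k)
  unfold sphericalHarmonicsL2 sphericalHarmonics
  rw [← Submodule.map_comp]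
  exact Submodule.finrank_map_le _ _

end Dimension

section AdditionTheorem

variable {n : ℕ}

theorem exists_harmonicPolys_toL2_eq {k : ℕ} {x : Lp ℂ 2 (surf n)}
    (hx : x ∈ sphericalHarmonicsL2 n k) :
    ∃ p ∈ harmonicPolys n k, toL2 n (restrictPoly n p) = x := by
  obtain ⟨_, ⟨p, hp, rfl⟩, rfl⟩ := hx
  exact ⟨p, hp, rfl⟩

/-- Harmonic polynomials whose restrictions to the sphere form an orthonormal basis of the
spherical harmonics of degree `k`. -/
def orthonormalPoly (n k : ℕ) (i : Fin (Module.finrank ℂ (sphericalHarmonicsL2 n k))) :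
    MvPolynomial (Fin n) ℂ :=
  (exists_harmonicPolys_toL2_eq (stdOrthonormalBasis ℂ (sphericalHarmonicsL2 n k) i).2).choose

theorem orthonormalPoly_mem (k : ℕ) (i) : orthonormalPoly n k i ∈ harmonicPolys n k :=
  (exists_harmonicPolys_toL2_eq (stdOrthonormalBasis ℂ _ i).2).choose_spec.1

theorem toL2_orthonormalPoly (k : ℕ) (i) : toL2 n (restrictPoly n (orthonormalPoly n k i)) =
    stdOrthonormalBasis ℂ (sphericalHarmonicsL2 n k) i :=
  (exists_harmonicPolys_toL2_eq (stdOrthonormalBasis ℂ _ i).2).choose_spec.2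

theorem integral_norm_sq_orthonormalPoly (k : ℕ) (i) :
    ∫ ω : Sph n, ‖polyEval ω (orthonormalPoly n k i)‖ ^ 2 ∂surf n = 1 := by
  simp_rw [← restrictPoly_apply]
  rw [← norm_sq_toL2, toL2_orthonormalPoly, ← Submodule.coe_norm, OrthonormalBasis.norm_eq_one,
    one_pow]

/-- The coefficients of a function on the sphere with respect to `orthonormalPoly n k`. -/
def harmonicCoeff (k : ℕ) (g : C(Sph n, ℂ))
    (i : Fin (Module.finrank ℂ (sphericalHarmonicsL2 n k))) : ℂ :=
  ∫ ω : Sph n, g ω * polyEval ω (polyConj (orthonormalPoly n k i)) ∂surf n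

theorem inner_stdOrthonormalBasis_sphericalHarmonicsL2 {k : ℕ} {Y : C(Sph n, ℂ)}
    (hY : Y ∈ sphericalHarmonics n k) (i) :
    inner ℂ (stdOrthonormalBasis ℂ (sphericalHarmonicsL2 n k) i) ⟨toL2 n Y, toL2_mem hY⟩ =
      harmonicCoeff k Y i := by
  rw [Submodule.coe_inner, ← toL2_orthonormalPoly, inner_toL2]
  simp [harmonicCoeff]

theorem sum_harmonicCoeff_mul {k : ℕ} {Y : C(Sph n, ℂ)} (hY : Y ∈ sphericalHarmonics n k)
    (ω : Sph n) : ∑ i, harmonicCoeff k Y i * polyEval ω (orthonormalPoly n k i) = Y ω := by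
  have h := congrArg Subtype.val ((stdOrthonormalBasis ℂ (sphericalHarmonicsL2 n k)).sum_repr'
    ⟨toL2 n Y, toL2_mem hY⟩)
  simp only [inner_stdOrthonormalBasis_sphericalHarmonicsL2 hY, Submodule.coe_sum,
    Submodule.coe_smul, ← toL2_orthonormalPoly, ← map_smul, ← map_sum] at h
  simpa using! DFunLike.congr_fun (toL2_injective n h) ω

theorem sum_norm_sq_harmonicCoeff {k : ℕ} {Y : C(Sph n, ℂ)} (hY : Y ∈ sphericalHarmonics n k) :
    ∑ i, ‖harmonicCoeff k Y i‖ ^ 2 = ∫ ω, ‖Y ω‖ ^ 2 ∂surf n := by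
  simp only [← inner_stdOrthonormalBasis_sphericalHarmonicsL2 hY]
  rw [OrthonormalBasis.sum_sq_norm_inner_right, ← norm_sq_toL2]
  rfl

/-- The fields `Ω_{ab}` act on the spherical harmonics of degree `k` by skew-Hermitian matrices. -/
theorem polyEval_rotField_sum_mul_polyConj (k : ℕ) (a b : Fin n) (ω : Sph n) :
    polyEval ω (rotField a b (∑ i, orthonormalPoly n k i * polyConj (orthonormalPoly n k i))) =
      0 := by
  set P := orthonormalPoly n k
  set A := fun i => harmonicCoeff k (restrictPoly n (rotField a b (P i))) with hA
  have hskew : ∀ i j, A i j = -starRingEnd ℂ (A j i) := by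
    intro i j
    simp only [hA, harmonicCoeff, restrictPoly_apply]
    rw [integral_rotField_mul, ← integral_conj]
    simp only [rotField_polyConj, polyEval_polyConj, map_mul, Complex.conj_conj, mul_comm]
    rfl
  have hrot : ∀ i, polyEval ω (rotField a b (P i)) = ∑ j, A i j * polyEval ω (P j) := fun i =>
    (sum_harmonicCoeff_mul ⟨_, rotField_mem (orthonormalPoly_mem k i) a b, rfl⟩ ω).symm
  simp only [rotField_sum, rotField_mul, rotField_polyConj, map_sum, map_add, map_mul,
    polyEval_polyConj, hrot, Finset.sum_add_distrib, Finset.sum_mul, Finset.mul_sum]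
  rw [Finset.sum_comm]
  simp only [← Finset.sum_add_distrib]
  refine Finset.sum_eq_zero fun i _ => Finset.sum_eq_zero fun j _ => ?_
  rw [hskew j i]
  ring

theorem restrictPoly_mem_zero_of_rotField_eq_zero [n.AtLeastTwo] {p : MvPolynomial (Fin n) ℂ}
    (hp : ∀ i j, ∀ ω : Sph n, polyEval ω (rotField i j p) = 0) :
    restrictPoly n p ∈ sphericalHarmonics n 0 := by
  refine mem_sphericalHarmonics_of_integral_mul_eq_zero fun l hl Y hY => ?_
  obtain ⟨q, hq, rfl⟩ := hY
  have h := integral_angularLaplacian_mul q p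
  simp only [hp, mul_zero, integral_zero, Finset.sum_const_zero, neg_zero, angularLaplacian_eq hq,
    map_smul, smul_eq_mul, mul_assoc] at h
  rw [integral_const_mul] at h
  have hne : ((-sphEigenvalue n l : ℝ) : ℂ) ≠ 0 := by
    have := sphEigenvalue_strictMono (n := n) (Nat.pos_of_ne_zero hl)
    rw [show sphEigenvalue n 0 = 0 by simp [sphEigenvalue]] at this
    exact_mod_cast (neg_lt_zero.2 this).ne
  simpa [mul_comm] using (mul_eq_zero.1 h).resolve_left hne

theorem exists_const_of_mem_sphericalHarmonics_zero {g : C(Sph n, ℂ)}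
    (hg : g ∈ sphericalHarmonics n 0) : ∃ c, ∀ ω, g ω = c := by
  obtain ⟨p, hp, rfl⟩ := hg
  refine ⟨p.coeff 0, fun ω => ?_⟩
  rw [MvPolynomial.totalDegree_eq_zero_iff_eq_C.1
    (Nat.le_zero.1 (mem_harmonicPolys.1 hp).1.totalDegree_le)]
  simp

theorem surf_univ_mul_sum_norm_sq_orthonormalPoly [n.AtLeastTwo] (k : ℕ) (ω : Sph n) :
    (surf n).real univ * ∑ i, ‖polyEval ω (orthonormalPoly n k i)‖ ^ 2 =
      Module.finrank ℂ (sphericalHarmonicsL2 n k) := by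
  obtain ⟨z, hz⟩ := exists_const_of_mem_sphericalHarmonics_zero
    (restrictPoly_mem_zero_of_rotField_eq_zero (polyEval_rotField_sum_mul_polyConj (n := n) k))
  have hconst (θ : Sph n) : ∑ i, ‖polyEval θ (orthonormalPoly n k i)‖ ^ 2 = z.re := by
    rw [← hz θ, restrictPoly_apply]
    simp only [map_sum, map_mul, polyEval_polyConj, Complex.mul_conj,
      Complex.normSq_eq_norm_sq, Complex.re_sum, Complex.ofReal_re]
  rw [hconst, ← smul_eq_mul, ← integral_const, ← funext hconst]
  rw [integral_finsetSum _ fun i _ => integrable_sphere (by fun_prop)]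
  simp [integral_norm_sq_orthonormalPoly]

theorem surf_univ_mul_norm_sq_apply_le [n.AtLeastTwo] {k : ℕ} {Y : C(Sph n, ℂ)}
    (hY : Y ∈ sphericalHarmonics n k) (ω : Sph n) :
    (surf n).real univ * ‖Y ω‖ ^ 2 ≤
      Module.finrank ℂ (sphericalHarmonicsL2 n k) * ∫ ω, ‖Y ω‖ ^ 2 ∂surf n := by
  have h : ‖Y ω‖ ≤ ∑ i, ‖harmonicCoeff k Y i‖ * ‖polyEval ω (orthonormalPoly n k i)‖ := by
    rw [← sum_harmonicCoeff_mul hY]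
    exact (norm_sum_le _ _).trans_eq (by simp only [norm_mul])
  rw [← surf_univ_mul_sum_norm_sq_orthonormalPoly k ω, mul_assoc, ← sum_norm_sq_harmonicCoeff hY]
  gcongr
  calc ‖Y ω‖ ^ 2 ≤ (∑ i, ‖harmonicCoeff k Y i‖ * ‖polyEval ω (orthonormalPoly n k i)‖) ^ 2 := by
        gcongr
    _ ≤ (∑ i, ‖harmonicCoeff k Y i‖ ^ 2) * ∑ i, ‖polyEval ω (orthonormalPoly n k i)‖ ^ 2 :=
        Finset.sum_mul_sq_le_sq_mul_sq _ _ _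
    _ = _ := mul_comm _ _

end AdditionTheorem

section PlaneWaves

variable {n : ℕ}

/-- The linear polynomial `x ↦ x · y`. -/
def linPoly (y : Eucl n) : MvPolynomial (Fin n) ℂ :=
  ∑ i, MvPolynomial.C ((y i : ℝ) : ℂ) * MvPolynomial.X i

@[simp] theorem polyEval_linPoly (x y : Eucl n) :
    polyEval x (linPoly y) = ((inner ℝ x y : ℝ) : ℂ) := by
  simp [linPoly, PiLp.inner_apply]

theorem totalDegree_linPoly_pow (y : Eucl n) (m : ℕ) : (linPoly y ^ m).totalDegree ≤ m := by
  have h : (linPoly y).IsHomogeneous 1 := MvPolynomial.IsHomogeneous.sum _ _ _ fun i _ => by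
    simpa using (MvPolynomial.isHomogeneous_C (Fin n) ((y i : ℝ) : ℂ)).mul
      (MvPolynomial.isHomogeneous_X ℂ i)
  simpa using (h.pow m).totalDegree_le

theorem pderiv_linPoly (y : Eucl n) (i : Fin n) :
    MvPolynomial.pderiv i (linPoly y) = MvPolynomial.C ((y i : ℝ) : ℂ) := by
  simp [linPoly, MvPolynomial.pderiv_X, Pi.single_apply]

theorem polyEval_rotField_linPoly_pow (x y : Eucl n) (m : ℕ) (i j : Fin n) :
    polyEval x (rotField i j (linPoly y ^ m)) =
      m * ((inner ℝ x y : ℝ) : ℂ) ^ (m - 1) * (x i * y j - x j * y i) := by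
  simp only [rotField, MvPolynomial.pderiv_pow, pderiv_linPoly, map_sub, map_mul, map_pow,
    map_natCast, polyEval_X, polyEval_C, polyEval_linPoly]
  ring

theorem polyEval_rotField_linPoly_pow_comm (x y : Eucl n) (m : ℕ) (i j : Fin n) :
    polyEval x (rotField i j (linPoly y ^ m)) = -polyEval y (rotField i j (linPoly x ^ m)) := by
  rw [polyEval_rotField_linPoly_pow, polyEval_rotField_linPoly_pow, real_inner_comm]
  ring

theorem integrable_sphere_prod {E : Type*} [NormedAddCommGroup E] {f : Sph n × Sph n → E}
    (hf : Continuous f) : Integrable f ((surf n).prod (surf n)) :=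
  hf.integrable_of_hasCompactSupport (HasCompactSupport.of_compactSpace f)

/-- The bilinear form on polynomials with kernel `(ω · θ) ^ m` on the sphere. -/
def innerPowForm (n m : ℕ) :
    MvPolynomial (Fin n) ℂ →ₗ[ℂ] MvPolynomial (Fin n) ℂ →ₗ[ℂ] ℂ :=
  LinearMap.mk₂ ℂ (fun p q => ∫ a : Sph n × Sph n,
      ((inner ℝ (a.1 : Eucl n) (a.2 : Eucl n) : ℝ) : ℂ) ^ m * (polyEval a.1 p * polyEval a.2 q)
        ∂(surf n).prod (surf n))
    (fun p p' q => by
      simp only [map_add, add_mul, mul_add]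
      exact integral_add (integrable_sphere_prod (by fun_prop))
        (integrable_sphere_prod (by fun_prop)))
    (fun c p q => by
      simp only [map_smul, smul_eq_mul, mul_assoc, mul_left_comm _ c]
      exact integral_const_mul c _)
    (fun p q q' => by
      simp only [map_add, mul_add]
      exact integral_add (integrable_sphere_prod (by fun_prop))
        (integrable_sphere_prod (by fun_prop)))
    (fun c p q => by
      simp only [map_smul, smul_eq_mul, mul_left_comm _ c]
      exact integral_const_mul c _)

theorem innerPowForm_apply (m : ℕ) (p q : MvPolynomial (Fin n) ℂ) :
    innerPowForm n m p q = ∫ a : Sph n × Sph n,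
      ((inner ℝ (a.1 : Eucl n) (a.2 : Eucl n) : ℝ) : ℂ) ^ m * (polyEval a.1 p * polyEval a.2 q)
        ∂(surf n).prod (surf n) := rfl

theorem innerPowForm_flip (m : ℕ) (p q : MvPolynomial (Fin n) ℂ) :
    innerPowForm n m q p = innerPowForm n m p q := by
  rw [innerPowForm_apply, innerPowForm_apply, ← integral_prod_swap]
  simp only [Prod.fst_swap, Prod.snd_swap, real_inner_comm, mul_comm (polyEval _ q)]

theorem innerPowForm_rotField_left (m : ℕ) (i j : Fin n) (p q : MvPolynomial (Fin n) ℂ) :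
    innerPowForm n m (rotField i j p) q = -∫ a : Sph n × Sph n,
      polyEval a.1 (rotField i j (linPoly (a.2 : Eucl n) ^ m)) *
        (polyEval a.1 p * polyEval a.2 q) ∂(surf n).prod (surf n) := by
  rw [innerPowForm_apply, integral_prod_symm _ (integrable_sphere_prod (by fun_prop)),
    integral_prod_symm _ (integrable_sphere_prod (by
      simp only [polyEval_rotField_linPoly_pow]; fun_prop)), ← integral_neg]
  refine integral_congr_ae (ae_of_all _ fun θ => ?_)
  simp only [← polyEval_linPoly, ← map_pow, ← mul_assoc]
  rw [integral_mul_const, integral_mul_const, integral_rotField_mul, neg_mul, neg_neg]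

theorem innerPowForm_rotField (m : ℕ) (i j : Fin n) (p q : MvPolynomial (Fin n) ℂ) :
    innerPowForm n m (rotField i j p) q = -innerPowForm n m p (rotField i j q) := by
  rw [← innerPowForm_flip m p, innerPowForm_rotField_left, innerPowForm_rotField_left,
    ← integral_prod_swap, ← integral_neg, ← integral_neg, ← integral_neg]
  refine integral_congr_ae (ae_of_all _ fun a => ?_)
  simp only [Prod.fst_swap, Prod.snd_swap]
  rw [polyEval_rotField_linPoly_pow_comm]
  ring

theorem innerPowForm_angularLaplacian (m : ℕ) (p q : MvPolynomial (Fin n) ℂ) :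
    innerPowForm n m (angularLaplacian p) q = innerPowForm n m p (angularLaplacian q) := by
  simp only [angularLaplacian, map_sum, LinearMap.sum_apply, innerPowForm_rotField, neg_neg]

theorem innerPowForm_eq_zero [n.AtLeastTwo] {k l : ℕ} (hkl : k ≠ l) {p q : MvPolynomial (Fin n) ℂ}
    (hp : p ∈ harmonicPolys n k) (hq : q ∈ harmonicPolys n l) (m : ℕ) :
    innerPowForm n m p q = 0 := by
  have h := innerPowForm_angularLaplacian m p q
  rw [angularLaplacian_eq hp, angularLaplacian_eq hq, map_smul, map_smul, LinearMap.smul_apply,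
    ← sub_eq_zero, ← sub_smul, smul_eq_zero, sub_eq_zero] at h
  refine h.resolve_left fun h => hkl ?_
  exact sphEigenvalue_strictMono.injective (neg_injective (Complex.ofReal_injective h))

theorem integral_exp_inner_mul_eq_zero [n.AtLeastTwo] {k l : ℕ} (hkl : k ≠ l) {Y Z : C(Sph n, ℂ)}
    (hY : Y ∈ sphericalHarmonics n k) (hZ : Z ∈ sphericalHarmonics n l) (z : ℂ) :
    ∫ a : Sph n × Sph n, Complex.exp (z * (inner ℝ (a.1 : Eucl n) (a.2 : Eucl n) : ℝ)) *
      (Y a.1 * Z a.2) ∂(surf n).prod (surf n) = 0 := by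
  obtain ⟨p, hp, rfl⟩ := hY
  obtain ⟨q, hq, rfl⟩ := hZ
  set F : ℕ → Sph n × Sph n → ℂ := fun m a => z ^ m / m.factorial *
    (((inner ℝ (a.1 : Eucl n) (a.2 : Eucl n) : ℝ) : ℂ) ^ m * (polyEval a.1 p * polyEval a.2 q))
    with hF
  have hFi (m : ℕ) : Integrable (F m) ((surf n).prod (surf n)) :=
    integrable_sphere_prod (by fun_prop)
  have hF0 (m : ℕ) : ∫ a, F m a ∂(surf n).prod (surf n) = 0 :=
    (integral_const_mul _ _).trans (by
      rw [← innerPowForm_apply, innerPowForm_eq_zero hkl hp hq, mul_zero])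
  have hbound (m : ℕ) : ∫ a, ‖F m a‖ ∂(surf n).prod (surf n) ≤ ‖z‖ ^ m / m.factorial *
      ∫ a : Sph n × Sph n, ‖polyEval a.1 p * polyEval a.2 q‖ ∂(surf n).prod (surf n) := by
    rw [← integral_const_mul]
    refine integral_mono (hFi m).norm (integrable_sphere_prod (by fun_prop)) fun a => ?_
    simp only [hF, norm_mul, norm_div, norm_pow, Complex.norm_natCast, Complex.norm_real]
    have hinner : ‖inner ℝ (a.1 : Eucl n) (a.2 : Eucl n)‖ ≤ 1 :=
      (norm_inner_le_norm _ _).trans (by simp)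
    exact mul_le_mul_of_nonneg_left
      (mul_le_of_le_one_left (by positivity) (pow_le_one₀ (norm_nonneg _) hinner)) (by positivity)
  have hs : Summable fun m => ∫ a, ‖F m a‖ ∂(surf n).prod (surf n) :=
    Summable.of_nonneg_of_le (fun m => integral_nonneg fun _ => norm_nonneg _) hbound
      ((Real.summable_pow_div_factorial ‖z‖).mul_right _)
  have hsum := hasSum_integral_of_summable_integral_norm hFi hs
  simp only [hF0] at hsum
  rw [← hsum.unique hasSum_zero]
  refine integral_congr_ae (ae_of_all _ fun a => ?_)
  simp only [hF, restrictPoly_apply, ← mul_assoc, tsum_mul_right, Complex.exp_eq_exp_ℂ,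
    NormedSpace.exp_eq_tsum_div, mul_pow, mul_div_right_comm]

end PlaneWaves

section SphereFourier

variable {n : ℕ}

/-- The Fourier transform of the measure `g dω` on the sphere. -/
def sphFourier (g : C(Sph n, ℂ)) (ξ : Eucl n) : ℂ :=
  ∫ ω : Sph n, Complex.exp (((-2 * Real.pi * inner ℝ (ω : Eucl n) ξ : ℝ) : ℂ) * Complex.I) * g ω
    ∂surf n

theorem continuous_integral_sphere {X : Type*} [TopologicalSpace X] [FirstCountableTopology X]
    [LocallyCompactSpace X] {f : X → Sph n → ℂ} (hf : Continuous f.uncurry) :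
    Continuous fun x => ∫ ω, f x ω ∂surf n := by
  simpa only [Measure.restrict_univ] using!
    continuous_parametric_integral_of_continuous (μ := surf n) hf isCompact_univ

@[fun_prop]
theorem continuous_sphFourier (g : C(Sph n, ℂ)) : Continuous (sphFourier g) :=
  continuous_integral_sphere (by simp only [Function.uncurry_def]; fun_prop)

/-- The restriction of `sphFourier g` to the sphere of radius `ρ`. -/
def sphFourierOn (g : C(Sph n, ℂ)) (ρ : ℝ) : C(Sph n, ℂ) where
  toFun θ := sphFourier g (ρ • (θ : Eucl n))

theorem sphFourierOn_mem [n.AtLeastTwo] {k : ℕ} {Y : C(Sph n, ℂ)}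
    (hY : Y ∈ sphericalHarmonics n k) (ρ : ℝ) : sphFourierOn Y ρ ∈ sphericalHarmonics n k := by
  refine mem_sphericalHarmonics_of_integral_mul_eq_zero fun l hl Z hZ => ?_
  rw [← integral_exp_inner_mul_eq_zero hl.symm hY hZ
      (((-2 * Real.pi * ρ : ℝ) : ℂ) * Complex.I),
    integral_prod_symm _ (integrable_sphere_prod (by fun_prop))]
  refine integral_congr_ae (ae_of_all _ fun θ => ?_)
  simp only [sphFourierOn, ContinuousMap.coe_mk, sphFourier, ← mul_assoc]
  rw [integral_mul_const]
  congr 2 with ω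
  rw [inner_smul_right]
  push_cast
  ring_nf

theorem integral_norm_le_sqrt_mul_norm_toL2 (g : C(Sph n, ℂ)) :
    ∫ ω, ‖g ω‖ ∂surf n ≤ √((surf n).real univ) * ‖toL2 n g‖ := by
  let absg : C(Sph n, ℂ) := ⟨fun ω => (‖g ω‖ : ℂ), by fun_prop⟩
  have hone : ‖toL2 n 1‖ = √((surf n).real univ) :=
    ((Real.sqrt_eq_iff_eq_sq measureReal_nonneg (norm_nonneg _)).2 (by
      rw [norm_sq_toL2]; simp)).symm
  have habs : ‖toL2 n absg‖ = ‖toL2 n g‖ := by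
    rw [← sq_eq_sq₀ (norm_nonneg _) (norm_nonneg _), norm_sq_toL2, norm_sq_toL2]
    simp [absg]
  have hinner : inner ℂ (toL2 n 1) (toL2 n absg) = ((∫ ω, ‖g ω‖ ∂surf n : ℝ) : ℂ) := by
    rw [inner_toL2, ← integral_complex_ofReal]
    simp [absg]
  calc ∫ ω, ‖g ω‖ ∂surf n ≤ ‖inner ℂ (toL2 n 1) (toL2 n absg)‖ := by
        rw [hinner, Complex.norm_real]; exact le_abs_self _
    _ ≤ ‖toL2 n 1‖ * ‖toL2 n absg‖ := norm_inner_le_norm _ _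
    _ = √((surf n).real univ) * ‖toL2 n g‖ := by rw [hone, habs]

theorem norm_sphFourier_le (g : C(Sph n, ℂ)) (ξ : Eucl n) :
    ‖sphFourier g ξ‖ ≤ ∫ ω, ‖g ω‖ ∂surf n := by
  refine (norm_integral_le_integral_norm _).trans_eq ?_
  simp [Complex.norm_exp]

theorem integral_taylor_mul_eq_zero [n.AtLeastTwo] {k : ℕ} {Y : C(Sph n, ℂ)}
    (hY : Y ∈ sphericalHarmonics n k) (ξ : Eucl n) (z : ℂ) :
    ∫ ω : Sph n, (∑ m ∈ Finset.range k, (z * (inner ℝ (ω : Eucl n) ξ : ℝ)) ^ m / m.factorial) *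
      Y ω ∂surf n = 0 := by
  simp only [Finset.sum_mul]
  rw [integral_finsetSum _ fun m _ => integrable_sphere (by fun_prop)]
  refine Finset.sum_eq_zero fun m hm => ?_
  have h := integral_polyEval_mul_eq_zero
    ((totalDegree_linPoly_pow ξ m).trans_lt (Finset.mem_range.1 hm)) hY
  simp only [map_pow, polyEval_linPoly] at h
  simp only [mul_pow, mul_div_right_comm, mul_assoc]
  rw [integral_const_mul, h, mul_zero]

theorem norm_sphFourier_le_factorial [n.AtLeastTwo] {k : ℕ} {Y : C(Sph n, ℂ)}
    (hY : Y ∈ sphericalHarmonics n k) {ξ : Eucl n} (hξ : 2 * Real.pi * ‖ξ‖ / (k + 1) ≤ 1 / 2) :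
    ‖sphFourier Y ξ‖ ≤ (2 * Real.pi * ‖ξ‖) ^ k / k.factorial * 2 * ∫ ω, ‖Y ω‖ ∂surf n := by
  set z : ℂ := -2 * Real.pi * Complex.I with hz
  set x : Sph n → ℂ := fun ω => z * (inner ℝ (ω : Eucl n) ξ : ℝ) with hx
  have hxc : Continuous x := by fun_prop
  have hxn (ω : Sph n) : ‖x ω‖ ≤ 2 * Real.pi * ‖ξ‖ := by
    have hinner : ‖inner ℝ (ω : Eucl n) ξ‖ ≤ ‖ξ‖ := (norm_inner_le_norm _ _).trans (by simp)
    simpa [hx, hz, Real.pi_pos.le, abs_of_pos Real.pi_pos] using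
      mul_le_mul_of_nonneg_left hinner Real.two_pi_pos.le
  have hremainder : sphFourier Y ξ = ∫ ω, (Complex.exp (x ω) -
      ∑ m ∈ Finset.range k, x ω ^ m / m.factorial) * Y ω ∂surf n := by
    simp only [sub_mul]
    rw [integral_sub (integrable_sphere (by fun_prop)) (integrable_sphere (by fun_prop)),
      integral_taylor_mul_eq_zero hY, sub_zero, sphFourier]
    simp only [hx, hz]
    push_cast
    simp only [mul_right_comm _ Complex.I]
  rw [hremainder, ← integral_const_mul]
  refine (norm_integral_le_integral_norm _).trans (integral_mono
    (integrable_sphere (by fun_prop)) (integrable_sphere (by fun_prop)) fun ω => ?_)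
  rw [norm_mul]
  gcongr
  refine (Complex.exp_bound' (le_trans ?_ hξ)).trans ?_
  · push_cast
    gcongr
    exact hxn ω
  · gcongr
    exact hxn ω

theorem pow_div_factorial_le_half_pow {t : ℝ} {k : ℕ} (ht : 0 ≤ t) (htk : t ≤ k / 6) :
    t ^ k / k.factorial ≤ (1 / 2) ^ k := by
  have hexp : (k : ℝ) ^ k / k.factorial ≤ 3 ^ k :=
    calc (k : ℝ) ^ k / k.factorial ≤ Real.exp k :=
          Real.pow_div_factorial_le_exp _ k.cast_nonneg k
      _ = Real.exp 1 ^ k := (Real.exp_one_pow k).symm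
      _ ≤ 3 ^ k := by gcongr; linarith [Real.exp_one_lt_d9]
  calc t ^ k / k.factorial ≤ (k / 6) ^ k / k.factorial := by gcongr
    _ = (1 / 6) ^ k * ((k : ℝ) ^ k / k.factorial) := by rw [div_pow, one_div_pow]; ring
    _ ≤ (1 / 6) ^ k * 3 ^ k := by gcongr
    _ = (1 / 2) ^ k := by rw [← mul_pow]; norm_num

theorem norm_sphFourier_le_half_pow [n.AtLeastTwo] {k : ℕ} {Y : C(Sph n, ℂ)}
    (hY : Y ∈ sphericalHarmonics n k) {ξ : Eucl n} (hξ : 2 * Real.pi * ‖ξ‖ ≤ (k + 1) / 12) :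
    ‖sphFourier Y ξ‖ ≤ (1 / 2) ^ k * 2 * ∫ ω, ‖Y ω‖ ∂surf n := by
  refine (norm_sphFourier_le_factorial hY ?_).trans ?_
  · rw [div_le_iff₀ (by positivity)]; linarith [(k.cast_nonneg : (0 : ℝ) ≤ k)]
  gcongr
  rcases Nat.eq_zero_or_pos k with rfl | hk
  · simp
  · have hk1 : (1 : ℝ) ≤ k := by exact_mod_cast hk
    exact pow_div_factorial_le_half_pow (by positivity) (by linarith)

theorem exists_half_pow_le (N : ℕ) :
    ∃ B : ℝ, ∀ k : ℕ, (1 / 2 : ℝ) ^ k ≤ B * (1 / ((k : ℝ) + 1)) ^ N := by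
  have h := (tendsto_pow_const_mul_const_pow_of_abs_lt_one N
    (r := 1 / 2) (by rw [abs_of_pos] <;> norm_num)).comp (Filter.tendsto_add_atTop_nat 1)
  obtain ⟨B, hB⟩ := h.bddAbove_range
  refine ⟨B * 2, fun k => ?_⟩
  have hk := hB ⟨k, rfl⟩
  simp only [Function.comp_def, pow_succ, Nat.cast_add, Nat.cast_one] at hk
  rw [one_div_pow ((k : ℝ) + 1), mul_one_div, le_div_iff₀ (by positivity)]
  linarith

/-- The low frequencies `|ξ| ≲ k` use the Taylor expansion of the kernel; for the others the bound
is trivial. -/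
theorem exists_norm_sphFourier_le (n N : ℕ) [n.AtLeastTwo] : ∃ C : ℝ, 0 ≤ C ∧
    ∀ (k : ℕ) (Y : C(Sph n, ℂ)), Y ∈ sphericalHarmonics n k → ∀ ξ : Eucl n,
      ‖sphFourier Y ξ‖ ≤ C * ((1 + ‖ξ‖) / (k + 1)) ^ N * ‖toL2 n Y‖ := by
  obtain ⟨B, hB⟩ := exists_half_pow_le N
  have hB0 : 0 ≤ B := by simpa using zero_le_one.trans (hB 0)
  set M := 2 * B + (24 * Real.pi) ^ N
  suffices h : ∀ (k : ℕ) (Y : C(Sph n, ℂ)), Y ∈ sphericalHarmonics n k → ∀ ξ : Eucl n,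
      ‖sphFourier Y ξ‖ ≤ M * ((1 + ‖ξ‖) / (k + 1)) ^ N * ∫ ω, ‖Y ω‖ ∂surf n by
    refine ⟨M * √((surf n).real univ), by positivity, fun k Y hY ξ => ?_⟩
    calc ‖sphFourier Y ξ‖ ≤ M * ((1 + ‖ξ‖) / (k + 1)) ^ N * ∫ ω, ‖Y ω‖ ∂surf n := h k Y hY ξ
      _ ≤ M * ((1 + ‖ξ‖) / (k + 1)) ^ N * (√((surf n).real univ) * ‖toL2 n Y‖) := by
          gcongr; exact integral_norm_le_sqrt_mul_norm_toL2 Y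
      _ = _ := by ring
  intro k Y hY ξ
  have hI : 0 ≤ ∫ ω, ‖Y ω‖ ∂surf n := integral_nonneg fun _ => norm_nonneg _
  rcases le_or_gt (2 * Real.pi * ‖ξ‖) ((k + 1) / 12) with hξ | hξ
  · refine (norm_sphFourier_le_half_pow hY hξ).trans (mul_le_mul_of_nonneg_right ?_ hI)
    calc (1 / 2 : ℝ) ^ k * 2 ≤ B * (1 / (k + 1)) ^ N * 2 := by gcongr; exact hB k
      _ = 2 * B * (1 / (k + 1)) ^ N := by ring
      _ ≤ M * ((1 + ‖ξ‖) / (k + 1)) ^ N := by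
          have hB : 2 * B ≤ M := le_add_of_nonneg_right (by positivity)
          gcongr
          linarith [norm_nonneg ξ]
  · refine (norm_sphFourier_le Y ξ).trans (le_mul_of_one_le_left hI ?_)
    have hbase : 1 ≤ 24 * Real.pi * ((1 + ‖ξ‖) / (k + 1)) := by
      rw [← mul_div_assoc, le_div_iff₀ (by positivity)]
      nlinarith [Real.pi_pos]
    calc (1 : ℝ) ≤ (24 * Real.pi * ((1 + ‖ξ‖) / (k + 1))) ^ N := one_le_pow₀ hbase
      _ = (24 * Real.pi) ^ N * ((1 + ‖ξ‖) / (k + 1)) ^ N := mul_pow _ _ _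
      _ ≤ M * ((1 + ‖ξ‖) / (k + 1)) ^ N := by
          have hπ : (24 * Real.pi) ^ N ≤ M := le_add_of_nonneg_left (by positivity)
          gcongr

end SphereFourier

section Gaussian

variable {V : Type*} [NormedAddCommGroup V] [InnerProductSpace ℝ V] [FiniteDimensional ℝ V]
  [MeasurableSpace V] [BorelSpace V]

theorem integrable_exp_neg_mul_norm_sq {a : ℝ} (ha : 0 < a) :
    Integrable fun x : V => Real.exp (-a * ‖x‖ ^ 2) := by
  have h := (GaussianFourier.integrable_cexp_neg_mul_sq_norm_add (V := V) (b := (a : ℂ))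
    (by simpa using ha) 0 0).norm
  refine h.congr (ae_of_all _ fun x => ?_)
  simp [Complex.norm_exp, ← Complex.ofReal_pow]

theorem lintegral_exp_neg_mul_norm_sub_sq {a : ℝ} (ha : 0 < a) (y : V) :
    ∫⁻ x : V, ENNReal.ofReal (Real.exp (-a * ‖x - y‖ ^ 2)) =
      ENNReal.ofReal ((Real.pi / a) ^ (Module.finrank ℝ V / 2 : ℝ)) := by
  rw [lintegral_sub_right_eq_self (fun x : V => ENNReal.ofReal (Real.exp (-a * ‖x‖ ^ 2))) y,
    ← ofReal_integral_eq_lintegral_ofReal (integrable_exp_neg_mul_norm_sq ha)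
      (ae_of_all _ fun x => (Real.exp_pos _).le),
    GaussianFourier.integral_rexp_neg_mul_sq_norm ha]

theorem norm_integral_exp_inner_mul_exp_neg {R : ℝ} (hR : 0 < R) (y : V) :
    ‖∫ ξ : V, Complex.exp (((-2 * Real.pi * inner ℝ ξ y : ℝ) : ℂ) * Complex.I) *
      (Real.exp (-(Real.pi / R ^ 2) * ‖ξ‖ ^ 2) : ℝ)‖ =
      R ^ Module.finrank ℝ V * Real.exp (-Real.pi * R ^ 2 * ‖y‖ ^ 2) := by
  have hb : 0 < Real.pi / R ^ 2 := by positivity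
  have h := fourier_gaussian_innerProductSpace (V := V) (b := ((Real.pi / R ^ 2 : ℝ) : ℂ))
    (by simpa only [Complex.ofReal_re] using hb) y
  have hscale : (Real.pi : ℂ) / ((Real.pi / R ^ 2 : ℝ) : ℂ) = ((R ^ 2 : ℝ) : ℂ) := by
    rw [← Complex.ofReal_div, div_div_cancel₀ Real.pi_ne_zero]
  have hexponent : -(Real.pi : ℂ) ^ 2 * (‖y‖ : ℂ) ^ 2 / ((Real.pi / R ^ 2 : ℝ) : ℂ) =
      ((-Real.pi * R ^ 2 * ‖y‖ ^ 2 : ℝ) : ℂ) := by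
    rw [neg_mul, neg_div, pow_two (Real.pi : ℂ), mul_assoc, mul_div_right_comm, hscale]
    push_cast
    ring
  rw [hscale, hexponent, ← Complex.ofReal_exp, Real.fourier_eq'] at h
  have hnorm := congrArg norm h
  rw [norm_mul, Complex.norm_cpow_eq_rpow_re_of_pos (by positivity), Complex.norm_real,
    Real.norm_of_nonneg (Real.exp_pos _).le] at hnorm
  convert hnorm using 2
  · congr 1 with ξ
    rw [smul_eq_mul]
    push_cast
    rfl
  · rw [← Real.rpow_natCast R 2, ← Real.rpow_mul hR.le, ← Real.rpow_natCast R]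
    congr 1
    norm_cast
    simp
    ring

end Gaussian

section AgmonHormander

variable {n : ℕ}

theorem norm_smul_sub_sq_le {r ε : ℝ} (hr : 1 ≤ r) (hrε : r ≤ 1 + ε) (ω θ : Sph n) :
    ‖r • (θ : Eucl n) - ω‖ ^ 2 ≤ 2 * (‖(θ : Eucl n) - ω‖ ^ 2 + ε ^ 2) := by
  have hsplit : r • (θ : Eucl n) - ω = ((θ : Eucl n) - ω) + (r - 1) • (θ : Eucl n) := by
    rw [sub_smul, one_smul]; abel
  have hnorm : ‖r • (θ : Eucl n) - ω‖ ≤ ‖(θ : Eucl n) - ω‖ + ε := by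
    rw [hsplit]
    refine (norm_add_le _ _).trans ?_
    rw [norm_smul_coe_sphere (by linarith)]
    linarith
  exact (pow_le_pow_left₀ (norm_nonneg _) hnorm 2).trans (add_sq_le ..)

/-- The Gaussian on the sphere is compared with the full one on the shell `1 < r ≤ 1 + 1 / R`. -/
theorem lintegral_sphere_gaussian_le [NeZero n] {R : ℝ} (hR : 0 < R) (ω : Sph n) :
    ENNReal.ofReal (1 / R) * (ENNReal.ofReal (Real.exp (-Real.pi)) * ∫⁻ θ : Sph n,
        ENNReal.ofReal (Real.exp (-Real.pi * R ^ 2 * ‖(θ : Eucl n) - ω‖ ^ 2)) ∂surf n) ≤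
      ENNReal.ofReal ((2 / R ^ 2) ^ (n / 2 : ℝ)) := by
  set c : ℝ := Real.pi / 2 * R ^ 2 with hc
  have hpt : ∀ r ∈ Ioc (1 : ℝ) (1 + 1 / R), ∀ θ : Sph n, ENNReal.ofReal (Real.exp (-Real.pi)) *
        ENNReal.ofReal (Real.exp (-Real.pi * R ^ 2 * ‖(θ : Eucl n) - ω‖ ^ 2)) ≤
      ENNReal.ofReal (Real.exp (-c * ‖r • (θ : Eucl n) - ω‖ ^ 2)) := by
    intro r hr θ
    rw [← ENNReal.ofReal_mul (Real.exp_pos _).le, ← Real.exp_add]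
    gcongr
    have h := mul_le_mul_of_nonneg_left (norm_smul_sub_sq_le hr.1.le hr.2 ω θ)
      (by positivity : 0 ≤ c)
    have hcR : 2 * c * (1 / R) ^ 2 = Real.pi := by rw [hc]; field_simp
    linear_combination h + hcR + 2 * ‖(θ : Eucl n) - ω‖ ^ 2 * hc
  calc _ = ∫⁻ r in Ioc (1 : ℝ) (1 + 1 / R), ENNReal.ofReal (Real.exp (-Real.pi)) * ∫⁻ θ : Sph n,
        ENNReal.ofReal (Real.exp (-Real.pi * R ^ 2 * ‖(θ : Eucl n) - ω‖ ^ 2)) ∂surf n := by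
        rw [setLIntegral_const, Real.volume_Ioc, add_sub_cancel_left, mul_comm]
    _ ≤ ∫⁻ r in Ioc (1 : ℝ) (1 + 1 / R), ENNReal.ofReal (r ^ (n - 1)) * ∫⁻ θ : Sph n,
        ENNReal.ofReal (Real.exp (-c * ‖r • (θ : Eucl n) - ω‖ ^ 2)) ∂surf n := by
        refine setLIntegral_mono' measurableSet_Ioc fun r hr => ?_
        refine le_trans ?_ (le_mul_of_one_le_left zero_le
          (ENNReal.one_le_ofReal.2 (one_le_pow₀ hr.1.le)))
        rw [← lintegral_const_mul _ (by fun_prop)]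
        exact lintegral_mono fun θ => hpt r hr θ
    _ ≤ ∫⁻ r in Ioi (0 : ℝ), ENNReal.ofReal (r ^ (n - 1)) * ∫⁻ θ : Sph n,
        ENNReal.ofReal (Real.exp (-c * ‖r • (θ : Eucl n) - ω‖ ^ 2)) ∂surf n :=
        lintegral_mono_set fun r hr => zero_lt_one.trans hr.1
    _ = ∫⁻ x : Eucl n, ENNReal.ofReal (Real.exp (-c * ‖x - ω‖ ^ 2)) := by
        symm
        rw [lintegral_eq_lintegral_Ioi_toSphere (by fun_prop), finrank_euclideanSpace_fin]
    _ = ENNReal.ofReal ((2 / R ^ 2) ^ (n / 2 : ℝ)) := by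
        have hratio : Real.pi / c = 2 / R ^ 2 := by rw [hc]; field_simp
        rw [lintegral_exp_neg_mul_norm_sub_sq (by positivity), finrank_euclideanSpace_fin, hratio]

theorem integral_sphere_gaussian_le [NeZero n] {R : ℝ} (hR : 0 < R) (ω : Sph n) :
    R ^ n * ∫ θ : Sph n, Real.exp (-Real.pi * R ^ 2 * ‖(θ : Eucl n) - ω‖ ^ 2) ∂surf n ≤
      Real.exp Real.pi * 2 ^ (n / 2 : ℝ) * R := by
  have hpow : (2 / R ^ 2) ^ (n / 2 : ℝ) = 2 ^ (n / 2 : ℝ) / R ^ n := by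
    rw [Real.div_rpow (by norm_num) (by positivity), ← Real.rpow_natCast_mul hR.le,
      Nat.cast_ofNat, mul_div_cancel₀ _ (two_ne_zero' ℝ), Real.rpow_natCast]
  have h := lintegral_sphere_gaussian_le hR ω
  rw [← ofReal_integral_eq_lintegral_ofReal (integrable_sphere (by fun_prop))
    (ae_of_all _ fun x => (Real.exp_pos _).le), ← ENNReal.ofReal_mul (Real.exp_pos _).le,
    ← ENNReal.ofReal_mul (by positivity), ENNReal.ofReal_le_ofReal_iff (by positivity), hpow,
    le_div_iff₀ (by positivity), Real.exp_neg] at h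
  calc _ = Real.exp Real.pi * R * (1 / R * ((Real.exp Real.pi)⁻¹ * ∫ θ : Sph n,
        Real.exp (-Real.pi * R ^ 2 * ‖(θ : Eucl n) - ω‖ ^ 2) ∂surf n) * R ^ n) := by field_simp
    _ ≤ Real.exp Real.pi * R * 2 ^ (n / 2 : ℝ) := by gcongr
    _ = _ := by ring

theorem sphFourier_mul_conj (g : C(Sph n, ℂ)) (ξ : Eucl n) :
    ((‖sphFourier g ξ‖ ^ 2 : ℝ) : ℂ) = ∫ q : Sph n × Sph n,
      Complex.exp (((-2 * Real.pi * inner ℝ ξ ((q.1 : Eucl n) - q.2) : ℝ) : ℂ) * Complex.I) *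
        (g q.1 * starRingEnd ℂ (g q.2)) ∂(surf n).prod (surf n) := by
  rw [← Complex.normSq_eq_norm_sq, ← Complex.mul_conj]
  conv_lhs => rw [sphFourier, ← integral_conj, ← integral_prod_mul]
  refine integral_congr_ae (ae_of_all _ fun q => ?_)
  simp only [map_mul, ← Complex.exp_conj, Complex.conj_ofReal, Complex.conj_I]
  rw [mul_mul_mul_comm, ← Complex.exp_add, inner_sub_right, real_inner_comm, real_inner_comm ξ]
  congr 2
  push_cast
  ring

theorem integrable_gaussian_mul_norm_sq_sphFourier (g : C(Sph n, ℂ)) {a : ℝ} (ha : 0 < a) :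
    Integrable fun ξ : Eucl n => Real.exp (-a * ‖ξ‖ ^ 2) * ‖sphFourier g ξ‖ ^ 2 := by
  refine ((integrable_exp_neg_mul_norm_sq ha).mul_const ((∫ ω, ‖g ω‖ ∂surf n) ^ 2)).mono'
    (Continuous.aestronglyMeasurable (by fun_prop)) (ae_of_all _ fun ξ => ?_)
  rw [Real.norm_of_nonneg (by positivity)]
  gcongr
  exact norm_sphFourier_le g ξ

theorem integral_gaussian_mul_norm_sq_sphFourier_le_prod (g : C(Sph n, ℂ)) {R : ℝ} (hR : 0 < R) :
    ∫ ξ : Eucl n, Real.exp (-(Real.pi / R ^ 2) * ‖ξ‖ ^ 2) * ‖sphFourier g ξ‖ ^ 2 ≤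
      ∫ q : Sph n × Sph n, R ^ n * Real.exp (-Real.pi * R ^ 2 * ‖(q.1 : Eucl n) - q.2‖ ^ 2) *
        (‖g q.1‖ * ‖g q.2‖) ∂(surf n).prod (surf n) := by
  set G : Eucl n → ℝ := fun ξ => Real.exp (-(Real.pi / R ^ 2) * ‖ξ‖ ^ 2)
  have hGi : Integrable G := integrable_exp_neg_mul_norm_sq (by positivity)
  set Φ : Eucl n → Sph n × Sph n → ℂ := fun ξ q =>
    Complex.exp (((-2 * Real.pi * inner ℝ ξ ((q.1 : Eucl n) - q.2) : ℝ) : ℂ) * Complex.I) *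
      (G ξ : ℂ) * (g q.1 * starRingEnd ℂ (g q.2)) with hΦ
  have hΦi : Integrable (Function.uncurry Φ) (volume.prod ((surf n).prod (surf n))) := by
    have hprod : Integrable (fun q : Sph n × Sph n => ‖g q.1 * starRingEnd ℂ (g q.2)‖)
      ((surf n).prod (surf n)) := integrable_sphere_prod (by fun_prop)
    refine (hGi.mul_prod hprod).mono' (Continuous.aestronglyMeasurable (by
      simp only [hΦ, G, Function.uncurry_def]; fun_prop)) (ae_of_all _ fun z => ?_)
    simp only [hΦ, Function.uncurry_def, norm_mul, Complex.norm_exp_ofReal_mul_I, one_mul,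
      Complex.norm_real]
    rw [Real.norm_of_nonneg (Real.exp_pos _).le]
  have hfubini : ((∫ ξ : Eucl n, G ξ * ‖sphFourier g ξ‖ ^ 2 : ℝ) : ℂ) =
      ∫ q : Sph n × Sph n, (∫ ξ, Φ ξ q) ∂(surf n).prod (surf n) := by
    rw [← integral_integral_swap hΦi, ← integral_complex_ofReal]
    refine integral_congr_ae (ae_of_all _ fun ξ => ?_)
    simp only [hΦ, mul_right_comm _ (G ξ : ℂ)]
    rw [integral_mul_const, ← sphFourier_mul_conj, Complex.ofReal_mul, mul_comm]
  have hkernel (q : Sph n × Sph n) : ‖∫ ξ, Φ ξ q‖ =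
      R ^ n * Real.exp (-Real.pi * R ^ 2 * ‖(q.1 : Eucl n) - q.2‖ ^ 2) * (‖g q.1‖ * ‖g q.2‖) := by
    simp only [hΦ]
    rw [integral_mul_const, norm_mul, norm_integral_exp_inner_mul_exp_neg hR, norm_mul,
      RCLike.norm_conj, finrank_euclideanSpace_fin]
  calc _ = ‖∫ q : Sph n × Sph n, (∫ ξ, Φ ξ q) ∂(surf n).prod (surf n)‖ := by
        rw [← hfubini, Complex.norm_real,
          Real.norm_of_nonneg (integral_nonneg fun ξ => by positivity)]
    _ ≤ _ := (norm_integral_le_integral_norm _).trans_eq (by simp only [hkernel])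

/-- Schur's test. -/
theorem integral_kernel_mul_norm_mul_norm_le {K : Sph n → Sph n → ℝ} {M : ℝ}
    (hK : Continuous K.uncurry) (hK0 : ∀ ω θ, 0 ≤ K ω θ) (hsymm : ∀ ω θ, K ω θ = K θ ω)
    (hM : ∀ ω, ∫ θ, K ω θ ∂surf n ≤ M) (g : C(Sph n, ℂ)) :
    ∫ q : Sph n × Sph n, K q.1 q.2 * (‖g q.1‖ * ‖g q.2‖) ∂(surf n).prod (surf n) ≤
      M * ‖toL2 n g‖ ^ 2 := by
  have hKc : Continuous fun q : Sph n × Sph n => K q.1 q.2 := hK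
  have hleft : ∫ q : Sph n × Sph n, K q.1 q.2 * ‖g q.1‖ ^ 2 ∂(surf n).prod (surf n) ≤
      M * ‖toL2 n g‖ ^ 2 := by
    rw [integral_prod _ (integrable_sphere_prod (by fun_prop)), norm_sq_toL2, ← integral_const_mul]
    refine integral_mono (integrable_sphere_prod (f := fun q : Sph n × Sph n =>
      K q.1 q.2 * ‖g q.1‖ ^ 2) (by fun_prop)).integral_prod_left
      (integrable_sphere (by fun_prop)) fun ω => ?_
    exact (integral_mul_const (‖g ω‖ ^ 2) (K ω)).trans_le
      (mul_le_mul_of_nonneg_right (hM ω) (sq_nonneg _))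
  have hright : ∫ q : Sph n × Sph n, K q.1 q.2 * ‖g q.2‖ ^ 2 ∂(surf n).prod (surf n) =
      ∫ q : Sph n × Sph n, K q.1 q.2 * ‖g q.1‖ ^ 2 ∂(surf n).prod (surf n) := by
    rw [← integral_prod_swap]
    simp only [Prod.fst_swap, Prod.snd_swap, hsymm]
  calc _ ≤ ∫ q : Sph n × Sph n, (K q.1 q.2 * ‖g q.1‖ ^ 2 + K q.1 q.2 * ‖g q.2‖ ^ 2) / 2
        ∂(surf n).prod (surf n) := by
        refine integral_mono (integrable_sphere_prod (by fun_prop))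
          (integrable_sphere_prod (by fun_prop)) fun q => ?_
        linear_combination
          1 / 2 * mul_le_mul_of_nonneg_left (two_mul_le_add_sq ‖g q.1‖ ‖g q.2‖) (hK0 q.1 q.2)
    _ = ∫ q : Sph n × Sph n, K q.1 q.2 * ‖g q.1‖ ^ 2 ∂(surf n).prod (surf n) := by
        rw [integral_div, integral_add (integrable_sphere_prod (by fun_prop))
          (integrable_sphere_prod (by fun_prop)), hright, add_self_div_two]
    _ ≤ M * ‖toL2 n g‖ ^ 2 := hleft

/-- The Agmon–Hörmander bound, with a Gaussian weight. -/
theorem integral_gaussian_mul_norm_sq_sphFourier_le [NeZero n] (g : C(Sph n, ℂ)) {R : ℝ}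
    (hR : 0 < R) :
    ∫ ξ : Eucl n, Real.exp (-(Real.pi / R ^ 2) * ‖ξ‖ ^ 2) * ‖sphFourier g ξ‖ ^ 2 ≤
      Real.exp Real.pi * 2 ^ (n / 2 : ℝ) * R * ‖toL2 n g‖ ^ 2 := by
  set K : Sph n → Sph n → ℝ := fun ω θ =>
    R ^ n * Real.exp (-Real.pi * R ^ 2 * ‖(ω : Eucl n) - θ‖ ^ 2) with hK
  have hKc : Continuous K.uncurry := by simp only [hK, Function.uncurry_def]; fun_prop
  have hK0 (ω θ : Sph n) : 0 ≤ K ω θ := by positivity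
  have hsymm (ω θ : Sph n) : K ω θ = K θ ω := by simp only [hK, norm_sub_rev]
  have hle (ω : Sph n) : ∫ θ, K ω θ ∂surf n ≤ Real.exp Real.pi * 2 ^ (n / 2 : ℝ) * R := by
    simp only [hsymm ω]
    exact (integral_const_mul _ _).trans_le (integral_sphere_gaussian_le hR ω)
  exact (integral_gaussian_mul_norm_sq_sphFourier_le_prod g hR).trans
    (integral_kernel_mul_norm_mul_norm_le hKc hK0 hsymm hle g)

end AgmonHormander

section RieszWeight

theorem lintegral_closedBall_norm_rpow_neg {E : Type*} [NormedAddCommGroup E] [NormedSpace ℝ E]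
    [FiniteDimensional ℝ E] [Nontrivial E] [MeasurableSpace E] [BorelSpace E] {μ : Measure E}
    [μ.IsAddHaarMeasure] {b ρ : ℝ} (hb : b < Module.finrank ℝ E) (hρ : 0 ≤ ρ) :
    ∫⁻ x in Metric.closedBall 0 ρ, ENNReal.ofReal (‖x‖ ^ (-b)) ∂μ =
      ENNReal.ofReal (μ.toSphere.real univ *
        (ρ ^ (Module.finrank ℝ E - b) / (Module.finrank ℝ E - b))) := by
  set d := Module.finrank ℝ E
  have hd : 1 ≤ d := Module.finrank_pos
  have hs : MeasurableSet (Metric.closedBall (0 : E) ρ) := Metric.isClosed_closedBall.measurableSet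
  have hpolar : ∀ r ∈ Ioi (0 : ℝ), ENNReal.ofReal (r ^ (d - 1)) *
      ∫⁻ ω : Metric.sphere (0 : E) 1, (Metric.closedBall (0 : E) ρ).indicator
        (fun x => ENNReal.ofReal (‖x‖ ^ (-b))) (r • (ω : E)) ∂μ.toSphere =
      (Iic ρ).indicator (fun r => ENNReal.ofReal (r ^ (d - 1 - b))) r * μ.toSphere univ := by
    intro r (hr : 0 < r)
    have hnorm := norm_smul_coe_sphere (E := E) hr.le
    have hind (ω : Metric.sphere (0 : E) 1) : (Metric.closedBall (0 : E) ρ).indicator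
        (fun x => ENNReal.ofReal (‖x‖ ^ (-b))) (r • (ω : E)) =
        (Iic ρ).indicator (fun r => ENNReal.ofReal (r ^ (-b))) r := by
      by_cases h : r ∈ Iic ρ
      · rw [indicator_of_mem (by rwa [mem_closedBall_zero_iff, hnorm]), hnorm, indicator_of_mem h]
      · rw [indicator_of_notMem (by rwa [mem_closedBall_zero_iff, hnorm]), indicator_of_notMem h]
    simp only [hind, lintegral_const, indicator_apply]
    split_ifs
    · rw [← mul_assoc, ← ENNReal.ofReal_mul (by positivity), ← Real.rpow_natCast,
        ← Real.rpow_add hr, Nat.cast_sub hd, Nat.cast_one, ← sub_eq_add_neg]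
    · simp
  have hint : IntegrableOn (fun r : ℝ => r ^ (d - 1 - b)) (Ioc 0 ρ) :=
    (intervalIntegrable_iff_integrableOn_Ioc_of_le hρ).1
      (intervalIntegral.intervalIntegrable_rpow' (by linarith))
  rw [← lintegral_indicator hs,
    lintegral_eq_lintegral_Ioi_toSphere (Measurable.indicator (by fun_prop) hs),
    setLIntegral_congr_fun measurableSet_Ioi hpolar,
    lintegral_mul_const _ (Measurable.indicator (by fun_prop) measurableSet_Iic),
    setLIntegral_indicator measurableSet_Iic, inter_comm, Ioi_inter_Iic,
    ← ofReal_integral_eq_lintegral_ofReal hint ((ae_restrict_mem measurableSet_Ioc).mono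
      fun r hr => Real.rpow_nonneg hr.1.le _),
    ← intervalIntegral.integral_of_le hρ, integral_rpow (Or.inl (by linarith)), mul_comm,
    ENNReal.ofReal_mul measureReal_nonneg, ofReal_measureReal,
    Real.zero_rpow (by linarith), sub_zero, show (d : ℝ) - 1 - b + 1 = d - b by ring]

variable {n : ℕ}

theorem norm_sq_sphFourier_le_half_pow [n.AtLeastTwo] {k : ℕ} {Y : C(Sph n, ℂ)}
    (hY : Y ∈ sphericalHarmonics n k) {ξ : Eucl n} (hξ : 2 * Real.pi * ‖ξ‖ ≤ (k + 1) / 12) :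
    ‖sphFourier Y ξ‖ ^ 2 ≤ (1 / 2) ^ k * (4 * (surf n).real univ) * ‖toL2 n Y‖ ^ 2 :=
  calc ‖sphFourier Y ξ‖ ^ 2
      ≤ ((1 / 2) ^ k * 2 * (√((surf n).real univ) * ‖toL2 n Y‖)) ^ 2 := by
        gcongr
        exact (norm_sphFourier_le_half_pow hY hξ).trans
          (mul_le_mul_of_nonneg_left (integral_norm_le_sqrt_mul_norm_toL2 Y) (by positivity))
    _ = (1 / 2) ^ k * ((1 / 2) ^ k * (4 * (surf n).real univ) * ‖toL2 n Y‖ ^ 2) := by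
        rw [mul_pow, mul_pow, mul_pow, Real.sq_sqrt measureReal_nonneg]; ring
    _ ≤ (1 / 2) ^ k * (4 * (surf n).real univ) * ‖toL2 n Y‖ ^ 2 :=
        mul_le_of_le_one_left (by positivity) (pow_le_one₀ (by norm_num) (by norm_num))

theorem exists_low_frequency_le [n.AtLeastTwo] {b : ℝ} (hbn : b < n) : ∃ C : ℝ, 0 ≤ C ∧
    ∀ (k : ℕ) (Y : C(Sph n, ℂ)), Y ∈ sphericalHarmonics n k →
      ∫⁻ ξ in Metric.closedBall 0 ((24 * Real.pi)⁻¹ * (k + 1)),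
        ENNReal.ofReal (‖ξ‖ ^ (-b)) * ‖sphFourier Y ξ‖ₑ ^ 2 ≤
          ENNReal.ofReal (C * (k + 1 : ℝ) ^ (1 - b) * ‖toL2 n Y‖ ^ 2) := by
  have _hnb : 0 < n - b := sub_pos.2 hbn
  obtain ⟨B, hB⟩ := exists_half_pow_le (n - 1)
  have hB0 : 0 ≤ B := by simpa using zero_le_one.trans (hB 0)
  set σ := (surf n).real univ
  set c := (24 * Real.pi)⁻¹ with hc
  refine ⟨σ * (c ^ (n - b) / (n - b)) * (4 * σ) * B, by positivity, fun k Y hY => ?_⟩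
  have hpt : ∀ ξ ∈ Metric.closedBall (0 : Eucl n) (c * (k + 1)),
      ENNReal.ofReal (‖ξ‖ ^ (-b)) * ‖sphFourier Y ξ‖ₑ ^ 2 ≤ ENNReal.ofReal (‖ξ‖ ^ (-b)) *
        ENNReal.ofReal ((1 / 2) ^ k * (4 * σ) * ‖toL2 n Y‖ ^ 2) := by
    intro ξ hξ
    rw [mem_closedBall_zero_iff, hc, inv_mul_eq_div, le_div_iff₀ (by positivity)] at hξ
    rw [← ofReal_norm, ← ENNReal.ofReal_pow (norm_nonneg _)]
    gcongr
    exact norm_sq_sphFourier_le_half_pow hY (by linarith)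
  have hpow : ((k : ℝ) + 1) ^ ((n : ℝ) - b) * (1 / (k + 1)) ^ (n - 1) = (k + 1 : ℝ) ^ (1 - b) := by
    rw [one_div, inv_pow, ← Real.rpow_natCast, ← Real.rpow_neg (by positivity),
      ← Real.rpow_add (by positivity), Nat.cast_sub NeZero.one_le]
    congr 1
    push_cast
    ring
  refine (setLIntegral_mono' Metric.isClosed_closedBall.measurableSet hpt).trans ?_
  rw [lintegral_mul_const _ (by fun_prop), lintegral_closedBall_norm_rpow_neg
      (by rwa [finrank_euclideanSpace_fin]) (by positivity), finrank_euclideanSpace_fin,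
    ← ENNReal.ofReal_mul (by positivity), Real.mul_rpow (by positivity) (by positivity)]
  refine ENNReal.ofReal_le_ofReal ?_
  calc _ = σ * (c ^ (n - b) / (n - b)) * (4 * σ) * ((k + 1 : ℝ) ^ ((n : ℝ) - b) * (1 / 2) ^ k) *
        ‖toL2 n Y‖ ^ 2 := by ring
    _ ≤ σ * (c ^ (n - b) / (n - b)) * (4 * σ) *
        ((k + 1 : ℝ) ^ ((n : ℝ) - b) * (B * (1 / (k + 1)) ^ (n - 1))) * ‖toL2 n Y‖ ^ 2 := by
        gcongr
        exact hB k
    _ = _ := by rw [← hpow]; ring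

theorem rpow_neg_le_gaussian {b s x : ℝ} (hb : 0 ≤ b) (hs : 0 < s) (hsx : s ≤ x)
    (hxs : x ≤ 2 * s) :
    x ^ (-b) ≤ s ^ (-b) * Real.exp Real.pi * Real.exp (-(Real.pi / (2 * s) ^ 2) * x ^ 2) := by
  have hexp : Real.pi / (2 * s) ^ 2 * x ^ 2 ≤ Real.pi := by
    rw [div_mul_eq_mul_div, div_le_iff₀ (by positivity)]
    have hx : 0 ≤ x := hs.le.trans hsx
    gcongr
  rw [mul_assoc, ← Real.exp_add]
  exact (Real.rpow_le_rpow_of_nonpos hs hsx (by linarith)).trans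
    (le_mul_of_one_le_right (by positivity) (Real.one_le_exp (by linarith)))

theorem setLIntegral_shell_le [NeZero n] {b s : ℝ} (hb : 0 ≤ b) (hs : 0 < s) (g : C(Sph n, ℂ)) :
    ∫⁻ ξ : Eucl n in {ξ | s ≤ ‖ξ‖ ∧ ‖ξ‖ ≤ 2 * s},
        ENNReal.ofReal (‖ξ‖ ^ (-b)) * ‖sphFourier g ξ‖ₑ ^ 2 ≤
      ENNReal.ofReal (2 * Real.exp Real.pi ^ 2 * 2 ^ (n / 2 : ℝ) * s ^ (1 - b) *
        ‖toL2 n g‖ ^ 2) := by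
  have hmeas : MeasurableSet {ξ : Eucl n | s ≤ ‖ξ‖ ∧ ‖ξ‖ ≤ 2 * s} :=
    (measurableSet_le measurable_const measurable_norm).inter
      (measurableSet_le measurable_norm measurable_const)
  have hpt : ∀ ξ ∈ {ξ : Eucl n | s ≤ ‖ξ‖ ∧ ‖ξ‖ ≤ 2 * s},
      ENNReal.ofReal (‖ξ‖ ^ (-b)) * ‖sphFourier g ξ‖ₑ ^ 2 ≤
        ENNReal.ofReal (s ^ (-b) * Real.exp Real.pi) * ENNReal.ofReal
          (Real.exp (-(Real.pi / (2 * s) ^ 2) * ‖ξ‖ ^ 2) * ‖sphFourier g ξ‖ ^ 2) := by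
    rintro ξ ⟨hsξ, hξs⟩
    rw [← ofReal_norm, ← ENNReal.ofReal_pow (norm_nonneg _), ← ENNReal.ofReal_mul (by positivity),
      ← ENNReal.ofReal_mul (by positivity), ← mul_assoc]
    gcongr
    exact rpow_neg_le_gaussian hb hs hsξ hξs
  have hpow : s ^ (1 - b) = s ^ (-b) * s := by
    rw [← Real.rpow_add_one hs.ne', neg_add_eq_sub]
  calc _ ≤ ∫⁻ ξ : Eucl n, ENNReal.ofReal (s ^ (-b) * Real.exp Real.pi) * ENNReal.ofReal
          (Real.exp (-(Real.pi / (2 * s) ^ 2) * ‖ξ‖ ^ 2) * ‖sphFourier g ξ‖ ^ 2) :=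
        (setLIntegral_mono' hmeas hpt).trans (setLIntegral_le_lintegral _ _)
    _ = ENNReal.ofReal (s ^ (-b) * Real.exp Real.pi * ∫ ξ : Eucl n,
          Real.exp (-(Real.pi / (2 * s) ^ 2) * ‖ξ‖ ^ 2) * ‖sphFourier g ξ‖ ^ 2) := by
        rw [lintegral_const_mul' _ _ ENNReal.ofReal_ne_top, ← ofReal_integral_eq_lintegral_ofReal
          (integrable_gaussian_mul_norm_sq_sphFourier g (by positivity))
          (ae_of_all _ fun ξ => by positivity), ← ENNReal.ofReal_mul (by positivity)]
    _ ≤ ENNReal.ofReal (s ^ (-b) * Real.exp Real.pi *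
          (Real.exp Real.pi * 2 ^ (n / 2 : ℝ) * (2 * s) * ‖toL2 n g‖ ^ 2)) := by
        gcongr
        exact integral_gaussian_mul_norm_sq_sphFourier_le g (by positivity)
    _ = _ := by rw [hpow]; ring_nf

theorem compl_closedBall_subset_iUnion_shell {E : Type*} [SeminormedAddGroup E] {ρ : ℝ}
    (hρ : 0 < ρ) :
    (Metric.closedBall (0 : E) ρ)ᶜ ⊆ ⋃ j : ℕ, {x | 2 ^ j * ρ ≤ ‖x‖ ∧ ‖x‖ ≤ 2 * (2 ^ j * ρ)} := by
  intro x hx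
  rw [mem_compl_iff, mem_closedBall_zero_iff, not_le] at hx
  obtain ⟨j, hj, hj'⟩ := exists_nat_pow_near ((one_le_div hρ).2 hx.le) one_lt_two
  rw [le_div_iff₀ hρ] at hj
  rw [div_lt_iff₀ hρ, pow_succ'] at hj'
  exact mem_iUnion.2 ⟨j, hj, by linarith⟩

theorem exists_high_frequency_le (n : ℕ) [NeZero n] {b : ℝ} (hb : 1 < b) : ∃ C : ℝ, 0 ≤ C ∧
    ∀ (g : C(Sph n, ℂ)) (ρ : ℝ), 0 < ρ →
      ∫⁻ ξ in (Metric.closedBall 0 ρ)ᶜ, ENNReal.ofReal (‖ξ‖ ^ (-b)) * ‖sphFourier g ξ‖ₑ ^ 2 ≤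
        ENNReal.ofReal (C * ρ ^ (1 - b) * ‖toL2 n g‖ ^ 2) := by
  set K := 2 * Real.exp Real.pi ^ 2 * 2 ^ (n / 2 : ℝ)
  set t : ℝ := 2 ^ (1 - b)
  have ht0 : 0 ≤ t := by positivity
  have ht1 : t < 1 := Real.rpow_lt_one_of_one_lt_of_neg one_lt_two (by linarith)
  refine ⟨K * (1 - t)⁻¹, mul_nonneg (by positivity) (inv_nonneg.2 (sub_pos.2 ht1).le),
    fun g ρ hρ => ?_⟩
  have hscale (j : ℕ) : (2 ^ j * ρ) ^ (1 - b) = t ^ j * ρ ^ (1 - b) := by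
    rw [Real.mul_rpow (by positivity) hρ.le, Real.rpow_pow_comm zero_le_two]
  calc _ ≤ ∑' j : ℕ, ∫⁻ ξ : Eucl n in {ξ | 2 ^ j * ρ ≤ ‖ξ‖ ∧ ‖ξ‖ ≤ 2 * (2 ^ j * ρ)},
          ENNReal.ofReal (‖ξ‖ ^ (-b)) * ‖sphFourier g ξ‖ₑ ^ 2 :=
        (lintegral_mono_set (compl_closedBall_subset_iUnion_shell hρ)).trans
          (lintegral_iUnion_le _ _)
    _ ≤ ∑' j : ℕ, ENNReal.ofReal (K * ρ ^ (1 - b) * ‖toL2 n g‖ ^ 2 * t ^ j) :=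
        ENNReal.tsum_le_tsum fun j =>
          (setLIntegral_shell_le (by linarith) (by positivity) g).trans_eq (by
            rw [hscale]; congr 1; ring)
    _ = ENNReal.ofReal (∑' j : ℕ, K * ρ ^ (1 - b) * ‖toL2 n g‖ ^ 2 * t ^ j) :=
        (ENNReal.ofReal_tsum_of_nonneg (fun j => by positivity)
          ((summable_geometric_of_lt_one ht0 ht1).mul_left _)).symm
    _ = _ := by
        rw [tsum_mul_left, tsum_geometric_of_lt_one ht0 ht1]
        congr 1
        ring

theorem exists_lintegral_sphFourier_le [n.AtLeastTwo] {b : ℝ} (hb : 1 < b) (hbn : b < n) :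
    ∃ C : ℝ, 0 ≤ C ∧ ∀ (k : ℕ) (Y : C(Sph n, ℂ)), Y ∈ sphericalHarmonics n k →
      ∫⁻ ξ, ENNReal.ofReal (‖ξ‖ ^ (-b)) * ‖sphFourier Y ξ‖ₑ ^ 2 ≤
        ENNReal.ofReal (C * (k + 1 : ℝ) ^ (1 - b) * ‖toL2 n Y‖ ^ 2) := by
  obtain ⟨C₁, hC₁, hlow⟩ := exists_low_frequency_le hbn
  obtain ⟨C₂, hC₂, hhigh⟩ := exists_high_frequency_le n hb
  refine ⟨C₁ + C₂ * (24 * Real.pi)⁻¹ ^ (1 - b), by positivity, fun k Y hY => ?_⟩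
  rw [← lintegral_add_compl _
    (Metric.isClosed_closedBall (x := 0) (ε := (24 * Real.pi)⁻¹ * (k + 1))).measurableSet]
  refine (add_le_add (hlow k Y hY) (hhigh Y _ (by positivity))).trans ?_
  rw [← ENNReal.ofReal_add (by positivity) (by positivity),
    Real.mul_rpow (by positivity) (by positivity)]
  exact ENNReal.ofReal_le_ofReal (le_of_eq (by ring))

end RieszWeight

section FourierSphere

variable {n : ℕ}

theorem integral_fourier_mul {u : Eucl n → ℂ} (hu : Integrable u) (Y : C(Sph n, ℂ)) (ρ : ℝ) :
    ∫ θ : Sph n, 𝓕 u (ρ • (θ : Eucl n)) * Y θ ∂surf n = ∫ x, u x * sphFourier Y (ρ • x) := by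
  let Φ (θ : Sph n) (x : Eucl n) : ℂ :=
    Complex.exp (((-2 * Real.pi * inner ℝ (θ : Eucl n) (ρ • x) : ℝ) : ℂ) * Complex.I) * Y θ * u x
  have hΦ : Integrable (Function.uncurry Φ) ((surf n).prod volume) := by
    refine ((integrable_sphere (f := fun θ => ‖Y θ‖) (by fun_prop)).mul_prod hu.norm).mono'
      (AEStronglyMeasurable.mul (Continuous.aestronglyMeasurable (by fun_prop))
        hu.aestronglyMeasurable.comp_snd) (ae_of_all _ fun z => ?_)
    simp only [Φ, Function.uncurry_def, norm_mul, Complex.norm_exp_ofReal_mul_I, one_mul, le_refl]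
  calc ∫ θ : Sph n, 𝓕 u (ρ • (θ : Eucl n)) * Y θ ∂surf n
      = ∫ θ : Sph n, (∫ x, Φ θ x) ∂surf n := by
        refine integral_congr_ae (ae_of_all _ fun θ => ?_)
        simp only [Φ, Real.fourier_eq', smul_eq_mul]
        rw [← integral_mul_const]
        refine integral_congr_ae (ae_of_all _ fun x => ?_)
        simp only [inner_smul_right, real_inner_comm x]
        ring
    _ = ∫ x, (∫ θ : Sph n, Φ θ x ∂surf n) := integral_integral_swap hΦ
    _ = ∫ x, u x * sphFourier Y (ρ • x) :=
        integral_congr_ae (ae_of_all _ fun x => (integral_mul_const _ _).trans (mul_comm _ _))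

/-- The function on `ℝⁿ` that restricts to `G r` on the sphere of radius `r > 0`; it takes the
value `0` at the origin. -/
def onSphere (G : ℝ → C(Sph n, ℂ)) (x : Eucl n) : ℂ :=
  if hx : x = 0 then 0 else G ‖x‖ ⟨‖x‖⁻¹ • x, by simp [norm_smul, hx]⟩

theorem onSphere_smul (G : ℝ → C(Sph n, ℂ)) {r : ℝ} (hr : 0 < r) (ω : Sph n) :
    onSphere G (r • (ω : Eucl n)) = G r ω := by
  have hnorm := norm_smul_coe_sphere hr.le ω
  rw [onSphere, dif_neg (norm_pos_iff.1 (hnorm.symm ▸ hr))]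
  congr 1
  · rw [hnorm]
  · ext1
    simp only [hnorm, smul_smul, inv_mul_cancel₀ hr.ne', one_smul]

theorem exists_eq_smul {x : Eucl n} (hx : x ≠ 0) : ∃ ω : Sph n, x = ‖x‖ • (ω : Eucl n) :=
  ⟨⟨‖x‖⁻¹ • x, by simp [norm_smul, hx]⟩, by simp [smul_smul, hx]⟩

theorem norm_onSphere_le (G : ℝ → C(Sph n, ℂ)) (x : Eucl n) : ‖onSphere G x‖ ≤ ‖G ‖x‖‖ := by
  rw [onSphere]
  split_ifs
  · simp
  · exact ContinuousMap.norm_coe_le_norm _ _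

theorem measurable_onSphere {G : ℝ → C(Sph n, ℂ)} (hG : Continuous G) :
    Measurable (onSphere G) := by
  refine measurable_of_measurable_on_compl_singleton 0 (Continuous.measurable ?_)
  have hdom : ({0}ᶜ : Set (Eucl n)).domRestrict (onSphere G) = fun x : ({0}ᶜ : Set (Eucl n)) =>
      G ‖(x : Eucl n)‖ ⟨‖(x : Eucl n)‖⁻¹ • (x : Eucl n), by
        simp [norm_smul, show (x : Eucl n) ≠ 0 from x.2]⟩ :=
    funext fun x => dif_neg x.2
  have hinv : Continuous fun x : ({0}ᶜ : Set (Eucl n)) => ‖(x : Eucl n)‖⁻¹ :=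
    Continuous.inv₀ (by fun_prop) fun x => norm_ne_zero_iff.2 x.2
  change Continuous (({0}ᶜ : Set (Eucl n)).domRestrict (onSphere G))
  rw [hdom]
  exact ContinuousEval.continuous_eval.comp (Continuous.prodMk (by fun_prop)
    (Continuous.subtype_mk (hinv.smul continuous_subtype_val) _))

theorem continuous_restrictSphere (f : 𝓢(Eucl n, ℂ)) : Continuous (restrictSphere f) :=
  ContinuousMap.continuous_of_continuous_uncurry _ (f.continuous.comp (by fun_prop))

theorem continuous_harmonicPart (k : ℕ) : Continuous (harmonicPart n k) := by
  have hsymm := LinearMap.continuous_of_finiteDimensional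
    ((sphericalHarmonics n k).subtype ∘ₗ (Submodule.equivMapOfInjective (toL2 n)
      (toL2_injective n) (sphericalHarmonics n k)).symm.toLinearMap :
        sphericalHarmonicsL2 n k →ₗ[ℂ] C(Sph n, ℂ))
  exact hsymm.comp ((sphericalHarmonicsL2 n k).orthogonalProjectionOnto.continuous.comp
    (ContinuousMap.toLp (E := ℂ) 2 (surf n) ℂ).continuous)

theorem norm_sq_toL2_harmonicPart (k : ℕ) (g : C(Sph n, ℂ)) :
    ((‖toL2 n (harmonicPart n k g)‖ ^ 2 : ℝ) : ℂ) =
      ∫ ω, g ω * star (harmonicPart n k g) ω ∂surf n := by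
  rw [← integral_harmonicPart_mul (star_mem_sphericalHarmonics (harmonicPart_mem k g)),
    norm_sq_toL2, ← integral_complex_ofReal]
  refine integral_congr_ae (ae_of_all _ fun ω => ?_)
  simp [← Complex.normSq_eq_norm_sq, Complex.mul_conj]

theorem schwartz_eq_fourier (f : 𝓢(Eucl n, ℂ)) (x : Eucl n) :
    f x = 𝓕 (⇑(𝓕 f : 𝓢(Eucl n, ℂ))) (-x) := by
  conv_lhs => rw [← FourierTransform.fourierInv_fourier_eq (F := 𝓢(Eucl n, ℂ)) f]
  rw [SchwartzMap.fourierInv_coe, Real.fourierInv_eq_fourier_neg]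

theorem norm_sq_harmonicPart_eq (f : 𝓢(Eucl n, ℂ)) (k : ℕ) (r : ℝ) :
    ((‖toL2 n (harmonicPart n k (restrictSphere f r))‖ ^ 2 : ℝ) : ℂ) =
      ∫ ξ, (𝓕 f) ξ * sphFourier (star (harmonicPart n k (restrictSphere f r))) ((-r) • ξ) := by
  rw [norm_sq_toL2_harmonicPart, ← integral_fourier_mul (𝓕 f).integrable]
  refine integral_congr_ae (ae_of_all _ fun ω => ?_)
  simp only [restrictSphere, ContinuousMap.coe_mk]
  rw [schwartz_eq_fourier, neg_smul]

theorem norm_toL2_star (g : C(Sph n, ℂ)) : ‖toL2 n (star g)‖ = ‖toL2 n g‖ := by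
  rw [← sq_eq_sq₀ (norm_nonneg _) (norm_nonneg _), norm_sq_toL2, norm_sq_toL2]
  simp

theorem integrable_schwartz_mul_pow (f : 𝓢(Eucl n, ℂ)) (N : ℕ) :
    Integrable fun x => ‖f x‖ * (1 + ‖x‖) ^ N := by
  simp only [add_comm (1 : ℝ), add_pow, Finset.mul_sum, one_pow, mul_one]
  refine integrable_finsetSum _ fun m _ => ?_
  exact ((f.integrable_pow_mul volume m).mul_const (N.choose m : ℝ)).congr
    (ae_of_all _ fun x => by ring)

theorem exists_norm_toL2_harmonicPart_le [n.AtLeastTwo] (f : 𝓢(Eucl n, ℂ)) (N : ℕ) :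
    ∃ C : ℝ, 0 ≤ C ∧ ∀ (k : ℕ) (r : ℝ),
      ‖toL2 n (harmonicPart n k (restrictSphere f r))‖ ≤ C * ((1 + |r|) / (k + 1)) ^ N := by
  obtain ⟨C, hC, hsph⟩ := exists_norm_sphFourier_le n N
  have hI : 0 ≤ ∫ ξ, ‖(𝓕 f) ξ‖ * (1 + ‖ξ‖) ^ N := integral_nonneg fun ξ => by positivity
  refine ⟨C * ∫ ξ, ‖(𝓕 f) ξ‖ * (1 + ‖ξ‖) ^ N, mul_nonneg hC hI, fun k r => ?_⟩
  set Y := harmonicPart n k (restrictSphere f r)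
  have hbound (ξ : Eucl n) : ‖sphFourier (star Y) ((-r) • ξ)‖ ≤
      C * ((1 + ‖ξ‖) * ((1 + |r|) / (k + 1))) ^ N * ‖toL2 n Y‖ := by
    refine (hsph k _ (star_mem_sphericalHarmonics (harmonicPart_mem k _)) _).trans ?_
    rw [norm_toL2_star, norm_smul, norm_neg, Real.norm_eq_abs, ← mul_div_assoc]
    gcongr
    nlinarith [abs_nonneg r, norm_nonneg ξ]
  have hsq : ‖toL2 n Y‖ * ‖toL2 n Y‖ ≤
      C * (∫ ξ, ‖(𝓕 f) ξ‖ * (1 + ‖ξ‖) ^ N) * ((1 + |r|) / (k + 1)) ^ N * ‖toL2 n Y‖ :=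
    calc ‖toL2 n Y‖ * ‖toL2 n Y‖ = ‖∫ ξ, (𝓕 f) ξ * sphFourier (star Y) ((-r) • ξ)‖ := by
          rw [← norm_sq_harmonicPart_eq, Complex.norm_real, Real.norm_of_nonneg (by positivity),
            pow_two]
      _ ≤ ∫ ξ, (‖(𝓕 f) ξ‖ * (1 + ‖ξ‖) ^ N) * (C * ((1 + |r|) / (k + 1)) ^ N * ‖toL2 n Y‖) := by
          refine norm_integral_le_of_norm_le ((integrable_schwartz_mul_pow (𝓕 f) N).mul_const _)
            (ae_of_all _ fun ξ => ?_)
          rw [norm_mul]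
          refine (mul_le_mul_of_nonneg_left (hbound ξ) (norm_nonneg _)).trans_eq ?_
          rw [mul_pow]
          ring
      _ = _ := by rw [integral_mul_const]; ring
  rcases (norm_nonneg (toL2 n Y)).eq_or_lt with hY | hY
  · rw [← hY]
    positivity
  · exact le_of_mul_le_mul_right hsq hY

theorem exists_norm_sq_le_norm_sq_toL2 (n : ℕ) [n.AtLeastTwo] : ∃ C : ℝ, 0 < C ∧
    ∀ (k : ℕ) (Y : C(Sph n, ℂ)), Y ∈ sphericalHarmonics n k →
      ‖Y‖ ^ 2 ≤ C * (k + 1 : ℝ) ^ (n - 2) * ‖toL2 n Y‖ ^ 2 := by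
  have : NeZero (surf n) := ⟨Measure.toSphere_ne_zero _⟩
  have hσ : 0 < (surf n).real univ := measureReal_univ_pos
  refine ⟨2 / (surf n).real univ, by positivity, fun k Y hY => ?_⟩
  have hdim : (Module.finrank ℂ (sphericalHarmonicsL2 n k) : ℝ) ≤ 2 * (k + 1) ^ (n - 2) := by
    exact_mod_cast finrank_sphericalHarmonicsL2_le k
  rw [← Real.le_sqrt (norm_nonneg _) (by positivity), ContinuousMap.norm_le _ (Real.sqrt_nonneg _)]
  intro ω
  refine Real.le_sqrt_of_sq_le ?_
  rw [div_mul_eq_mul_div, div_mul_eq_mul_div, le_div_iff₀' hσ, norm_sq_toL2]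
  exact (surf_univ_mul_norm_sq_apply_le hY ω).trans
    (mul_le_mul_of_nonneg_right hdim (by positivity))

/-- Multiplication of a Schwartz function by `(1 + |x|²)^M`, which commutes with the projections
on the spherical harmonics. -/
def weightMul (M : ℕ) (f : 𝓢(Eucl n, ℂ)) : 𝓢(Eucl n, ℂ) :=
  SchwartzMap.smulLeftCLM ℂ (fun x : Eucl n => (1 + ‖x‖ ^ 2) ^ M) f

theorem weightMul_apply (M : ℕ) (f : 𝓢(Eucl n, ℂ)) (x : Eucl n) :
    weightMul M f x = (((1 + ‖x‖ ^ 2) ^ M : ℝ) : ℂ) * f x := by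
  have h : (fun x : Eucl n => (1 + ‖x‖ ^ 2) ^ M).HasTemperateGrowth := by fun_prop
  rw [weightMul, SchwartzMap.smulLeftCLM_apply_apply h, Complex.real_smul]

theorem restrictSphere_weightMul (M : ℕ) (f : 𝓢(Eucl n, ℂ)) (r : ℝ) :
    restrictSphere (weightMul M f) r = (((1 + r ^ 2) ^ M : ℝ) : ℂ) • restrictSphere f r := by
  ext ω
  simp [restrictSphere, weightMul_apply, norm_smul]

theorem exists_norm_toL2_harmonicPart_le_inv_pow [n.AtLeastTwo] (f : 𝓢(Eucl n, ℂ)) (M N : ℕ) :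
    ∃ C : ℝ, 0 ≤ C ∧ ∀ (k : ℕ) (r : ℝ), ‖toL2 n (harmonicPart n k (restrictSphere f r))‖ ≤
      C * ((k + 1 : ℝ) ^ M)⁻¹ * ((1 + |r|) ^ N)⁻¹ := by
  obtain ⟨C, hC, hdecay⟩ := exists_norm_toL2_harmonicPart_le (weightMul (M + N) f) M
  refine ⟨2 ^ (M + N) * C, by positivity, fun k r => ?_⟩
  set y := ‖toL2 n (harmonicPart n k (restrictSphere f r))‖ with hy
  have hweight : (1 + r ^ 2) ^ (M + N) * y ≤ C * ((1 + |r|) / (k + 1)) ^ M := by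
    have h := hdecay k r
    rwa [restrictSphere_weightMul, harmonicPart_smul, map_smul, norm_smul, Complex.norm_real,
      Real.norm_of_nonneg (by positivity), ← hy] at h
  have hbase : 1 + |r| ≤ 2 * (1 + r ^ 2) := by nlinarith [sq_abs r, sq_nonneg (|r| - 1)]
  have hmul : (1 + |r|) ^ M * (1 + |r|) ^ N * y ≤
      (1 + |r|) ^ M * (2 ^ (M + N) * C * ((k + 1 : ℝ) ^ M)⁻¹) :=
    calc _ ≤ (2 * (1 + r ^ 2)) ^ (M + N) * y := by rw [← pow_add]; gcongr
      _ = 2 ^ (M + N) * ((1 + r ^ 2) ^ (M + N) * y) := by rw [mul_pow]; ring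
      _ ≤ 2 ^ (M + N) * (C * ((1 + |r|) / (k + 1)) ^ M) := by gcongr
      _ = _ := by rw [div_pow]; ring
  rw [← div_eq_mul_inv, le_div_iff₀' (by positivity)]
  exact le_of_mul_le_mul_left (by rwa [← mul_assoc]) (by positivity : 0 < (1 + |r|) ^ M)

theorem exists_norm_harmonicPart_le [n.AtLeastTwo] (f : 𝓢(Eucl n, ℂ)) (N : ℕ) :
    ∃ C : ℝ, 0 ≤ C ∧ ∀ (k : ℕ) (r : ℝ), ‖harmonicPart n k (restrictSphere f r)‖ ≤
      C * ((k + 1 : ℝ) ^ N)⁻¹ * ((1 + |r|) ^ N)⁻¹ := by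
  obtain ⟨A, hA, hsup⟩ := exists_norm_sq_le_norm_sq_toL2 n
  obtain ⟨C, hC, hdecay⟩ := exists_norm_toL2_harmonicPart_le_inv_pow f (n + N) N
  refine ⟨√A * C, by positivity, fun k r => ?_⟩
  set Y := harmonicPart n k (restrictSphere f r)
  have hYsup : ‖Y‖ ≤ √A * (k + 1 : ℝ) ^ n * ‖toL2 n Y‖ := by
    refine le_of_sq_le_sq ((hsup k Y (harmonicPart_mem k _)).trans ?_) (by positivity)
    rw [mul_pow, mul_pow, Real.sq_sqrt hA.le, ← pow_mul]
    gcongr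
    · exact le_add_of_nonneg_left k.cast_nonneg
    · omega
  calc ‖Y‖ ≤ √A * (k + 1 : ℝ) ^ n * (C * ((k + 1 : ℝ) ^ (n + N))⁻¹ * ((1 + |r|) ^ N)⁻¹) :=
        hYsup.trans (by gcongr; exact hdecay k r)
    _ = _ := by
        rw [pow_add]
        field_simp

end FourierSphere

section Plancherel

variable {V F : Type*} [NormedAddCommGroup V] [InnerProductSpace ℝ V] [FiniteDimensional ℝ V]
  [MeasurableSpace V] [BorelSpace V] [NormedAddCommGroup F] [InnerProductSpace ℂ F]
  {h : V → F}

theorem continuous_fourier_of_integrable (hh : Integrable h) : Continuous (𝓕 h) :=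
  VectorFourier.fourierIntegral_continuous Real.continuous_fourierChar
    (by exact continuous_inner) hh

variable [CompleteSpace F]

theorem integral_fourier_smul_eq {g : V → ℂ} (hg : Integrable g) (hh : Integrable h) :
    ∫ x, 𝓕 g x • h x = ∫ x, g x • 𝓕 h x := by
  simpa only [flip_innerₗ] using!
    VectorFourier.integral_fourierIntegral_smul_eq_flip (μ := volume) (ν := volume)
      (L := innerₗ V) Real.continuous_fourierChar continuous_inner hg hh

theorem fourier_toLp_ae_eq (h1 : Integrable h) (h2 : MemLp h 2) :
    ⇑(𝓕 (h2.toLp h) : Lp F 2 (volume : Measure V)) =ᵐ[volume] 𝓕 h := by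
  refine ae_eq_of_integral_contDiff_smul_eq ((Lp.memLp _).locallyIntegrable (by norm_num))
    (continuous_fourier_of_integrable h1).locallyIntegrable fun φ hφ hφc => ?_
  have hsmooth : ContDiff ℝ (⊤ : ℕ∞) fun x => (φ x : ℂ) := Complex.ofRealCLM.contDiff.comp hφ
  set g : 𝓢(V, ℂ) :=
    HasCompactSupport.toSchwartzMap (hφc.comp_left Complex.ofReal_zero) hsmooth
  have hdual : ∫ x, 𝓕 g x • h2.toLp h x = ∫ x, g x • (𝓕 (h2.toLp h) : Lp F 2 volume) x := by
    simpa only [Lp.toTemperedDistribution_apply, TemperedDistribution.fourier_apply] using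
      congrArg (fun T => T g) (Lp.fourier_toTemperedDistribution_eq (h2.toLp h))
  have hcoe : ∫ x, 𝓕 g x • h2.toLp h x = ∫ x, 𝓕 g x • h x :=
    integral_congr_ae (h2.coeFn_toLp.mono fun x hx => congrArg (𝓕 g x • ·) hx)
  calc ∫ x, φ x • (𝓕 (h2.toLp h) : Lp F 2 volume) x = ∫ x, 𝓕 (⇑g) x • h x := by
        rw [← SchwartzMap.fourier_coe, ← hcoe, hdual]
        rfl
    _ = ∫ x, φ x • 𝓕 h x := integral_fourier_smul_eq g.integrable h1

theorem eLpNorm_fourier_eq (h1 : Integrable h) (h2 : MemLp h 2) :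
    eLpNorm (𝓕 h) 2 volume = eLpNorm h 2 volume := by
  have hnorm := Lp.norm_fourier_eq (h2.toLp h)
  rw [Lp.norm_def, Lp.norm_def,
    ENNReal.toReal_eq_toReal_iff' (Lp.eLpNorm_ne_top _) (Lp.eLpNorm_ne_top _)] at hnorm
  rw [← eLpNorm_congr_ae (fourier_toLp_ae_eq h1 h2), hnorm, eLpNorm_congr_ae h2.coeFn_toLp]

theorem eLpNorm_fourierInv_eq (h1 : Integrable h) (h2 : MemLp h 2) :
    eLpNorm (𝓕⁻ h) 2 volume = eLpNorm h 2 volume := by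
  rw [← eLpNorm_fourier_eq h1 h2, ← eLpNorm_comp_measurePreserving
    (continuous_fourier_of_integrable h1).aestronglyMeasurable
    (Measure.measurePreserving_neg volume)]
  exact congrArg (eLpNorm · 2 volume) (funext fun x => Real.fourierInv_eq_fourier_neg h x)

end Plancherel

section CauchySchwarz

variable {X : Type*} [MeasurableSpace X] {μ : Measure X}

theorem eLpNorm_two_sq {E : Type*} [NormedAddCommGroup E] (g : X → E) :
    eLpNorm g 2 μ ^ 2 = ∫⁻ x, ‖g x‖ₑ ^ 2 ∂μ := by
  simpa only [NNReal.coe_ofNat, ENNReal.rpow_ofNat] using!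
    eLpNorm_nnreal_pow_eq_lintegral (f := g) (μ := μ) (p := 2) two_ne_zero

theorem sq_lintegral_mul_le {f g : X → ℝ≥0∞} (hf : AEMeasurable f μ) (hg : AEMeasurable g μ) :
    (∫⁻ x, f x * g x ∂μ) ^ 2 ≤ (∫⁻ x, f x ^ 2 ∂μ) * ∫⁻ x, g x ^ 2 ∂μ := by
  refine (pow_le_pow_left' (ENNReal.lintegral_mul_le_Lp_mul_Lq μ Real.HolderConjugate.two_two
    hf hg) 2).trans_eq ?_
  rw [mul_pow, ← ENNReal.rpow_natCast, ← ENNReal.rpow_natCast, ← ENNReal.rpow_mul,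
    ← ENNReal.rpow_mul]
  norm_num

theorem sq_tsum_mul_le (f g : ℕ → ℝ≥0∞) :
    (∑' k, f k * g k) ^ 2 ≤ (∑' k, f k ^ 2) * ∑' k, g k ^ 2 := by
  simpa only [lintegral_count] using sq_lintegral_mul_le (μ := Measure.count)
    (measurable_of_countable f).aemeasurable (measurable_of_countable g).aemeasurable

theorem rpow_half_sq (x : ℝ≥0∞) : (x ^ (1 / 2 : ℝ)) ^ 2 = x := by
  rw [← ENNReal.rpow_natCast, ← ENNReal.rpow_mul]
  norm_num

theorem le_of_sq_le_mul_self {x y : ℝ≥0∞} (hx : x ≠ ∞) (hxy : x ^ 2 ≤ x * y) : x ≤ y := by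
  rcases eq_or_ne x 0 with rfl | hx0
  · exact zero_le
  · exact (ENNReal.mul_le_mul_iff_right hx0 hx).1 (by rwa [← pow_two])

theorem le_nnreal_sqrt_mul_of_sq_le {x y : ℝ≥0∞} {c : ℝ} (hxy : x ^ 2 ≤ ENNReal.ofReal c * y ^ 2) :
    x ≤ (NNReal.sqrt c.toNNReal : ℝ≥0∞) * y := by
  refine (ENNReal.pow_le_pow_left_iff two_ne_zero).1 (hxy.trans_eq ?_)
  rw [mul_pow, ← ENNReal.coe_pow, NNReal.sq_sqrt, ENNReal.ofReal]

/-- Minkowski's integral inequality in `ℓ²`. -/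
theorem tsum_sq_lintegral_le {y : ℕ → X → ℝ≥0∞} {Z : X → ℝ≥0∞} (hy : ∀ k, Measurable (y k))
    (hZ : ∀ x, ∑' k, y k x ^ 2 ≤ Z x ^ 2) :
    ∑' k, (∫⁻ x, y k x ∂μ) ^ 2 ≤ (∫⁻ x, Z x ∂μ) ^ 2 := by
  rcases eq_or_ne (∫⁻ x, Z x ∂μ) ∞ with htop | htop
  · simp [htop]
  have hyZ (k : ℕ) (x : X) : y k x ≤ Z x :=
    (ENNReal.pow_le_pow_left_iff two_ne_zero).1 ((ENNReal.le_tsum k).trans (hZ x))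
  have hfinite (k : ℕ) : ∫⁻ x, y k x ∂μ ≠ ∞ := ne_top_of_le_ne_top htop (lintegral_mono (hyZ k))
  rw [ENNReal.tsum_eq_iSup_sum]
  refine iSup_le fun s => ?_
  set S := ∑ k ∈ s, (∫⁻ x, y k x ∂μ) ^ 2
  have hS : S ≠ ∞ := ENNReal.sum_ne_top.2 fun k _ => ENNReal.pow_ne_top (hfinite k)
  have hcauchy (x : X) : ∑ k ∈ s, (∫⁻ x, y k x ∂μ) * y k x ≤ S ^ (1 / 2 : ℝ) * Z x := by
    refine (ENNReal.pow_le_pow_left_iff two_ne_zero).1 ?_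
    rw [mul_pow, rpow_half_sq]
    have := sq_lintegral_mul_le (μ := Measure.count.restrict (s : Set ℕ))
      (measurable_of_countable fun k => ∫⁻ x, y k x ∂μ).aemeasurable
      (measurable_of_countable fun k => y k x).aemeasurable
    simp only [lintegral_finset, Measure.count_singleton, mul_one] at this
    exact this.trans (mul_le_mul' le_rfl ((ENNReal.sum_le_tsum s).trans (hZ x)))
  have hself : S ≤ S ^ (1 / 2 : ℝ) * ∫⁻ x, Z x ∂μ := by
    calc S = ∫⁻ x, ∑ k ∈ s, (∫⁻ x, y k x ∂μ) * y k x ∂μ := by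
          rw [lintegral_finsetSum _ fun k _ => (hy k).const_mul _]
          exact Finset.sum_congr rfl fun k _ => by rw [lintegral_const_mul _ (hy k), pow_two]
      _ ≤ ∫⁻ x, S ^ (1 / 2 : ℝ) * Z x ∂μ := lintegral_mono hcauchy
      _ = S ^ (1 / 2 : ℝ) * ∫⁻ x, Z x ∂μ :=
          lintegral_const_mul' _ _ (ENNReal.rpow_ne_top_of_nonneg (by norm_num) hS)
  refine le_of_sq_le_mul_self hS ?_
  rw [← rpow_half_sq S, ← mul_pow, rpow_half_sq]
  gcongr

theorem lintegral_mul_lintegral_swap {Y : Type*} [MeasurableSpace Y] {ν : Measure Y} [SFinite μ]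
    [SFinite ν] {u : X → ℝ≥0∞} {v : Y → ℝ≥0∞} {S : X → Y → ℝ≥0∞} (hu : Measurable u)
    (hv : Measurable v) (hS : Measurable fun p : X × Y => S p.1 p.2) :
    ∫⁻ x, u x * ∫⁻ y, v y * S x y ∂ν ∂μ = ∫⁻ y, v y * ∫⁻ x, u x * S x y ∂μ ∂ν := by
  have hx (x : X) : Measurable (S x) := hS.comp measurable_prodMk_left
  have hy (y : Y) : Measurable fun x => S x y := hS.comp measurable_prodMk_right
  calc _ = ∫⁻ x, ∫⁻ y, u x * (v y * S x y) ∂ν ∂μ :=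
        lintegral_congr fun x => (lintegral_const_mul _ (hv.mul (hx x))).symm
    _ = ∫⁻ y, ∫⁻ x, u x * (v y * S x y) ∂μ ∂ν :=
        lintegral_lintegral_swap (Measurable.aemeasurable (by fun_prop))
    _ = _ := by
        refine lintegral_congr fun y => ?_
        rw [← lintegral_const_mul _ (by fun_prop : Measurable fun x => u x * S x y)]
        exact lintegral_congr fun x => mul_left_comm _ _ _

end CauchySchwarz

section Multiplier

variable {n : ℕ}

/-- Sequences of at most polynomial growth, the multipliers that preserve the rapid decay of the
harmonic expansion of a Schwartz function. -/
def PolyGrowth (m : ℕ → ℂ) : Prop := ∃ A : ℝ, 0 ≤ A ∧ ∃ N : ℕ, ∀ k, ‖m k‖ ≤ A * (k + 1 : ℝ) ^ N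

/-- The angular multiplier acting on the harmonic component of degree `k` as multiplication by
`m k`. -/
def angularMult (m : ℕ → ℂ) (g : C(Sph n, ℂ)) : C(Sph n, ℂ) :=
  ∑' k, m k • harmonicPart n k g

/-- The angular multiplier with symbol `m`, acting on a Schwartz function on every sphere about
the origin. -/
def angularOp (m : ℕ → ℂ) (f : 𝓢(Eucl n, ℂ)) : Eucl n → ℂ :=
  onSphere fun r => angularMult m (restrictSphere f r)

theorem summable_succ_sq_inv : Summable fun k : ℕ => (((k : ℝ) + 1) ^ 2)⁻¹ := by
  simpa using (summable_nat_add_iff 1).2 (Real.summable_nat_pow_inv (p := 2).2 one_lt_two)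

/-- The projection onto the spherical harmonics of degree `k` as a continuous linear map. -/
def harmonicPartL (n k : ℕ) [NeZero n] : C(Sph n, ℂ) →L[ℂ] C(Sph n, ℂ) where
  toFun := harmonicPart n k
  map_add' g h := harmonicPart_add k g h
  map_smul' c g := harmonicPart_smul k c g
  cont := continuous_harmonicPart k

theorem polyGrowth_one : PolyGrowth fun _ => 1 := ⟨1, zero_le_one, 0, fun l => by simp⟩

theorem polyGrowth_single (k : ℕ) : PolyGrowth (Pi.single k 1) := by
  refine ⟨1, zero_le_one, 0, fun l => ?_⟩
  rw [Pi.single_apply]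
  split_ifs <;> simp

theorem angularMult_single (k : ℕ) (g : C(Sph n, ℂ)) :
    angularMult (Pi.single k 1) g = harmonicPart n k g := by
  rw [angularMult, tsum_eq_single k fun l hl => by
    rw [Pi.single_eq_of_ne hl]; exact zero_smul ℂ (harmonicPart n l g), Pi.single_eq_same]
  exact one_smul ℂ _

theorem integrable_mul_sphFourier {v : Eucl n → ℂ} (hv : Integrable v) (Y : C(Sph n, ℂ)) (ρ : ℝ) :
    Integrable fun x => v x * sphFourier Y (ρ • x) :=
  hv.mul_bdd (c := ∫ ω, ‖Y ω‖ ∂surf n) (Continuous.aestronglyMeasurable (by fun_prop))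
    (ae_of_all _ fun x => norm_sphFourier_le _ _)

theorem ae_ne_zero [NeZero n] : ∀ᵐ x : Eucl n, x ≠ 0 := by simp [ae_iff]

variable [n.AtLeastTwo] {m : ℕ → ℂ}

theorem PolyGrowth.exists_norm_smul_harmonicPart_le (hm : PolyGrowth m) (f : 𝓢(Eucl n, ℂ))
    (M : ℕ) : ∃ C : ℝ, 0 ≤ C ∧ ∀ (k : ℕ) (r : ℝ), ‖m k • harmonicPart n k (restrictSphere f r)‖ ≤
      C * (((k : ℝ) + 1) ^ 2)⁻¹ * ((1 + |r|) ^ M)⁻¹ := by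
  obtain ⟨A, hA, N, hgrowth⟩ := hm
  obtain ⟨C, hC, hdecay⟩ := exists_norm_harmonicPart_le f (N + 2 + M)
  refine ⟨A * C, mul_nonneg hA hC, fun k r => ?_⟩
  have hk : (1 : ℝ) ≤ k + 1 := le_add_of_nonneg_left k.cast_nonneg
  have hr : 1 ≤ 1 + |r| := le_add_of_nonneg_right (abs_nonneg r)
  rw [norm_smul]
  calc _ ≤ A * (k + 1 : ℝ) ^ N *
        (C * ((k + 1 : ℝ) ^ (N + 2 + M))⁻¹ * ((1 + |r|) ^ (N + 2 + M))⁻¹) := by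
        gcongr
        · exact hgrowth k
        · exact hdecay k r
    _ ≤ A * (k + 1 : ℝ) ^ N * (C * ((k + 1 : ℝ) ^ (N + 2))⁻¹ * ((1 + |r|) ^ M)⁻¹) := by
        have hkpow := pow_le_pow_right₀ hk (Nat.le_add_right (N + 2) M)
        have hrpow := pow_le_pow_right₀ hr (Nat.le_add_left M (N + 2))
        gcongr
    _ = _ := by
        rw [pow_add]
        field_simp

theorem PolyGrowth.summable (hm : PolyGrowth m) (f : 𝓢(Eucl n, ℂ)) (r : ℝ) :
    Summable fun k => m k • harmonicPart n k (restrictSphere f r) := by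
  obtain ⟨C, -, hC⟩ := hm.exists_norm_smul_harmonicPart_le f 0
  exact Summable.of_norm_bounded (summable_succ_sq_inv.mul_left C) fun k => by simpa using hC k r

theorem PolyGrowth.continuous_angularMult (hm : PolyGrowth m) (f : 𝓢(Eucl n, ℂ)) :
    Continuous fun r => angularMult m (restrictSphere f r) := by
  obtain ⟨C, -, hC⟩ := hm.exists_norm_smul_harmonicPart_le f 0
  refine continuous_tsum (fun k => ?_) (summable_succ_sq_inv.mul_left C) fun k r => ?_
  · exact ((continuous_harmonicPart k).comp (continuous_restrictSphere f)).const_smul (m k)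
  · simpa using hC k r

theorem PolyGrowth.exists_norm_angularMult_le (hm : PolyGrowth m) (f : 𝓢(Eucl n, ℂ)) (M : ℕ) :
    ∃ C : ℝ, 0 ≤ C ∧ ∀ r : ℝ, ‖angularMult m (restrictSphere f r)‖ ≤ C * ((1 + |r|) ^ M)⁻¹ := by
  obtain ⟨C, hC₀, hC⟩ := hm.exists_norm_smul_harmonicPart_le f M
  refine ⟨C * ∑' k : ℕ, (((k : ℝ) + 1) ^ 2)⁻¹,
    mul_nonneg hC₀ (tsum_nonneg fun k => by positivity), fun r => ?_⟩
  exact tsum_of_norm_bounded ((summable_succ_sq_inv.hasSum.mul_left C).mul_right _) fun k => hC k r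

theorem PolyGrowth.harmonicPart_angularMult (hm : PolyGrowth m) (f : 𝓢(Eucl n, ℂ)) (r : ℝ)
    (l : ℕ) : harmonicPart n l (angularMult m (restrictSphere f r)) =
      m l • harmonicPart n l (restrictSphere f r) := by
  change harmonicPartL n l _ = _
  rw [angularMult, (harmonicPartL n l).map_tsum (hm.summable f r), tsum_eq_single l]
  · rw [map_smul]
    exact congrArg _ (harmonicPart_of_mem (harmonicPart_mem l _))
  · intro k hk
    rw [map_smul]
    change m k • harmonicPart n l _ = 0
    rw [harmonicPart_of_mem_of_ne hk (harmonicPart_mem k _)]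
    exact smul_zero (A := C(Sph n, ℂ)) (m k)

theorem PolyGrowth.integral_angularMult_mul (hm : PolyGrowth m) (f : 𝓢(Eucl n, ℂ)) (r : ℝ) {l : ℕ}
    {Y : C(Sph n, ℂ)} (hY : Y ∈ sphericalHarmonics n l) :
    ∫ ω, angularMult m (restrictSphere f r) ω * Y ω ∂surf n =
      m l * ∫ ω, restrictSphere f r ω * Y ω ∂surf n := by
  rw [← integral_harmonicPart_mul hY, hm.harmonicPart_angularMult,
    ← integral_harmonicPart_mul hY (restrictSphere f r), ← integral_const_mul]
  simp [mul_assoc]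

theorem angularMult_one (f : 𝓢(Eucl n, ℂ)) (r : ℝ) :
    angularMult (fun _ => 1) (restrictSphere f r) = restrictSphere f r :=
  eq_of_integral_mul_eq fun l Y hY => by
    rw [polyGrowth_one.integral_angularMult_mul f r hY, one_mul]

theorem PolyGrowth.integrable_angularOp (hm : PolyGrowth m) (f : 𝓢(Eucl n, ℂ)) :
    Integrable (angularOp m f) := by
  obtain ⟨C, -, hC⟩ := hm.exists_norm_angularMult_le f (n + 1)
  have hint : Integrable fun x : Eucl n => C * (1 + ‖x‖) ^ (-((n : ℝ) + 1)) :=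
    (integrable_one_add_norm (by simp)).const_mul C
  refine hint.mono' (measurable_onSphere (hm.continuous_angularMult f)).aestronglyMeasurable
    (ae_of_all _ fun x => ?_)
  refine (norm_onSphere_le _ x).trans ((hC ‖x‖).trans_eq ?_)
  rw [abs_norm, Real.rpow_neg (by positivity)]
  norm_cast

theorem PolyGrowth.integral_angularOp_mul_sphFourier (hm : PolyGrowth m) (f : 𝓢(Eucl n, ℂ))
    {l : ℕ} {Y : C(Sph n, ℂ)} (hY : Y ∈ sphericalHarmonics n l) (ρ : ℝ) :
    ∫ x, angularOp m f x * sphFourier Y (ρ • x) = m l * ∫ x, f x * sphFourier Y (ρ • x) := by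
  rw [integral_eq_integral_Ioi_toSphere (integrable_mul_sphFourier (hm.integrable_angularOp f) Y ρ),
    integral_eq_integral_Ioi_toSphere (integrable_mul_sphFourier f.integrable Y ρ),
    ← integral_const_mul]
  refine setIntegral_congr_fun measurableSet_Ioi fun r hr => ?_
  have hdilate (ω : Sph n) : sphFourier Y (ρ • (r • (ω : Eucl n))) = sphFourierOn Y (ρ * r) ω := by
    rw [smul_smul]
    rfl
  simp only [hdilate, angularOp, onSphere_smul _ hr]
  rw [hm.integral_angularMult_mul f r (sphFourierOn_mem hY (ρ * r)), mul_smul_comm]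
  rfl

theorem PolyGrowth.fourier_angularOp (hm : PolyGrowth m) (f : 𝓢(Eucl n, ℂ)) {ξ : Eucl n}
    (hξ : ξ ≠ 0) : 𝓕 (angularOp m f) ξ = angularOp m (𝓕 f) ξ := by
  have hint := hm.integrable_angularOp f
  let U : C(Sph n, ℂ) := ⟨fun θ => 𝓕 (angularOp m f) (‖ξ‖ • (θ : Eucl n)),
    (continuous_fourier_of_integrable hint).comp (by fun_prop)⟩
  have hU : U = angularMult m (restrictSphere (𝓕 f) ‖ξ‖) := by
    refine eq_of_integral_mul_eq fun l Y hY => ?_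
    calc ∫ ω, U ω * Y ω ∂surf n = ∫ x, angularOp m f x * sphFourier Y (‖ξ‖ • x) :=
          integral_fourier_mul hint Y ‖ξ‖
      _ = m l * ∫ x, f x * sphFourier Y (‖ξ‖ • x) := hm.integral_angularOp_mul_sphFourier f hY _
      _ = m l * ∫ ω, restrictSphere (𝓕 f) ‖ξ‖ ω * Y ω ∂surf n :=
          congrArg _ (integral_fourier_mul f.integrable Y ‖ξ‖).symm
      _ = _ := (hm.integral_angularMult_mul _ _ hY).symm
  obtain ⟨θ, hθ⟩ := exists_eq_smul hξ
  calc 𝓕 (angularOp m f) ξ = U θ := congrArg _ hθ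
    _ = angularMult m (restrictSphere (𝓕 f) ‖ξ‖) θ := by rw [hU]
    _ = angularOp m (𝓕 f) (‖ξ‖ • θ) := Eq.symm <|
        onSphere_smul (fun r => angularMult m (restrictSphere (𝓕 f) r)) (norm_pos_iff.2 hξ) θ
    _ = angularOp m (𝓕 f) ξ := by rw [← hθ]

end Multiplier

section AngularSymbol

variable {n : ℕ} [n.AtLeastTwo]

/-- The symbol of the angular multiplier `Λ_ω^s`. -/
def angularSymbol (n : ℕ) (s : ℝ) (k : ℕ) : ℂ := (((1 + sphEigenvalue n k) ^ (s / 2) : ℝ) : ℂ)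

theorem two_le_cast (n : ℕ) [n.AtLeastTwo] : (2 : ℝ) ≤ n := mod_cast Nat.AtLeastTwo.prop

theorem sphEigenvalue_nonneg (n : ℕ) [n.AtLeastTwo] (k : ℕ) : 0 ≤ sphEigenvalue n k :=
  mul_nonneg k.cast_nonneg (by linarith [two_le_cast n, (k.cast_nonneg : (0 : ℝ) ≤ k)])

theorem one_add_sphEigenvalue_le (n : ℕ) [n.AtLeastTwo] (k : ℕ) :
    1 + sphEigenvalue n k ≤ n * (k + 1 : ℝ) ^ 2 := by
  have hn : (0 : ℝ) ≤ n - 2 := sub_nonneg.2 (two_le_cast n)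
  have hk : (0 : ℝ) ≤ k := k.cast_nonneg
  rw [sphEigenvalue]
  nlinarith [mul_nonneg hk hk, mul_nonneg hk hn, mul_nonneg (mul_nonneg hk hk) hn]

theorem le_one_add_sphEigenvalue (n : ℕ) [n.AtLeastTwo] (k : ℕ) :
    (2 : ℝ)⁻¹ * (k + 1 : ℝ) ^ 2 ≤ 1 + sphEigenvalue n k := by
  have hk : (0 : ℝ) ≤ k := k.cast_nonneg
  rw [sphEigenvalue]
  nlinarith [mul_nonneg hk (sub_nonneg.2 (two_le_cast n)), sq_nonneg ((k : ℝ) - 1)]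

theorem polyGrowth_angularSymbol (n : ℕ) [n.AtLeastTwo] (s : ℝ) :
    PolyGrowth (angularSymbol n s) := by
  obtain ⟨N, hN⟩ := exists_nat_ge (s / 2)
  refine ⟨(n : ℝ) ^ N, by positivity, 2 * N, fun k => ?_⟩
  have hpos := sphEigenvalue_nonneg n k
  rw [angularSymbol, Complex.norm_real, Real.norm_of_nonneg (by positivity)]
  calc (1 + sphEigenvalue n k) ^ (s / 2) ≤ (1 + sphEigenvalue n k) ^ (N : ℝ) :=
        Real.rpow_le_rpow_of_exponent_le (by linarith) hN
    _ = (1 + sphEigenvalue n k) ^ N := Real.rpow_natCast _ _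
    _ ≤ (n * (k + 1 : ℝ) ^ 2) ^ N := by
        gcongr
        exact one_add_sphEigenvalue_le n k
    _ = _ := by rw [mul_pow, pow_mul]

theorem angularPow_ae_eq (s : ℝ) (f : 𝓢(Eucl n, ℂ)) :
    angularPow s f =ᵐ[volume] angularOp (angularSymbol n s) f := by
  filter_upwards [ae_ne_zero] with x hx
  rw [angularPow, dif_neg hx, angularOp, onSphere, dif_neg hx, angularMult]
  exact ContinuousMap.tsum_apply ((polyGrowth_angularSymbol n s).summable f ‖x‖) _

end AngularSymbol

section Weighted

variable {n : ℕ}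

theorem lintegral_closedBall_rpow_mul_lt_top [NeZero n] {a C : ℝ} (ha : -(n : ℝ) < a) (hC : 0 ≤ C)
    {v : Eucl n → ℝ} (hv : ∀ x, v x ≤ C) :
    ∫⁻ x in Metric.closedBall 0 1, ENNReal.ofReal (‖x‖ ^ a * v x) < ∞ := by
  have hint := lintegral_closedBall_norm_rpow_neg (μ := (volume : Measure (Eucl n))) (b := -a)
    (by rw [finrank_euclideanSpace_fin]; linarith) zero_le_one
  calc ∫⁻ x in Metric.closedBall 0 1, ENNReal.ofReal (‖x‖ ^ a * v x)
      ≤ ∫⁻ x : Eucl n in Metric.closedBall 0 1,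
          ENNReal.ofReal C * ENNReal.ofReal (‖x‖ ^ (-(-a))) := by
        refine lintegral_mono fun x => ?_
        rw [← ENNReal.ofReal_mul hC, neg_neg, mul_comm C]
        gcongr
        exact hv x
    _ < ∞ := by
        rw [lintegral_const_mul _ (by fun_prop), hint]
        exact ENNReal.mul_lt_top ENNReal.ofReal_lt_top ENNReal.ofReal_lt_top

theorem rpow_mul_inv_pow_le {a t : ℝ} {N M : ℕ} (ha : a ≤ N) (ht : 1 ≤ t) :
    t ^ a * ((1 + t) ^ (N + M))⁻¹ ≤ ((1 + t) ^ M)⁻¹ := by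
  have hrpow : t ^ a ≤ (1 + t) ^ N :=
    calc t ^ a ≤ t ^ (N : ℝ) := Real.rpow_le_rpow_of_exponent_le ht ha
      _ = t ^ N := Real.rpow_natCast _ _
      _ ≤ (1 + t) ^ N := by gcongr; linarith
  calc t ^ a * ((1 + t) ^ (N + M))⁻¹ ≤ (1 + t) ^ N * ((1 + t) ^ (N + M))⁻¹ := by gcongr
    _ = ((1 + t) ^ M)⁻¹ := by
      rw [pow_add]
      field_simp

theorem lintegral_rpow_mul_lt_top [NeZero n] {a : ℝ} (ha : -(n : ℝ) < a) {v : Eucl n → ℝ}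
    (hv : ∀ M : ℕ, ∃ C : ℝ, 0 ≤ C ∧ ∀ x, v x ≤ C * ((1 + ‖x‖) ^ M)⁻¹) :
    ∫⁻ x, ENNReal.ofReal (‖x‖ ^ a * v x) < ∞ := by
  have hball := (Metric.isClosed_closedBall (x := (0 : Eucl n)) (ε := 1)).measurableSet
  rw [← lintegral_add_compl _ hball, ENNReal.add_lt_top]
  constructor
  · obtain ⟨C, hC, hbound⟩ := hv 0
    exact lintegral_closedBall_rpow_mul_lt_top ha hC fun x => by simpa using hbound x
  obtain ⟨N, hN⟩ := exists_nat_ge a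
  obtain ⟨C, hC, hdecay⟩ := hv (N + (n + 1))
  have hint : Integrable fun x : Eucl n => C * (1 + ‖x‖) ^ (-((n : ℝ) + 1)) :=
    (integrable_one_add_norm (by simp)).const_mul C
  refine lt_of_le_of_lt (setLIntegral_mono' hball.compl
    fun x hx => ENNReal.ofReal_le_ofReal ?_)
    ((setLIntegral_le_lintegral _ _).trans_lt hint.lintegral_lt_top)
  have hx1 : 1 ≤ ‖x‖ := (not_le.1 (by simpa using hx : ¬‖x‖ ≤ 1)).le
  calc ‖x‖ ^ a * v x ≤ ‖x‖ ^ a * (C * ((1 + ‖x‖) ^ (N + (n + 1)))⁻¹) := by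
        gcongr
        exact hdecay x
    _ = C * (‖x‖ ^ a * ((1 + ‖x‖) ^ (N + (n + 1)))⁻¹) := by ring
    _ ≤ C * ((1 + ‖x‖) ^ (n + 1))⁻¹ := by
        gcongr
        exact rpow_mul_inv_pow_le hN hx1
    _ = C * (1 + ‖x‖) ^ (-((n : ℝ) + 1)) := by
        rw [Real.rpow_neg (by positivity)]
        norm_cast

theorem enorm_rpow_mul {a t : ℝ} (ht : 0 ≤ t) (z : ℂ) :
    ‖((t ^ a : ℝ) : ℂ) * z‖ₑ = ENNReal.ofReal (t ^ a * ‖z‖) := by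
  rw [← ofReal_norm, norm_mul, Complex.norm_real, Real.norm_of_nonneg (by positivity)]

theorem sq_ofReal_rpow_mul (a : ℝ) {t : ℝ} (ht : 0 ≤ t) (y : ℝ≥0∞) :
    (ENNReal.ofReal (t ^ a) * y) ^ 2 = ENNReal.ofReal (t ^ (2 * a)) * y ^ 2 := by
  rw [mul_pow, ← ENNReal.ofReal_pow (by positivity), ← Real.rpow_natCast, ← Real.rpow_mul ht,
    mul_comm a, Nat.cast_ofNat]

theorem enorm_sq_rpow_mul {a t : ℝ} (ht : 0 ≤ t) (z : ℂ) :
    ‖((t ^ a : ℝ) : ℂ) * z‖ₑ ^ 2 = ENNReal.ofReal (t ^ (2 * a)) * ‖z‖ₑ ^ 2 := by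
  rw [enorm_rpow_mul ht, ENNReal.ofReal_mul (by positivity), ofReal_norm, sq_ofReal_rpow_mul a ht]

variable [n.AtLeastTwo] {m : ℕ → ℂ}

theorem PolyGrowth.exists_norm_angularOp_le (hm : PolyGrowth m) (g : 𝓢(Eucl n, ℂ)) (M : ℕ) :
    ∃ C : ℝ, 0 ≤ C ∧ ∀ x, ‖angularOp m g x‖ ≤ C * ((1 + ‖x‖) ^ M)⁻¹ := by
  obtain ⟨C, hC, hbound⟩ := hm.exists_norm_angularMult_le g M
  exact ⟨C, hC, fun x => (norm_onSphere_le _ x).trans (by simpa using hbound ‖x‖)⟩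

theorem PolyGrowth.exists_norm_sq_angularOp_le (hm : PolyGrowth m) (g : 𝓢(Eucl n, ℂ)) (M : ℕ) :
    ∃ C : ℝ, 0 ≤ C ∧ ∀ x, ‖angularOp m g x‖ ^ 2 ≤ C * ((1 + ‖x‖) ^ M)⁻¹ := by
  obtain ⟨C, -, hbound⟩ := hm.exists_norm_angularOp_le g M
  refine ⟨C ^ 2, by positivity, fun x =>
    (pow_le_pow_left₀ (norm_nonneg _) (hbound x) 2).trans ?_⟩
  rw [mul_pow]
  gcongr
  exact pow_le_of_le_one (by positivity) (inv_le_one_of_one_le₀ (one_le_pow₀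
    (le_add_of_nonneg_right (norm_nonneg x)))) two_ne_zero

theorem PolyGrowth.measurable_angularOp (hm : PolyGrowth m) (g : 𝓢(Eucl n, ℂ)) :
    Measurable (angularOp m g) :=
  measurable_onSphere (hm.continuous_angularMult g)

theorem PolyGrowth.lintegral_angularOp_lt_top (hm : PolyGrowth m) (g : 𝓢(Eucl n, ℂ)) {a : ℝ}
    (ha : -(n : ℝ) < a) : ∫⁻ ξ, ENNReal.ofReal (‖ξ‖ ^ a) * ‖angularOp m g ξ‖ₑ ^ 2 < ∞ := by
  refine (lintegral_congr fun x => ?_).trans_lt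
    (lintegral_rpow_mul_lt_top ha (hm.exists_norm_sq_angularOp_le g))
  rw [ENNReal.ofReal_mul (by positivity), ENNReal.ofReal_pow (norm_nonneg _), ofReal_norm]

end Weighted

section Energy

variable {n : ℕ}

theorem lintegral_onSphere [NeZero n] {G : ℝ → C(Sph n, ℂ)} (hG : Continuous G) {w : ℝ → ℝ≥0∞}
    (hw : Measurable w) : ∫⁻ x, w ‖x‖ * ‖onSphere G x‖ₑ ^ 2 =
      ∫⁻ r in Ioi (0 : ℝ), ENNReal.ofReal (r ^ (n - 1)) *
        (w r * ENNReal.ofReal (‖toL2 n (G r)‖ ^ 2)) := by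
  have hmeas := measurable_onSphere hG
  rw [lintegral_eq_lintegral_Ioi_toSphere (by fun_prop), finrank_euclideanSpace_fin]
  refine setLIntegral_congr_fun measurableSet_Ioi fun r hr => ?_
  simp only [onSphere_smul G hr, norm_smul_coe_sphere (le_of_lt hr)]
  rw [lintegral_const_mul _ (by fun_prop), norm_sq_toL2,
    ofReal_integral_eq_lintegral_ofReal (integrable_sphere (by fun_prop))
      (ae_of_all _ fun ω => by positivity)]
  simp only [ENNReal.ofReal_pow (norm_nonneg _), ofReal_norm]

/-- The component of `g` of degree `k` in the angular variable. -/
def harmonicComponent (k : ℕ) (g : 𝓢(Eucl n, ℂ)) : Eucl n → ℂ :=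
  onSphere fun r => harmonicPart n k (restrictSphere g r)

/-- The weighted energy `∫ |ξ|^a |g_k(ξ)|² dξ` of the component `g_k` of `g` of degree `k`. -/
def harmonicEnergy (a : ℝ) (g : 𝓢(Eucl n, ℂ)) (k : ℕ) : ℝ≥0∞ :=
  ∫⁻ ξ, ENNReal.ofReal (‖ξ‖ ^ a) * ‖harmonicComponent k g ξ‖ₑ ^ 2

theorem continuous_harmonicPart_restrictSphere [NeZero n] (g : 𝓢(Eucl n, ℂ)) (k : ℕ) :
    Continuous fun ρ => harmonicPart n k (restrictSphere g ρ) :=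
  (continuous_harmonicPart k).comp (continuous_restrictSphere g)

theorem measurable_norm_toL2_harmonicPart [NeZero n] (g : 𝓢(Eucl n, ℂ)) (k : ℕ) :
    Measurable fun ρ => ‖toL2 n (harmonicPart n k (restrictSphere g ρ))‖ :=
  ((ContinuousMap.toLp (E := ℂ) 2 (surf n) ℂ).continuous.comp
    (continuous_harmonicPart_restrictSphere g k)).norm.measurable

theorem harmonicEnergy_eq_lintegral_Ioi [NeZero n] (a : ℝ) (g : 𝓢(Eucl n, ℂ)) (k : ℕ) :
    harmonicEnergy a g k = ∫⁻ r in Ioi (0 : ℝ), ENNReal.ofReal (r ^ (n - 1)) *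
      (ENNReal.ofReal (r ^ a) *
        ENNReal.ofReal (‖toL2 n (harmonicPart n k (restrictSphere g r))‖ ^ 2)) :=
  lintegral_onSphere (w := fun r => ENNReal.ofReal (r ^ a))
    (continuous_harmonicPart_restrictSphere g k) (by fun_prop)

theorem angularOp_single (k : ℕ) (g : 𝓢(Eucl n, ℂ)) :
    angularOp (Pi.single k 1) g = harmonicComponent k g := by
  simp only [angularOp, angularMult_single, harmonicComponent]

variable [n.AtLeastTwo] {m : ℕ → ℂ}

theorem tsum_norm_sq_harmonicPart (g : C(Sph n, ℂ)) :
    ENNReal.ofReal (‖toL2 n g‖ ^ 2) =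
      ∑' k, ENNReal.ofReal (‖toL2 n (harmonicPart n k g)‖ ^ 2) := by
  have hsum := hasSum_norm_sq_harmonicPart g
  simp only [← norm_sq_toL2] at hsum
  rw [← hsum.tsum_eq, ENNReal.ofReal_tsum_of_nonneg (fun k => by positivity) hsum.summable]

theorem PolyGrowth.norm_sq_toL2_angularMult (hm : PolyGrowth m) (g : 𝓢(Eucl n, ℂ)) (r : ℝ) :
    ENNReal.ofReal (‖toL2 n (angularMult m (restrictSphere g r))‖ ^ 2) =
      ∑' k, ‖m k‖ₑ ^ 2 * ENNReal.ofReal (‖toL2 n (harmonicPart n k (restrictSphere g r))‖ ^ 2) := by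
  rw [tsum_norm_sq_harmonicPart]
  refine tsum_congr fun k => ?_
  rw [hm.harmonicPart_angularMult, map_smul, norm_smul, mul_pow,
    ENNReal.ofReal_mul (by positivity), ENNReal.ofReal_pow (norm_nonneg _), ofReal_norm]

theorem PolyGrowth.lintegral_angularOp_eq_tsum (hm : PolyGrowth m) (g : 𝓢(Eucl n, ℂ)) (a : ℝ) :
    ∫⁻ ξ, ENNReal.ofReal (‖ξ‖ ^ a) * ‖angularOp m g ξ‖ₑ ^ 2 =
      ∑' k, ‖m k‖ₑ ^ 2 * harmonicEnergy a g k := by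
  have hmeas (k : ℕ) : Measurable fun r : ℝ => ENNReal.ofReal (r ^ (n - 1)) *
      (ENNReal.ofReal (r ^ a) *
        ENNReal.ofReal (‖toL2 n (harmonicPart n k (restrictSphere g r))‖ ^ 2)) := by
    have := measurable_norm_toL2_harmonicPart g k
    fun_prop
  have hpolar := lintegral_onSphere (w := fun r => ENNReal.ofReal (r ^ a))
    (hm.continuous_angularMult g) (by fun_prop)
  simp only [harmonicEnergy_eq_lintegral_Ioi, ← lintegral_const_mul _ (hmeas _)]
  rw [← lintegral_tsum fun k => ((hmeas k).const_mul _).aemeasurable]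
  refine hpolar.trans (lintegral_congr fun r => ?_)
  rw [hm.norm_sq_toL2_angularMult, ← ENNReal.tsum_mul_left, ← ENNReal.tsum_mul_left]
  exact tsum_congr fun k => by ring

theorem tsum_harmonicEnergy_eq_lintegral (a s : ℝ) (g : 𝓢(Eucl n, ℂ)) :
    ∑' k, ENNReal.ofReal ((1 + sphEigenvalue n k) ^ s) * harmonicEnergy a g k =
      ∫⁻ ξ, ENNReal.ofReal (‖ξ‖ ^ a) * ‖angularOp (angularSymbol n s) g ξ‖ₑ ^ 2 := by
  rw [(polyGrowth_angularSymbol n s).lintegral_angularOp_eq_tsum]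
  refine tsum_congr fun k => ?_
  have hk := sphEigenvalue_nonneg n k
  have hsymbol := enorm_sq_rpow_mul (a := s / 2) (t := 1 + sphEigenvalue n k) (by positivity) 1
  rw [mul_one, enorm_one, one_pow, mul_one, mul_div_cancel₀ s two_ne_zero] at hsymbol
  rw [angularSymbol, hsymbol]

end Energy

section Plancherel

variable {n : ℕ} [n.AtLeastTwo]

/-- The Fourier transform of `D^a Λ_ω^s f`, in terms of the Fourier transform `g` of `f`. -/
def fracAngularSymbol (a s : ℝ) (g : 𝓢(Eucl n, ℂ)) (ξ : Eucl n) : ℂ :=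
  (((2 * Real.pi * ‖ξ‖) ^ a : ℝ) : ℂ) * angularOp (angularSymbol n s) g ξ

theorem fracD_angularPow (a s : ℝ) (f : 𝓢(Eucl n, ℂ)) :
    fracD a (angularPow s f) = 𝓕⁻ (fracAngularSymbol a s (𝓕 f)) := by
  have hfourier : 𝓕 (angularPow s f) = 𝓕 (angularOp (angularSymbol n s) f) := by
    ext ξ
    simp only [Real.fourier_eq]
    exact integral_congr_ae ((angularPow_ae_eq s f).mono fun x hx => by simp only [hx])
  ext y
  rw [fracD, Real.fourierInv_eq, Real.fourierInv_eq]
  refine integral_congr_ae (ae_ne_zero.mono fun ξ hξ => ?_)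
  simp only [fracAngularSymbol]
  rw [hfourier, (polyGrowth_angularSymbol n s).fourier_angularOp f hξ]

theorem measurable_fracAngularSymbol (a s : ℝ) (g : 𝓢(Eucl n, ℂ)) :
    Measurable (fracAngularSymbol a s g) := by
  have := (polyGrowth_angularSymbol n s).measurable_angularOp g
  unfold fracAngularSymbol
  fun_prop

theorem lintegral_enorm_sq_fracAngularSymbol (a s : ℝ) (g : 𝓢(Eucl n, ℂ)) :
    ∫⁻ ξ, ‖fracAngularSymbol a s g ξ‖ₑ ^ 2 = ENNReal.ofReal ((2 * Real.pi) ^ (2 * a)) *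
      ∫⁻ ξ, ENNReal.ofReal (‖ξ‖ ^ (2 * a)) * ‖angularOp (angularSymbol n s) g ξ‖ₑ ^ 2 := by
  have := (polyGrowth_angularSymbol n s).measurable_angularOp g
  rw [← lintegral_const_mul _ (by fun_prop)]
  refine lintegral_congr fun ξ => ?_
  rw [fracAngularSymbol, enorm_sq_rpow_mul (by positivity),
    Real.mul_rpow (by positivity) (norm_nonneg _), ENNReal.ofReal_mul (by positivity), mul_assoc]

theorem integrable_fracAngularSymbol {a : ℝ} (ha : -(n : ℝ) < a) (s : ℝ) (g : 𝓢(Eucl n, ℂ)) :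
    Integrable (fracAngularSymbol a s g) := by
  refine ⟨(measurable_fracAngularSymbol a s g).aestronglyMeasurable, ?_⟩
  have hfinite := lintegral_rpow_mul_lt_top ha
    ((polyGrowth_angularSymbol n s).exists_norm_angularOp_le g)
  have := (polyGrowth_angularSymbol n s).measurable_angularOp g
  refine Eq.trans_lt ?_
    (ENNReal.mul_lt_top (ENNReal.ofReal_lt_top (r := (2 * Real.pi) ^ a)) hfinite)
  rw [← lintegral_const_mul _ (by fun_prop)]
  refine lintegral_congr fun ξ => ?_
  rw [fracAngularSymbol, enorm_rpow_mul (by positivity),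
    Real.mul_rpow (by positivity) (norm_nonneg _), ← ENNReal.ofReal_mul (by positivity), mul_assoc]

theorem memLp_two_fracAngularSymbol {a : ℝ} (ha : -(n : ℝ) < 2 * a) (s : ℝ) (g : 𝓢(Eucl n, ℂ)) :
    MemLp (fracAngularSymbol a s g) 2 := by
  refine ⟨(measurable_fracAngularSymbol a s g).aestronglyMeasurable, ?_⟩
  have hsq : eLpNorm (fracAngularSymbol a s g) 2 volume ^ 2 < ∞ := by
    rw [eLpNorm_two_sq, lintegral_enorm_sq_fracAngularSymbol]
    exact ENNReal.mul_lt_top ENNReal.ofReal_lt_top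
      ((polyGrowth_angularSymbol n s).lintegral_angularOp_lt_top g ha)
  exact (ENNReal.pow_lt_top_iff.1 hsq).resolve_right two_ne_zero

theorem eLpNorm_fracD_angularPow_sq {a : ℝ} (ha : -(n : ℝ) < 2 * a) (s : ℝ) (f : 𝓢(Eucl n, ℂ)) :
    eLpNorm (fracD a (angularPow s f)) 2 volume ^ 2 =
      ENNReal.ofReal ((2 * Real.pi) ^ (2 * a)) *
        ∑' k, ENNReal.ofReal ((1 + sphEigenvalue n k) ^ s) * harmonicEnergy (2 * a) (𝓕 f) k := by
  have ha' : -(n : ℝ) < a := by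
    rcases le_total 0 a <;> linarith [two_le_cast n]
  rw [fracD_angularPow, eLpNorm_fourierInv_eq (integrable_fracAngularSymbol ha' s _)
    (memLp_two_fracAngularSymbol ha s _), eLpNorm_two_sq, lintegral_enorm_sq_fracAngularSymbol,
    tsum_harmonicEnergy_eq_lintegral]

end Plancherel

section Estimates

variable {n : ℕ}

theorem lintegral_rpow_comp_smul (b : ℝ) {c : ℝ} (hc : c ≠ 0) {G : Eucl n → ℝ≥0∞}
    (hG : Measurable G) : ∫⁻ ξ, ENNReal.ofReal (‖ξ‖ ^ (-b)) * G (c • ξ) =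
      ENNReal.ofReal (|c| ^ (b - n)) * ∫⁻ ξ, ENNReal.ofReal (‖ξ‖ ^ (-b)) * G ξ := by
  have hc' : 0 < |c| := abs_pos.2 hc
  set H : Eucl n → ℝ≥0∞ := fun x =>
    ENNReal.ofReal (|c| ^ b) * (ENNReal.ofReal (‖x‖ ^ (-b)) * G x)
  have hH (ξ : Eucl n) : ENNReal.ofReal (‖ξ‖ ^ (-b)) * G (c • ξ) = H (c • ξ) := by
    simp only [H, norm_smul, Real.norm_eq_abs]
    rw [Real.mul_rpow hc'.le (norm_nonneg _), ← mul_assoc, ← ENNReal.ofReal_mul (by positivity),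
      ← mul_assoc, ← Real.rpow_add hc', add_neg_cancel, Real.rpow_zero, one_mul]
  have hmap : ∫⁻ ξ, H (c • ξ) = ∫⁻ x, H x ∂(Measure.map (c • ·) volume) :=
    (lintegral_map (by fun_prop) (measurable_const_smul c)).symm
  simp only [hH]
  rw [hmap, Measure.map_addHaar_smul volume hc, lintegral_smul_measure,
    lintegral_const_mul _ (by fun_prop), smul_eq_mul, ← mul_assoc,
    ← ENNReal.ofReal_mul (by positivity)]
  congr 2
  rw [finrank_euclideanSpace_fin, abs_inv, abs_pow, Real.rpow_sub hc', Real.rpow_natCast]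
  field_simp

theorem sq_lintegral_rpow_mul_le [NeZero n] (e b : ℝ) {A B : Eucl n → ℝ≥0∞} (hA : Measurable A)
    (hB : Measurable B) : (∫⁻ ξ, ENNReal.ofReal (‖ξ‖ ^ e) * (A ξ * B ξ)) ^ 2 ≤
      (∫⁻ ξ, ENNReal.ofReal (‖ξ‖ ^ (2 * e + b)) * A ξ ^ 2) *
        ∫⁻ ξ, ENNReal.ofReal (‖ξ‖ ^ (-b)) * B ξ ^ 2 := by
  have hsplit : ∫⁻ ξ, ENNReal.ofReal (‖ξ‖ ^ e) * (A ξ * B ξ) =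
      ∫⁻ ξ, (ENNReal.ofReal (‖ξ‖ ^ (e + b / 2)) * A ξ) *
        (ENNReal.ofReal (‖ξ‖ ^ (-b / 2)) * B ξ) := by
    refine lintegral_congr_ae (ae_ne_zero.mono fun ξ hξ => ?_)
    have hrpow : ‖ξ‖ ^ e = ‖ξ‖ ^ (e + b / 2) * ‖ξ‖ ^ (-b / 2) := by
      rw [← Real.rpow_add (norm_pos_iff.2 hξ)]
      congr 1
      ring
    simp only [hrpow]
    rw [ENNReal.ofReal_mul (by positivity)]
    ring
  rw [hsplit]
  refine (sq_lintegral_mul_le (by fun_prop) (by fun_prop)).trans_eq ?_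
  simp only [sq_ofReal_rpow_mul _ (norm_nonneg _)]
  congr 3 <;> ring_nf

variable [n.AtLeastTwo]

theorem fourier_harmonicComponent (f : 𝓢(Eucl n, ℂ)) (k : ℕ) {ξ : Eucl n} (hξ : ξ ≠ 0) :
    𝓕 (harmonicComponent k f) ξ = harmonicComponent k (𝓕 f) ξ := by
  simpa only [angularOp_single] using (polyGrowth_single k).fourier_angularOp f hξ

theorem integrable_harmonicComponent (f : 𝓢(Eucl n, ℂ)) (k : ℕ) :
    Integrable (harmonicComponent k f) :=
  angularOp_single k f ▸ (polyGrowth_single k).integrable_angularOp f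

theorem measurable_harmonicComponent (f : 𝓢(Eucl n, ℂ)) (k : ℕ) :
    Measurable (harmonicComponent k f) :=
  angularOp_single k f ▸ (polyGrowth_single k).measurable_angularOp f

theorem harmonicEnergy_ne_top {a : ℝ} (ha : -(n : ℝ) < a) (f : 𝓢(Eucl n, ℂ)) (k : ℕ) :
    harmonicEnergy a f k ≠ ∞ := by
  simpa only [harmonicEnergy, angularOp_single] using
    ((polyGrowth_single k).lintegral_angularOp_lt_top f ha).ne

theorem exists_sq_lintegral_mul_sphFourier_le {b : ℝ} (hb : 1 < b) (hbn : b < n) : ∃ C : ℝ, 0 ≤ C ∧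
    ∀ (e : ℝ) (g : 𝓢(Eucl n, ℂ)) (k : ℕ) (Y : C(Sph n, ℂ)), Y ∈ sphericalHarmonics n k →
      ∀ c : ℝ, c ≠ 0 →
        (∫⁻ ξ, ENNReal.ofReal (‖ξ‖ ^ e) *
          (‖harmonicComponent k g ξ‖ₑ * ‖sphFourier Y (c • ξ)‖ₑ)) ^ 2 ≤
          harmonicEnergy (2 * e + b) g k *
            ENNReal.ofReal (C * (k + 1 : ℝ) ^ (1 - b) * |c| ^ (b - n) * ‖toL2 n Y‖ ^ 2) := by
  obtain ⟨C, hC, hrestriction⟩ := exists_lintegral_sphFourier_le (n := n) hb hbn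
  refine ⟨C, hC, fun e g k Y hY c hc => ?_⟩
  refine (sq_lintegral_rpow_mul_le e b (measurable_harmonicComponent g k).enorm
    (B := fun ξ => ‖sphFourier Y (c • ξ)‖ₑ) (Continuous.measurable (by fun_prop))).trans ?_
  refine mul_le_mul' le_rfl ?_
  rw [lintegral_rpow_comp_smul b hc (G := fun ξ => ‖sphFourier Y ξ‖ₑ ^ 2)
    (Continuous.measurable (by fun_prop))]
  refine (mul_le_mul' le_rfl (hrestriction k Y hY)).trans_eq ?_
  rw [← ENNReal.ofReal_mul (by positivity)]
  congr 1
  ring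

theorem ofReal_norm_sq_harmonicPart_le (f : 𝓢(Eucl n, ℂ)) (k : ℕ) (r : ℝ) :
    ENNReal.ofReal (‖toL2 n (harmonicPart n k (restrictSphere f r))‖ ^ 2) ≤
      ∫⁻ ξ, ‖harmonicComponent k (𝓕 f) ξ‖ₑ *
        ‖sphFourier (star (harmonicPart n k (restrictSphere f r))) ((-r) • ξ)‖ₑ := by
  set Y := harmonicPart n k (restrictSphere f r) with hY
  have hcomponent : ((‖toL2 n Y‖ ^ 2 : ℝ) : ℂ) =
      ∫ ξ, harmonicComponent k (𝓕 f) ξ * sphFourier (star Y) ((-r) • ξ) := by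
    have hsingle := (polyGrowth_single k).integral_angularOp_mul_sphFourier (𝓕 f)
      (star_mem_sphericalHarmonics (harmonicPart_mem k (restrictSphere f r))) (-r)
    rw [Pi.single_eq_same, one_mul, angularOp_single] at hsingle
    rw [hY, norm_sq_harmonicPart_eq, hsingle]
  calc ENNReal.ofReal (‖toL2 n Y‖ ^ 2) = ‖((‖toL2 n Y‖ ^ 2 : ℝ) : ℂ)‖ₑ := by
        rw [← ofReal_norm, Complex.norm_real, Real.norm_of_nonneg (by positivity)]
    _ ≤ ∫⁻ ξ, ‖harmonicComponent k (𝓕 f) ξ * sphFourier (star Y) ((-r) • ξ)‖ₑ := by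
        rw [hcomponent]
        exact enorm_integral_le_lintegral_enorm _
    _ = _ := by simp only [enorm_mul]

theorem exists_norm_sq_toL2_harmonicPart_le {b : ℝ} (hb : 1 < b) (hbn : b < n) : ∃ C : ℝ, 0 ≤ C ∧
    ∀ (f : 𝓢(Eucl n, ℂ)) (k : ℕ) (r : ℝ), 0 < r →
      ENNReal.ofReal (‖toL2 n (harmonicPart n k (restrictSphere f r))‖ ^ 2) ≤
        ENNReal.ofReal (C * (k + 1 : ℝ) ^ (1 - b) * r ^ (b - n)) *
          harmonicEnergy b (𝓕 f) k := by
  obtain ⟨C, hC, hcauchy⟩ := exists_sq_lintegral_mul_sphFourier_le (n := n) hb hbn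
  refine ⟨C, hC, fun f k r hr => le_of_sq_le_mul_self ENNReal.ofReal_ne_top ?_⟩
  have hstar := hcauchy 0 (𝓕 f) k (star (harmonicPart n k (restrictSphere f r)))
    (star_mem_sphericalHarmonics (harmonicPart_mem k _)) (-r) (neg_ne_zero.2 hr.ne')
  simp only [Real.rpow_zero, ENNReal.ofReal_one, one_mul, mul_zero, zero_add, abs_neg,
    abs_of_pos hr, norm_toL2_star] at hstar
  refine ((pow_le_pow_left' (ofReal_norm_sq_harmonicPart_le f k r) 2).trans hstar).trans_eq ?_
  rw [ENNReal.ofReal_mul (by positivity)]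
  ring

theorem enorm_harmonicComponent_fourier_le (f : 𝓢(Eucl n, ℂ)) (k : ℕ) {ξ : Eucl n} (hξ : ξ ≠ 0) :
    ‖harmonicComponent k (𝓕 f) ξ‖ₑ ≤ ∫⁻ r in Ioi (0 : ℝ), ENNReal.ofReal (r ^ (n - 1)) *
      ‖sphFourier (harmonicPart n k (restrictSphere f r)) (r • ξ)‖ₑ := by
  have hint : Integrable fun x =>
      Complex.exp (↑(-2 * Real.pi * inner ℝ x ξ) * Complex.I) • harmonicComponent k f x :=
    (integrable_harmonicComponent f k).bdd_mul (c := 1)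
      (Continuous.aestronglyMeasurable (by fun_prop))
      (ae_of_all _ fun x => (Complex.norm_exp_ofReal_mul_I _).le)
  rw [← fourier_harmonicComponent f k hξ, Real.fourier_eq',
    integral_eq_integral_Ioi_toSphere hint, finrank_euclideanSpace_fin]
  refine (enorm_integral_le_lintegral_enorm _).trans_eq ?_
  refine setLIntegral_congr_fun measurableSet_Ioi fun r hr => ?_
  simp only [harmonicComponent, onSphere_smul _ hr]
  rw [enorm_smul, Real.enorm_of_nonneg (pow_nonneg (le_of_lt hr) _), sphFourier]
  simp only [real_inner_smul_left, inner_smul_right, smul_eq_mul]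

theorem continuous_sphFourier_harmonicPart (f : 𝓢(Eucl n, ℂ)) (k : ℕ) :
    Continuous fun p : Eucl n × ℝ =>
      sphFourier (harmonicPart n k (restrictSphere f p.2)) (p.2 • p.1) := by
  have hcont := continuous_harmonicPart_restrictSphere f k
  refine continuous_integral_sphere (Continuous.mul (by fun_prop) ?_)
  exact ContinuousEval.continuous_eval.comp
    (Continuous.prodMk (hcont.comp (by fun_prop)) (by fun_prop))

theorem harmonicEnergy_fourier_le (a : ℝ) (f : 𝓢(Eucl n, ℂ)) (k : ℕ) :
    harmonicEnergy a (𝓕 f) k ≤ ∫⁻ r in Ioi (0 : ℝ), ENNReal.ofReal (r ^ (n - 1)) *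
      ∫⁻ ξ, ENNReal.ofReal (‖ξ‖ ^ a) * ‖harmonicComponent k (𝓕 f) ξ‖ₑ *
        ‖sphFourier (harmonicPart n k (restrictSphere f r)) (r • ξ)‖ₑ := by
  have hcomponent := measurable_harmonicComponent (𝓕 f) k
  rw [← lintegral_mul_lintegral_swap (by fun_prop) (by fun_prop)
    (continuous_sphFourier_harmonicPart f k).enorm.measurable]
  refine lintegral_mono_ae (ae_ne_zero.mono fun ξ hξ => ?_)
  rw [pow_two, ← mul_assoc]
  gcongr
  exact enorm_harmonicComponent_fourier_le f k hξ

theorem exists_harmonicEnergy_neg_le {b : ℝ} (hb : 1 < b) (hbn : b < n) : ∃ C : ℝ, 0 ≤ C ∧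
    ∀ (f : 𝓢(Eucl n, ℂ)) (k : ℕ), harmonicEnergy (-b) (𝓕 f) k ≤
      ENNReal.ofReal (C * (k + 1 : ℝ) ^ (1 - b)) *
        (∫⁻ r in Ioi (0 : ℝ), ENNReal.ofReal (r ^ (n - 1)) * ENNReal.ofReal (r ^ ((b - n) / 2)) *
          ENNReal.ofReal ‖toL2 n (harmonicPart n k (restrictSphere f r))‖) ^ 2 := by
  obtain ⟨C, hC, hcauchy⟩ := exists_sq_lintegral_mul_sphFourier_le (n := n) hb hbn
  refine ⟨C, hC, fun f k => le_of_sq_le_mul_self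
    (harmonicEnergy_ne_top (neg_lt_neg hbn) (𝓕 f) k) ?_⟩
  set Y := fun r => harmonicPart n k (restrictSphere f r)
  set N := harmonicEnergy (-b) (𝓕 f) k
  set K := N * ENNReal.ofReal (C * (k + 1 : ℝ) ^ (1 - b))
  have hmeas : Measurable fun r => ‖toL2 n (Y r)‖ := measurable_norm_toL2_harmonicPart f k
  have hradial (r : ℝ) (hr : 0 < r) : ∫⁻ ξ, ENNReal.ofReal (‖ξ‖ ^ (-b)) *
      (‖harmonicComponent k (𝓕 f) ξ‖ₑ * ‖sphFourier (Y r) (r • ξ)‖ₑ) ≤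
        K ^ (1 / 2 : ℝ) * (ENNReal.ofReal (r ^ ((b - n) / 2)) * ENNReal.ofReal ‖toL2 n (Y r)‖) := by
    have hr' := hcauchy (-b) (𝓕 f) k (Y r) (harmonicPart_mem k _) r hr.ne'
    rw [abs_of_pos hr, show 2 * -b + b = -b by ring] at hr'
    refine (ENNReal.pow_le_pow_left_iff two_ne_zero).1 (hr'.trans_eq ?_)
    rw [mul_pow, rpow_half_sq, sq_ofReal_rpow_mul _ hr.le, mul_div_cancel₀ _ two_ne_zero,
      ← ENNReal.ofReal_pow (norm_nonneg _), ENNReal.ofReal_mul (by positivity),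
      ENNReal.ofReal_mul (by positivity)]
    simp only [K, N, mul_assoc]
  have hN : N ≤ K ^ (1 / 2 : ℝ) * ∫⁻ r in Ioi (0 : ℝ), ENNReal.ofReal (r ^ (n - 1)) *
      ENNReal.ofReal (r ^ ((b - n) / 2)) * ENNReal.ofReal ‖toL2 n (Y r)‖ := by
    rw [← lintegral_const_mul _ (by fun_prop)]
    refine (harmonicEnergy_fourier_le (-b) f k).trans
      (setLIntegral_mono' measurableSet_Ioi fun r hr => ?_)
    simp only [mul_assoc (ENNReal.ofReal (‖_‖ ^ (-b)))]
    refine (mul_le_mul' le_rfl (hradial r hr)).trans_eq ?_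
    ring
  refine (pow_le_pow_left' hN 2).trans_eq ?_
  rw [mul_pow, rpow_half_sq, mul_assoc]

end Estimates

section Comparison

variable {n : ℕ}

theorem eLpNorm_two_eq_norm_toL2 (g : C(Sph n, ℂ)) :
    eLpNorm g 2 (surf n) = ENNReal.ofReal ‖toL2 n g‖ := by
  have hcoe : (toL2 n g : Sph n → ℂ) =ᵐ[surf n] g := ContinuousMap.coeFn_toLp (surf n) g
  rw [ofReal_norm, Lp.enorm_def, eLpNorm_congr_ae hcoe]

theorem sphereNorm_top_le (f : 𝓢(Eucl n, ℂ)) (r : ℝ) :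
    sphereNorm ∞ f r ≤ ‖restrictSphere f r‖ₑ := by
  rw [sphereNorm, eLpNorm_exponent_top]
  refine eLpNormEssSup_le_of_ae_enorm_bound (ae_of_all _ fun ω => ?_)
  rw [← ofReal_norm, ← ofReal_norm]
  exact ENNReal.ofReal_le_ofReal ((restrictSphere f r).norm_coe_le_norm ω)

theorem mixedNorm_rpow_mul (a : ℝ) (f : 𝓢(Eucl n, ℂ)) :
    mixedNorm (fun x => ((‖x‖ ^ a : ℝ) : ℂ) * f x) = ∫⁻ r in Ioi (0 : ℝ),
      ENNReal.ofReal (r ^ (n - 1)) * ENNReal.ofReal (r ^ a) *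
        ENNReal.ofReal ‖toL2 n (restrictSphere f r)‖ := by
  refine setLIntegral_congr_fun measurableSet_Ioi fun r (hr : 0 < r) => ?_
  have hsmul : (fun ω : Sph n => ((‖r • (ω : Eucl n)‖ ^ a : ℝ) : ℂ) * f (r • (ω : Eucl n))) =
      ((r ^ a : ℝ) : ℂ) • ⇑(restrictSphere f r) := by
    ext ω
    rw [norm_smul_coe_sphere hr.le]
    rfl
  simp only [sphereNorm]
  rw [hsmul, eLpNorm_const_smul, eLpNorm_two_eq_norm_toL2, ← ofReal_norm, Complex.norm_real,
    Real.norm_of_nonneg (by positivity)]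
  ring

variable [n.AtLeastTwo]

theorem succ_rpow_one_sub_le (n : ℕ) [n.AtLeastTwo] {b : ℝ} (hb : 1 ≤ b) (k : ℕ) :
    (k + 1 : ℝ) ^ (1 - b) ≤ (n : ℝ) ^ ((b - 1) / 2) * (1 + sphEigenvalue n k) ^ ((1 - b) / 2) := by
  have hk := sphEigenvalue_nonneg n k
  have hn : (0 : ℝ) < n := by linarith [two_le_cast n]
  calc (k + 1 : ℝ) ^ (1 - b) = ((k + 1 : ℝ) ^ 2) ^ ((1 - b) / 2) := by
        rw [← Real.rpow_ofNat, ← Real.rpow_mul (by positivity), mul_div_cancel₀ _ two_ne_zero]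
    _ ≤ ((1 + sphEigenvalue n k) / n) ^ ((1 - b) / 2) := by
        refine Real.rpow_le_rpow_of_nonpos (by positivity) ?_ (by linarith)
        rw [div_le_iff₀' hn]
        exact one_add_sphEigenvalue_le n k
    _ = _ := by
        rw [Real.div_rpow (by positivity) hn.le, div_eq_inv_mul, ← Real.rpow_neg hn.le]
        congr 2
        ring

theorem succ_rpow_two_mul_le (n : ℕ) [n.AtLeastTwo] {s : ℝ} (hs : 0 ≤ s) (k : ℕ) :
    (k + 1 : ℝ) ^ (2 * s) ≤ 2 ^ s * (1 + sphEigenvalue n k) ^ s := by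
  have hk := sphEigenvalue_nonneg n k
  rw [Real.rpow_mul (by positivity), Real.rpow_ofNat, ← Real.mul_rpow (by positivity)
    (by positivity)]
  refine Real.rpow_le_rpow (by positivity) ?_ hs
  linarith [le_one_add_sphEigenvalue n k]

theorem tsum_harmonicEnergy_le_eLpNorm_sq {b : ℝ} (hb : 0 ≤ b) (s : ℝ) (f : 𝓢(Eucl n, ℂ)) :
    ∑' k, ENNReal.ofReal ((1 + sphEigenvalue n k) ^ s) * harmonicEnergy b (𝓕 f) k ≤
      eLpNorm (fracD (b / 2) (angularPow s f)) 2 volume ^ 2 := by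
  rw [eLpNorm_fracD_angularPow_sq (by linarith [two_le_cast n]), mul_div_cancel₀ b two_ne_zero]
  refine le_mul_of_one_le_left' (ENNReal.one_le_ofReal.2 ?_)
  exact Real.one_le_rpow (by linarith [Real.two_le_pi]) hb

theorem eLpNorm_sq_le_tsum_harmonicEnergy {b : ℝ} (hb : 0 ≤ b) (hbn : b < n) (s : ℝ)
    (f : 𝓢(Eucl n, ℂ)) : eLpNorm (fracD (-b / 2) (angularPow s f)) 2 volume ^ 2 ≤
      ∑' k, ENNReal.ofReal ((1 + sphEigenvalue n k) ^ s) * harmonicEnergy (-b) (𝓕 f) k := by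
  rw [eLpNorm_fracD_angularPow_sq (by linarith), mul_div_cancel₀ _ two_ne_zero]
  refine mul_le_of_le_one_left' (ENNReal.ofReal_le_one.2 ?_)
  exact Real.rpow_le_one_of_one_le_of_nonpos (by linarith [Real.two_le_pi]) (by linarith)

end Comparison

section SphereEstimates

variable {n : ℕ} [n.AtLeastTwo]

theorem exists_sphereNorm_two_le {b : ℝ} (hb : 1 < b) (hbn : b < n) : ∃ C : ℝ≥0,
    ∀ f : 𝓢(Eucl n, ℂ), (⨆ (r : ℝ) (_ : 0 < r),
        ENNReal.ofReal (r ^ (((n : ℝ) - b) / 2)) * sphereNorm 2 f r) ≤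
      C * eLpNorm (fracD (b / 2) (angularPow ((1 - b) / 2) f)) 2 volume := by
  obtain ⟨C, hC, hcomponent⟩ := exists_norm_sq_toL2_harmonicPart_le (n := n) hb hbn
  set K := C * (n : ℝ) ^ ((b - 1) / 2)
  refine ⟨NNReal.sqrt K.toNNReal, fun f => iSup₂_le fun r hr => le_nnreal_sqrt_mul_of_sq_le ?_⟩
  have hconst (k : ℕ) : r ^ (n - b) * (C * (k + 1 : ℝ) ^ (1 - b) * r ^ (b - n)) ≤
      K * (1 + sphEigenvalue n k) ^ ((1 - b) / 2) :=
    calc _ = C * (k + 1 : ℝ) ^ (1 - b) * (r ^ (n - b) * r ^ (b - n)) := by ring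
      _ = C * (k + 1 : ℝ) ^ (1 - b) := by
          rw [← Real.rpow_add hr, sub_add_sub_cancel, sub_self, Real.rpow_zero, mul_one]
      _ ≤ C * ((n : ℝ) ^ ((b - 1) / 2) * (1 + sphEigenvalue n k) ^ ((1 - b) / 2)) := by
          gcongr
          exact succ_rpow_one_sub_le n hb.le k
      _ = _ := (mul_assoc _ _ _).symm
  calc _ = ENNReal.ofReal (r ^ (n - b)) *
        ∑' k, ENNReal.ofReal (‖toL2 n (harmonicPart n k (restrictSphere f r))‖ ^ 2) := by
        rw [sq_ofReal_rpow_mul _ hr.le, mul_div_cancel₀ _ two_ne_zero, sphereNorm,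
          ← tsum_norm_sq_harmonicPart, ENNReal.ofReal_pow (norm_nonneg _)]
        exact congrArg (_ * · ^ 2) (eLpNorm_two_eq_norm_toL2 (restrictSphere f r))
    _ ≤ ∑' k, ENNReal.ofReal K * (ENNReal.ofReal ((1 + sphEigenvalue n k) ^ ((1 - b) / 2)) *
          harmonicEnergy b (𝓕 f) k) := by
        rw [← ENNReal.tsum_mul_left]
        refine ENNReal.tsum_le_tsum fun k => (mul_le_mul' le_rfl (hcomponent f k r hr)).trans ?_
        rw [← mul_assoc, ← mul_assoc, ← ENNReal.ofReal_mul (by positivity),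
          ← ENNReal.ofReal_mul (by positivity)]
        exact mul_le_mul' (ENNReal.ofReal_le_ofReal (hconst k)) le_rfl
    _ ≤ _ := by
        rw [ENNReal.tsum_mul_left]
        exact mul_le_mul' le_rfl (tsum_harmonicEnergy_le_eLpNorm_sq (by linarith) _ f)

theorem tsum_sq_lintegral_harmonicPart_le {v : ℝ → ℝ≥0∞} (hv : Measurable v) (f : 𝓢(Eucl n, ℂ)) :
    ∑' k, (∫⁻ r in Ioi (0 : ℝ), v r *
        ENNReal.ofReal ‖toL2 n (harmonicPart n k (restrictSphere f r))‖) ^ 2 ≤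
      (∫⁻ r in Ioi (0 : ℝ), v r * ENNReal.ofReal ‖toL2 n (restrictSphere f r)‖) ^ 2 := by
  refine tsum_sq_lintegral_le
    (fun k => hv.mul (measurable_norm_toL2_harmonicPart f k).ennreal_ofReal) fun r => ?_
  simp only [mul_pow, ← ENNReal.ofReal_pow (norm_nonneg _)]
  rw [ENNReal.tsum_mul_left, ← tsum_norm_sq_harmonicPart]

theorem exists_eLpNorm_le_mixedNorm {b : ℝ} (hb : 1 < b) (hbn : b < n) : ∃ C : ℝ≥0,
    ∀ f : 𝓢(Eucl n, ℂ), eLpNorm (fracD (-b / 2) (angularPow ((b - 1) / 2) f)) 2 volume ≤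
      C * mixedNorm (fun x => ((‖x‖ ^ ((b - (n : ℝ)) / 2) : ℝ) : ℂ) * f x) := by
  obtain ⟨C, hC, henergy⟩ := exists_harmonicEnergy_neg_le (n := n) hb hbn
  set K := C * (n : ℝ) ^ ((b - 1) / 2)
  refine ⟨NNReal.sqrt K.toNNReal, fun f => le_nnreal_sqrt_mul_of_sq_le ?_⟩
  have hconst (k : ℕ) : (1 + sphEigenvalue n k) ^ ((b - 1) / 2) * (C * (k + 1 : ℝ) ^ (1 - b)) ≤
      K := by
    have hk := sphEigenvalue_nonneg n k
    calc _ ≤ (1 + sphEigenvalue n k) ^ ((b - 1) / 2) *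
          (C * ((n : ℝ) ^ ((b - 1) / 2) * (1 + sphEigenvalue n k) ^ ((1 - b) / 2))) := by
          gcongr
          exact succ_rpow_one_sub_le n hb.le k
      _ = K * ((1 + sphEigenvalue n k) ^ ((b - 1) / 2) *
          (1 + sphEigenvalue n k) ^ ((1 - b) / 2)) := by ring
      _ = K := by
          rw [← Real.rpow_add (by positivity), ← add_div, sub_add_sub_cancel, sub_self, zero_div,
            Real.rpow_zero, mul_one]
  rw [mixedNorm_rpow_mul]
  refine (eLpNorm_sq_le_tsum_harmonicEnergy (by linarith) hbn _ f).trans ?_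
  refine le_trans ?_ (mul_le_mul' le_rfl (tsum_sq_lintegral_harmonicPart_le
    (v := fun r => ENNReal.ofReal (r ^ (n - 1)) * ENNReal.ofReal (r ^ ((b - n) / 2)))
    (by fun_prop) f))
  rw [← ENNReal.tsum_mul_left]
  refine ENNReal.tsum_le_tsum fun k => (mul_le_mul' le_rfl (henergy f k)).trans ?_
  have hk := sphEigenvalue_nonneg n k
  rw [← mul_assoc, ← ENNReal.ofReal_mul (by positivity)]
  exact mul_le_mul' (ENNReal.ofReal_le_ofReal (hconst k)) le_rfl

theorem exists_enorm_sq_harmonicPart_le {b : ℝ} (hb : 1 < b) (hbn : b < n) : ∃ C : ℝ, 0 ≤ C ∧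
    ∀ (f : 𝓢(Eucl n, ℂ)) (k : ℕ) (r : ℝ), 0 < r → ‖harmonicPart n k (restrictSphere f r)‖ₑ ^ 2 ≤
      ENNReal.ofReal (C * (k + 1 : ℝ) ^ (n - 1 - b) * r ^ (b - n)) *
        harmonicEnergy b (𝓕 f) k := by
  obtain ⟨C, hC, hcomponent⟩ := exists_norm_sq_toL2_harmonicPart_le (n := n) hb hbn
  obtain ⟨A, hA, hsup⟩ := exists_norm_sq_le_norm_sq_toL2 n
  refine ⟨A * C, by positivity, fun f k r hr => ?_⟩
  set Y := harmonicPart n k (restrictSphere f r)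
  have hexp : (k + 1 : ℝ) ^ (n - 2) * (k + 1 : ℝ) ^ (1 - b) = (k + 1 : ℝ) ^ (n - 1 - b) := by
    rw [← Real.rpow_natCast, ← Real.rpow_add (by positivity), Nat.cast_sub Nat.AtLeastTwo.prop]
    congr 1
    push_cast
    ring
  calc ‖Y‖ₑ ^ 2 = ENNReal.ofReal (‖Y‖ ^ 2) := by
        rw [ENNReal.ofReal_pow (norm_nonneg _), ofReal_norm]
    _ ≤ ENNReal.ofReal (A * (k + 1 : ℝ) ^ (n - 2)) * ENNReal.ofReal (‖toL2 n Y‖ ^ 2) := by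
        rw [← ENNReal.ofReal_mul (by positivity)]
        exact ENNReal.ofReal_le_ofReal (hsup k Y (harmonicPart_mem k _))
    _ ≤ ENNReal.ofReal (A * (k + 1 : ℝ) ^ (n - 2)) *
        (ENNReal.ofReal (C * (k + 1 : ℝ) ^ (1 - b) * r ^ (b - n)) * harmonicEnergy b (𝓕 f) k) :=
        mul_le_mul' le_rfl (hcomponent f k r hr)
    _ = _ := by
        rw [← mul_assoc, ← ENNReal.ofReal_mul (by positivity), ← hexp]
        congr 2
        ring

theorem sq_tsum_le_tsum_rpow_mul {e : ℝ} (he : e < -1) (y : ℕ → ℝ≥0∞) :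
    (∑' k, y k) ^ 2 ≤ ENNReal.ofReal (∑' k : ℕ, (k + 1 : ℝ) ^ e) *
      ∑' k : ℕ, ENNReal.ofReal ((k + 1 : ℝ) ^ (-e)) * y k ^ 2 := by
  have hsummable : Summable fun k : ℕ => (k + 1 : ℝ) ^ e := by
    simpa using (summable_nat_add_iff 1).2 (Real.summable_nat_rpow.2 he)
  have hsplit (k : ℕ) : y k = ENNReal.ofReal ((k + 1 : ℝ) ^ (e / 2)) *
      (ENNReal.ofReal ((k + 1 : ℝ) ^ (-e / 2)) * y k) := by
    rw [← mul_assoc, ← ENNReal.ofReal_mul (by positivity), ← Real.rpow_add (by positivity),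
      ← add_div, add_neg_cancel, zero_div, Real.rpow_zero, ENNReal.ofReal_one, one_mul]
  have hsq (k : ℕ) : ENNReal.ofReal ((k + 1 : ℝ) ^ (e / 2)) ^ 2 =
      ENNReal.ofReal ((k + 1 : ℝ) ^ e) := by
    have := sq_ofReal_rpow_mul (e / 2) k.cast_add_one_pos.le 1
    rwa [mul_one, one_pow, mul_one, mul_div_cancel₀ _ two_ne_zero] at this
  rw [ENNReal.ofReal_tsum_of_nonneg (fun k => by positivity) hsummable, tsum_congr hsplit]
  refine (sq_tsum_mul_le _ _).trans_eq (congrArg₂ _ (tsum_congr hsq) (tsum_congr fun k => ?_))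
  rw [sq_ofReal_rpow_mul _ k.cast_add_one_pos.le, mul_div_cancel₀ _ two_ne_zero]

theorem sphereNorm_top_le_tsum (f : 𝓢(Eucl n, ℂ)) (r : ℝ) :
    sphereNorm ∞ f r ≤ ∑' k, ‖harmonicPart n k (restrictSphere f r)‖ₑ := by
  have hexpansion : restrictSphere f r = ∑' k, harmonicPart n k (restrictSphere f r) := by
    conv_lhs => rw [← angularMult_one f r]
    exact tsum_congr fun k => one_smul ℂ _
  refine (sphereNorm_top_le f r).trans ?_
  conv_lhs => rw [hexpansion]
  exact enorm_tsum_le_tsum_enorm (f := fun k => harmonicPart n k (restrictSphere f r))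

theorem rpow_mul_succ_rpow_mul_le (b : ℝ) {s C r : ℝ} (hs : 0 ≤ s) (hC : 0 ≤ C) (hr : 0 < r)
    (k : ℕ) :
    r ^ (n - b) * (k + 1 : ℝ) ^ (-(n - 1 - b - 2 * s)) *
        (C * (k + 1 : ℝ) ^ (n - 1 - b) * r ^ (b - n)) ≤
      C * 2 ^ s * (1 + sphEigenvalue n k) ^ s :=
  calc _ = C * ((k + 1 : ℝ) ^ (-(n - 1 - b - 2 * s)) * (k + 1 : ℝ) ^ (n - 1 - b)) *
          (r ^ (n - b) * r ^ (b - n)) := by ring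
    _ = C * (k + 1 : ℝ) ^ (2 * s) := by
        rw [← Real.rpow_add hr, ← Real.rpow_add (by positivity), sub_add_sub_cancel, sub_self,
          Real.rpow_zero, mul_one, neg_sub, sub_add_cancel]
    _ ≤ C * (2 ^ s * (1 + sphEigenvalue n k) ^ s) := by
        gcongr
        exact succ_rpow_two_mul_le n hs k
    _ = _ := (mul_assoc _ _ _).symm

theorem exists_sphereNorm_top_le {b : ℝ} (hb : 1 < b) (hbn : b < n) {s : ℝ}
    (hs : ((n : ℝ) - b) / 2 < s) : ∃ C : ℝ≥0,
    ∀ f : 𝓢(Eucl n, ℂ), (⨆ (r : ℝ) (_ : 0 < r),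
        ENNReal.ofReal (r ^ (((n : ℝ) - b) / 2)) * sphereNorm ∞ f r) ≤
      C * eLpNorm (fracD (b / 2) (angularPow s f)) 2 volume := by
  obtain ⟨C, hC, hcomponent⟩ := exists_enorm_sq_harmonicPart_le (n := n) hb hbn
  set e : ℝ := n - 1 - b - 2 * s
  set B := ∑' k : ℕ, (k + 1 : ℝ) ^ e
  have hB : 0 ≤ B := tsum_nonneg fun k => by positivity
  refine ⟨NNReal.sqrt (B * (C * 2 ^ s)).toNNReal,
    fun f => iSup₂_le fun r hr => le_nnreal_sqrt_mul_of_sq_le ?_⟩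
  set Y := fun k => harmonicPart n k (restrictSphere f r)
  have hterm (k : ℕ) :
      ENNReal.ofReal (r ^ (n - b)) * (ENNReal.ofReal ((k + 1 : ℝ) ^ (-e)) * ‖Y k‖ₑ ^ 2) ≤
        ENNReal.ofReal (C * 2 ^ s) *
          (ENNReal.ofReal ((1 + sphEigenvalue n k) ^ s) * harmonicEnergy b (𝓕 f) k) := by
    refine (mul_le_mul' le_rfl (mul_le_mul' le_rfl (hcomponent f k r hr))).trans ?_
    rw [← mul_assoc, ← mul_assoc, ← ENNReal.ofReal_mul (by positivity),
      ← ENNReal.ofReal_mul (by positivity), ← mul_assoc (ENNReal.ofReal (C * 2 ^ s)),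
      ← ENNReal.ofReal_mul (by positivity)]
    exact mul_le_mul' (ENNReal.ofReal_le_ofReal
      (rpow_mul_succ_rpow_mul_le b (by linarith) hC hr k)) le_rfl
  calc _ ≤ ENNReal.ofReal (r ^ (n - b)) * (∑' k, ‖Y k‖ₑ) ^ 2 := by
        rw [sq_ofReal_rpow_mul _ hr.le, mul_div_cancel₀ _ two_ne_zero]
        gcongr
        exact sphereNorm_top_le_tsum f r
    _ ≤ ENNReal.ofReal (r ^ (n - b)) *
        (ENNReal.ofReal B * ∑' k : ℕ, ENNReal.ofReal ((k + 1 : ℝ) ^ (-e)) * ‖Y k‖ₑ ^ 2) :=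
        mul_le_mul' le_rfl (sq_tsum_le_tsum_rpow_mul (by linarith) _)
    _ ≤ ENNReal.ofReal B * (ENNReal.ofReal (C * 2 ^ s) *
        eLpNorm (fracD (b / 2) (angularPow s f)) 2 volume ^ 2) := by
        rw [mul_left_comm, ← ENNReal.tsum_mul_left]
        refine mul_le_mul' le_rfl ((ENNReal.tsum_le_tsum hterm).trans ?_)
        rw [ENNReal.tsum_mul_left]
        exact mul_le_mul' le_rfl (tsum_harmonicEnergy_le_eLpNorm_sq (by linarith) s f)
    _ = _ := by rw [← mul_assoc, ← ENNReal.ofReal_mul hB]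

end SphereEstimates

end AngularSobolev

end

theorem corollary1p2 (n : ℕ) (hn : 2 ≤ n) (b : ℝ) (hb1 : 1 < b) (hbn : b < n) :
    (∃ C : ℝ≥0, ∀ f : 𝓢(AngularSobolev.Eucl n, ℂ),
      (⨆ (r : ℝ) (_ : 0 < r),
          ENNReal.ofReal (r ^ (((n : ℝ) - b) / 2)) * AngularSobolev.sphereNorm 2 f r) ≤
        C * eLpNorm (AngularSobolev.fracD (b / 2)
          (AngularSobolev.angularPow ((1 - b) / 2) f)) 2 volume) ∧
    (∃ C : ℝ≥0, ∀ f : 𝓢(AngularSobolev.Eucl n, ℂ),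
      eLpNorm (AngularSobolev.fracD (-b / 2)
          (AngularSobolev.angularPow ((b - 1) / 2) f)) 2 volume ≤
        C * AngularSobolev.mixedNorm
          (fun x => ((‖x‖ ^ ((b - (n : ℝ)) / 2) : ℝ) : ℂ) * f x)) ∧
    (∀ s : ℝ, ((n : ℝ) - b) / 2 < s →
      ∃ C : ℝ≥0, ∀ f : 𝓢(AngularSobolev.Eucl n, ℂ),
        (⨆ (r : ℝ) (_ : 0 < r),
            ENNReal.ofReal (r ^ (((n : ℝ) - b) / 2)) * AngularSobolev.sphereNorm ∞ f r) ≤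
          C * eLpNorm (AngularSobolev.fracD (b / 2)
            (AngularSobolev.angularPow s f)) 2 volume) := by
  have : n.AtLeastTwo := ⟨hn⟩
  exact ⟨AngularSobolev.exists_sphereNorm_two_le hb1 hbn,
    AngularSobolev.exists_eLpNorm_le_mixedNorm hb1 hbn,
    fun _ hs => AngularSobolev.exists_sphereNorm_top_le hb1 hbn hs⟩
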